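/- Let $G$ be a connected, simply connected, compact simple Lie group with Lie algebra $\mathfrak g$, $d=\dim\mathfrak g$, dual Coxeter number $h^\vee$, let $(e_a)_{a=1}^d$ be a basis of $\mathfrak g$ that is orthonormal for $-\frac1{2h^\vee}\operatorname{tr}(\operatorname{ad}x\operatorname{ad}y)$, let $LG=C^\infty(S^1,G)$, and let $\ell\ge 1$ be an integer. *Representations.* Let $\lambda_0,\dots,\lambda_{N-1}$ be a maximal family of mutually inequivalent irreducible projective unitary positive-energy representations of $LG$ of level $\ell$, i.e. of those to which the irreducible unitary highest weight representations of level $\ell$ of the affine Kac–Moody algebra $\hat{\mathfrak g}_{\mathbb C}$ exponentiate; $\lambda_0$ is the vacuum representation (highest weight $0$). Let $H_i$ be the Hilbert space of $\lambda_i$, let $J^{a,\lambda_i}_n=\mathrm i\,\lambda_i(e_a\otimes t^n)$ be the current modes on finite energy vectors, and let $L_0^{\lambda_i}$ be the conformal Hamiltonian $\frac{1}{2(\ell+h^\vee)}\sum_{a=1}^{d}\sum_{m\in\mathbb Z}{:}J^{a,\lambda_i}_{-m}J^{a,\lambda_i}_{m}{:}$ (closed). Put $\lambda_{\rm red}=\bigoplus_i\lambda_i$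 on $H_{\rm red}=\bigoplus_i H_i$ (a projective representation of $LG$), $L_0^{\lambda_{\rm red}}=\bigoplus_iL_0^{\lambda_i}$, $B_{G_\ell}=\lambda_{\rm red}(LG)''$ and $\mathfrak K_{G_\ell}=B_{G_\ell}\cap K(H_{\rm red})$, where $K(\cdot)$ denotes the compact operators. Let $\pi_{\lambda_i}(x)$ be the restriction of $x\in B_{G_\ell}$ to $H_i$. *Dirac operators.* Let $\pi_R$ be the irreducible graded Ramond representation on $H_R$ of the CAR algebra with modes $F^a_n$ ($1\le a\le 2d$, $n\in\mathbb Z$), so that $F^a_mF^b_n+F^b_nF^a_m=\delta_{m+n,0}\delta_{ab}$, $(F^a_n)^*=F^a_{-n}$. Let $\hat H_i=H_i\otimes H_0\otimes H_R$ and $\hat\pi_{\lambda_i}(x)=\pi_{\lambda_i}(x)\otimes q_\Omega\otimes e_R$ for $x\in B_{G_\ell}$, where $q_\Omega$ is the projection onto the lowest energy vectors $\mathbb C\Omega$ of $\lambda_0$ and $e_R$ is the projection onto the line spanned by a fixed even lowest energy vector of $\pi_R$. Let $J^a_m=J^{a,\lambda_i}_m\otimes1\otimes1$ for $a\le d$ and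 $J^a_m=1\otimes J^{a-d,\lambda_0}_m\otimes1$ for $a>d$, let $f_{abc}$ be the structure constants of $\mathfrak g\oplus\mathfrak g$ in the basis given by two copies of $(e_a)$, let $J'^a_m=-\frac{\mathrm i}{2}\sum_{k\in\mathbb Z}\sum_{b,c=1}^{2d}f_{abc}F^b_kF^c_{m-k}$, and let $D_{\lambda_i}$ be the closure of $$G_0=\frac1{\sqrt{\ell+h^\vee}}\sum_{a=1}^{2d}\sum_{m\in\mathbb Z}\Big(J^a_m+\tfrac13J'^a_m\Big)F^a_{-m}$$ on finite energy vectors. Put $D_{\rm red}=\bigoplus_iD_{\lambda_i}$ on $\hat H_{\rm red}=\bigoplus_i\hat H_i$ and $\hat\pi_{\rm red}=\bigoplus_i\hat\pi_{\lambda_i}$. A bounded operator $x$ on $\hat H_{\rm red}$ lies in $\operatorname{dom}(\delta_{\rm red})$, with $\delta_{\rm red}(x)=y$ bounded, if $xD_{\rm red}\subset D_{\rm red}x-y$. *The algebra.* Let $$\mathfrak K^1_{G_\ell}=\{x\in\mathfrak K_{G_\ell}:\ \hat\pi_{\rm red}(x)\in\operatorname{dom}(\delta_{\rm red}),\ \delta_{\rm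 red}(\hat\pi_{\rm red}(x))\in K(\hat H_{\rm red})\},\qquad \|x\|_1=\|x\|+\|\delta_{\rm red}(\hat\pi_{\rm red}(x))\|.$$ **Proposition.** $(\mathfrak K^1_{G_\ell},\|\cdot\|_1)$ is a Banach algebra, and: 1. it is stably unital: the algebra $M_\infty(\mathfrak K^1_{G_\ell})$ of infinite matrices with finitely many nonzero entries, with any algebra norm that on each $M_r(\mathfrak K^1_{G_\ell})$ induces the topology of entrywise convergence, has a (two-sided, not necessarily bounded) approximate identity of idempotents; 2. for every $n\in\mathbb N$ the spectral projection $e_n$ of $L_0^{\lambda_{\rm red}}$ for the eigenvalues less than $n$ is a finite-rank idempotent in $\mathfrak K^1_{G_\ell}$, and $(e_n)_{n\in\mathbb N}$ is an approximate identity: $\|e_nx-x\|_1\to0$ and $\|xe_n-x\|_1\to0$ for every $x\in\mathfrak K^1_{G_\ell}$; 3. the finite-rank elements are dense in $\mathfrak K^1_{G_\ell}$ for $\|\cdot\|_1$. -/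

import Mathlib

open scoped ContDiff Manifold InnerProductSpace TensorProduct

universe u v

set_option linter.unusedSectionVars false
set_option linter.checkUnivs false

noncomputable section

/-! ### Lie-algebraic preliminaries -/

section LieAlg

variable (g : Type*) [LieRing g] [LieAlgebra ℝ g]

/-- `hv` is the dual Coxeter number of the complexification of `g`, that is `1 + ⟨ρ, θ^∨⟩`, where
`θ` is the highest root and `ρ` is half the sum of the positive roots. -/
def IsDualCoxeterNumber [Module.Finite ℝ g] (hv : ℕ) : Prop :=
  ∃ (_ : LieAlgebra.IsKilling ℂ (ℂ ⊗[ℝ] g)) (H : LieSubalgebra ℂ (ℂ ⊗[ℝ] g))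
    (_ : H.IsCartanSubalgebra) (b : (LieAlgebra.IsKilling.rootSystem H).Base) (θ : H.root),
    b.IsPos θ ∧
    (∀ i ∈ b.support, (LieAlgebra.IsKilling.rootSystem H).root θ +
      (LieAlgebra.IsKilling.rootSystem H).root i ∉
        Set.range (LieAlgebra.IsKilling.rootSystem H).root) ∧
    (hv : ℂ) = 1 + (1 / 2) * ∑ᶠ (β : H.root) (_ : b.IsPos β),
      (LieAlgebra.IsKilling.rootSystem H).pairing β θ

variable {g}

/-- The normalized invariant inner product `-(1 / (2 h^∨)) tr (ad x ad y)` on a compact simple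
Lie algebra with dual Coxeter number `hv`. -/
def normForm (hv : ℕ) (x y : g) : ℝ := -(1 / (2 * (hv : ℝ))) * killingForm ℝ g x y

/-- The structure constants of the Lie algebra `g ⊕ g`, with respect to the basis consisting of
two copies of the basis `e` of `g`. -/
def structConst {d : ℕ} (e : Module.Basis (Fin d) ℝ g) :
    Fin d ⊕ Fin d → Fin d ⊕ Fin d → Fin d ⊕ Fin d → ℝ
  | .inl a, .inl b, .inl c => e.repr ⁅e a, e b⁆ c
  | .inr a, .inr b, .inr c => e.repr ⁅e a, e b⁆ c
  | _, _, _ => 0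

end LieAlg

/-! ### Sums of locally finite families of operators -/

open Classical in
/-- The pointwise sum of a family of endomorphisms such that on every vector only finitely many
members are nonzero (and `0` for other families). -/
def locSum {ι X : Type*} [AddCommGroup X] [Module ℂ X] (T : ι → Module.End ℂ X) :
    Module.End ℂ X :=
  if h : ∀ v, (Function.support fun i => T i v).Finite then
    { toFun := fun v => ∑ᶠ i, T i v
      map_add' := fun v w => by
        simp only [map_add]
        exact finsum_add_distrib (h v) (h w)
      map_smul' := fun c v => by
        simp only [map_smul, RingHom.id_apply]
        exact (smul_finsum c _).symm }
  else 0

/-! ### Hilbert space completions -/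

section HilbC

variable (X : Type*) [NormedAddCommGroup X] [InnerProductSpace ℂ X]

/-- The Hilbert space completion of an inner product space. -/
def HilbC : Type _ := UniformSpace.Completion X

instance : NormedAddCommGroup (HilbC X) :=
  inferInstanceAs (NormedAddCommGroup (UniformSpace.Completion X))

instance : InnerProductSpace ℂ (HilbC X) :=
  inferInstanceAs (InnerProductSpace ℂ (UniformSpace.Completion X))

instance : CompleteSpace (HilbC X) :=
  inferInstanceAs (CompleteSpace (UniformSpace.Completion X))

variable {X}

/-- The inner product of a complex inner product space. -/
abbrev ip (x y : X) : ℂ := @inner ℂ X InnerProductSpace.toInner x y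

/-- The embedding of an inner product space into its completion. -/
def toHilb : X →ₗᵢ[ℂ] HilbC X := UniformSpace.Completion.toComplₗᵢ (𝕜 := ℂ) (E := X)

theorem denseRange_toHilb : DenseRange (toHilb : X → HilbC X) :=
  UniformSpace.Completion.denseRange_coe (α := X)

variable {Y : Type*} [NormedAddCommGroup Y] [InnerProductSpace ℂ Y]

/-- The extension of a bounded operator to the completions. -/
def mapHilb (f : X →L[ℂ] Y) : HilbC X →L[ℂ] HilbC Y :=
  (toHilb.toContinuousLinearMap ∘L f).extend toHilb.toContinuousLinearMap

theorem mapHilb_toHilb (f : X →L[ℂ] Y) (x : X) : mapHilb f (toHilb x) = toHilb (f x) :=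
  ContinuousLinearMap.extend_eq _ (e := (toHilb : X →ₗᵢ[ℂ] HilbC X).toContinuousLinearMap)
    denseRange_toHilb (toHilb : X →ₗᵢ[ℂ] HilbC X).isometry.isUniformInducing x

end HilbC

/-! ### Unitary highest weight representations of affine Kac-Moody algebras -/

/-- Let `g` be a compact simple Lie algebra and let `J n x` (`n : ℤ`, `x ∈ g`) be modes of currents,
`J n x` being `i` times the action of `x ⊗ tⁿ`. Let `ξ₀ ∈ g`; its centralizer (if abelian) is a
Cartan subalgebra of `g`, and the roots with positive value at `i ξ₀` are a system of positive
roots. The vector `v` is a highest weight vector with weight `μ`: it is nonzero and annihilated by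
all positive modes, it is an eigenvector of the Cartan subalgebra, and it is annihilated by all
positive root vectors `x + i y`, i.e. those with `[i ξ₀, x + i y] = r (x + i y)`, `r > 0`. -/
structure IsHighestWeightVector {g V : Type*} [LieRing g] [LieAlgebra ℝ g] [AddCommGroup V]
    [Module ℂ V] (J : ℤ → g →ₗ[ℝ] Module.End ℂ V) (ξ₀ : g) (μ : g → ℂ) (v : V) : Prop where
  ne_zero : v ≠ 0
  pos_mode : ∀ n : ℤ, 0 < n → ∀ x, J n x v = 0
  cartan : ∀ x, ⁅ξ₀, x⁆ = 0 → J 0 x v = μ x • v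
  pos_root : ∀ (r : ℝ) (x y : g), 0 < r → ⁅ξ₀, x⁆ = r • y → ⁅ξ₀, y⁆ = -(r • x) →
    J 0 x v + Complex.I • J 0 y v = 0

/-- `ξ₀` is a regular element of the compact Lie algebra `g`. -/
def IsRegularElt {g : Type*} [LieRing g] (ξ₀ : g) : Prop :=
  ∀ x y : g, ⁅ξ₀, x⁆ = 0 → ⁅ξ₀, y⁆ = 0 → ⁅x, y⁆ = 0

/-- An irreducible unitary highest weight representation, of level `ℓ`, of the affine Kac-Moody
algebra associated with the compact simple Lie algebra `g` of dual Coxeter number `hv`. It is given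
on a complex inner product space `V` by the modes `J n x = i π (x ⊗ tⁿ)`, `x ∈ g`, `n : ℤ`. -/
structure AffineRep (g : Type*) [LieRing g] [LieAlgebra ℝ g] (hv ℓ : ℕ) where
  /-- the underlying inner product space -/
  V : Type u
  [normed : NormedAddCommGroup V]
  [innerProd : InnerProductSpace ℂ V]
  /-- the modes of the currents -/
  J : ℤ → g →ₗ[ℝ] Module.End ℂ V
  comm : ∀ (m n : ℤ) (x y : g) (v : V), J m x (J n y v) - J n y (J m x v) =
    Complex.I • J (m + n) ⁅x, y⁆ v +
      if m + n = 0 then ((m * ℓ * normForm hv x y : ℝ) : ℂ) • v else 0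
  adj : ∀ (n : ℤ) (x : g) (u v : V), ip (J n x u) v = ip u (J (-n) x v)
  irreducible : ∀ S : Submodule ℂ V, (∀ n x, ∀ v ∈ S, J n x v ∈ S) → S = ⊥ ∨ S = ⊤
  highestWeight : ∃ ξ₀ : g, IsRegularElt ξ₀ ∧ ∃ μ v, IsHighestWeightVector J ξ₀ μ v

attribute [instance] AffineRep.normed AffineRep.innerProd

namespace AffineRep

variable {g : Type*} [LieRing g] [LieAlgebra ℝ g] {hv ℓ : ℕ} (π : AffineRep g hv ℓ)

/-- The Hilbert space of the representation. -/
abbrev Hilb : Type _ := HilbC π.V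

/-- The vacuum representation is the one with highest weight `0`. -/
def IsVacuum : Prop :=
  ∃ ξ₀ : g, IsRegularElt ξ₀ ∧ ∃ v, IsHighestWeightVector π.J ξ₀ (fun _ => 0) v

/-- The conformal Hamiltonian on finite energy vectors, given by the Sugawara formula
`(1 / (2 (ℓ + h^∨))) ∑ₘ ∑ₐ :Jᵃ₋ₘ Jᵃₘ:` for an orthonormal basis `e` of `g`. -/
def L0 {d : ℕ} (e : Module.Basis (Fin d) ℝ g) : Module.End ℂ π.V :=
  (1 / (2 * ((ℓ : ℂ) + hv))) • locSum fun m : ℤ => ∑ a, π.J (-|m|) (e a) * π.J |m| (e a)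

/-- `v` is an eigenvector of `L0` for its lowest eigenvalue. -/
def IsLowestEnergy {d : ℕ} (e : Module.Basis (Fin d) ℝ g) (v : π.V) : Prop :=
  ∃ h : ℝ, v ≠ 0 ∧ π.L0 e v = (h : ℂ) • v ∧
    ∀ (h' : ℝ) (w : π.V), w ≠ 0 → π.L0 e w = (h' : ℂ) • w → h ≤ h'

end AffineRep

/-! ### The Ramond representation of the CAR algebra of `2d` free fermions -/

/-- The irreducible Ramond representation of the self-dual CAR algebra over `L²(S¹, ℂ²ᵈ)` on finite
energy vectors, given by the modes `F n a = F (zⁿ εₐ)`, with its grading `Γ`. -/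
structure RamondRep (d : ℕ) where
  /-- the space of finite energy vectors -/
  V : Type v
  [normed : NormedAddCommGroup V]
  [innerProd : InnerProductSpace ℂ V]
  /-- the fermionic modes -/
  F : ℤ → Fin d ⊕ Fin d → Module.End ℂ V
  car : ∀ m n a b v, F m a (F n b v) + F n b (F m a v) = if m + n = 0 ∧ a = b then v else 0
  adj : ∀ n a (u v : V), ip (F n a u) v = ip u (F (-n) a v)
  irreducible : ∀ S : Submodule ℂ V, (∀ n a, ∀ v ∈ S, F n a v ∈ S) → S = ⊥ ∨ S = ⊤
  vacuum : ∃ v : V, v ≠ 0 ∧ ∀ n : ℤ, 0 < n → ∀ a, F n a v = 0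
  /-- the grading operator -/
  Γ : Module.End ℂ V
  Γ_sq : ∀ v, Γ (Γ v) = v
  Γ_symm : ∀ u v : V, ip (Γ u) v = ip u (Γ v)
  Γ_odd : ∀ n a v, Γ (F n a v) = -F n a (Γ v)

attribute [instance] RamondRep.normed RamondRep.innerProd

/-- The conformal Hamiltonian `-(1/2) ∑ₘ ∑ₐ m :Fᵃₘ Fᵃ₋ₘ: + d/8` of the Ramond representation. -/
def RamondRep.L0 {d : ℕ} (R : RamondRep d) : Module.End ℂ R.V :=
  (locSum fun m : ℤ => ∑ a, (((|m| : ℤ) : ℂ) / 2) • (R.F (-|m|) a * R.F |m| a)) + ((d : ℂ) / 8) • 1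

/-! ### The super-Sugawara construction -/

section Sugawara

variable {g : Type*} [LieRing g] [LieAlgebra ℝ g] {hv ℓ d : ℕ}
  (e : Module.Basis (Fin d) ℝ g) (π π₀ : AffineRep g hv ℓ) (R : RamondRep d)

/-- The algebraic tensor product of the spaces of finite energy vectors. -/
def HatV : Type _ := π.V ⊗[ℂ] (π₀.V ⊗[ℂ] R.V)

instance : NormedAddCommGroup (HatV π π₀ R) :=
  inferInstanceAs (NormedAddCommGroup (π.V ⊗[ℂ] (π₀.V ⊗[ℂ] R.V)))

instance : InnerProductSpace ℂ (HatV π π₀ R) :=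
  inferInstanceAs (InnerProductSpace ℂ (π.V ⊗[ℂ] (π₀.V ⊗[ℂ] R.V)))

variable {π π₀ R} in
/-- The elementary tensor `u ⊗ v ⊗ w`. -/
def hatTmul (u : π.V) (v : π₀.V) (w : R.V) : HatV π π₀ R := u ⊗ₜ[ℂ] (v ⊗ₜ[ℂ] w)

variable {π π₀ R} in
theorem ip_hatTmul (u u' : π.V) (v v' : π₀.V) (w w' : R.V) :
    ip (hatTmul u v w) (hatTmul u' v' w') = ip u u' * (ip v v' * ip w w') := rfl

variable {π π₀ R} in
theorem norm_hatTmul (u : π.V) (v : π₀.V) (w : R.V) :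
    ‖hatTmul u v w‖ = ‖u‖ * (‖v‖ * ‖w‖) := by
  refine (TensorProduct.norm_tmul (𝕜 := ℂ) u (v ⊗ₜ[ℂ] w)).trans ?_
  rw [TensorProduct.norm_tmul]

variable {π π₀ R} in
theorem HatV.induction_on {p : HatV π π₀ R → Prop} (x : HatV π π₀ R) (h0 : p 0)
    (ht : ∀ u v w, p (hatTmul u v w)) (ha : ∀ x y, p x → p y → p (x + y)) : p x := by
  refine TensorProduct.induction_on (motive := p) x h0 (fun u z => ?_) ha
  refine TensorProduct.induction_on (motive := fun z => p (u ⊗ₜ[ℂ] z)) z ?_ (fun v w => ht u v w)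
    fun x y hx hy => ?_
  · rw [TensorProduct.tmul_zero]
    exact h0
  · rw [TensorProduct.tmul_add]
    exact ha _ _ hx hy

/-- The operator `A ⊗ B ⊗ C` on finite energy vectors. -/
def hatMap (A : Module.End ℂ π.V) (B : Module.End ℂ π₀.V) (C : Module.End ℂ R.V) :
    Module.End ℂ (HatV π π₀ R) :=
  { toFun := fun x => TensorProduct.map A (TensorProduct.map B C) x
    map_add' := fun x y => (TensorProduct.map A (TensorProduct.map B C)).map_add x y
    map_smul' := fun c x => (TensorProduct.map A (TensorProduct.map B C)).map_smul c x }

theorem hatMap_hatTmul (A : Module.End ℂ π.V) (B : Module.End ℂ π₀.V) (C : Module.End ℂ R.V)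
    (u : π.V) (v : π₀.V) (w : R.V) :
    hatMap π π₀ R A B C (hatTmul u v w) = hatTmul (A u) (B v) (C w) := rfl

/-- The Hilbert space tensor product of the three representation spaces. -/
abbrev HatH : Type _ := HilbC (HatV π π₀ R)

/-- The currents of `g ⊕ g` on the tensor product. -/
def hatJ (m : ℤ) : Fin d ⊕ Fin d → Module.End ℂ (HatV π π₀ R)
  | .inl a => hatMap π π₀ R (π.J m (e a)) 1 1
  | .inr a => hatMap π π₀ R 1 (π₀.J m (e a)) 1

/-- The fermionic modes on the tensor product. -/
def hatF (m : ℤ) (a : Fin d ⊕ Fin d) : Module.End ℂ (HatV π π₀ R) :=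
  hatMap π π₀ R 1 1 (R.F m a)

/-- The fermionic currents `-(i/2) ∑ₖ ∑_{b,c} f_{abc} Fᵇₖ Fᶜₘ₋ₖ`. -/
def hatJ' (m : ℤ) (a : Fin d ⊕ Fin d) : Module.End ℂ (HatV π π₀ R) :=
  (-(Complex.I / 2)) • locSum fun k : ℤ => ∑ b, ∑ c,
    (structConst e a b c : ℂ) • (hatF π π₀ R k b * hatF π π₀ R (m - k) c)

/-- The zero mode `G₀ = (ℓ + h^∨)^{-1/2} ∑ₐ ∑ₘ (Jᵃₘ + (1/3) J'ᵃₘ) Fᵃ₋ₘ` of the supercurrent, on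
finite energy vectors. -/
def superG0 : Module.End ℂ (HatV π π₀ R) :=
  ((1 / √((ℓ : ℝ) + hv) : ℝ) : ℂ) • locSum fun m : ℤ => ∑ a,
    (hatJ e π π₀ R m a + (1 / 3 : ℂ) • hatJ' e π π₀ R m a) * hatF π π₀ R (-m) a

end Sugawara

/-! ### Unbounded operators -/

section Unbounded

variable {X : Type*} [NormedAddCommGroup X] [InnerProductSpace ℂ X]

/-- A linear operator on the inner product space `X`, as an operator on the completion of `X` with
domain `X`. -/
def coreOp (A : Module.End ℂ X) : HilbC X →ₗ.[ℂ] HilbC X where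
  domain := LinearMap.range (toHilb : X →ₗᵢ[ℂ] HilbC X).toLinearMap
  toFun := (toHilb : X →ₗᵢ[ℂ] HilbC X).toLinearMap ∘ₗ A ∘ₗ
    (LinearEquiv.ofInjective (toHilb : X →ₗᵢ[ℂ] HilbC X).toLinearMap
      (toHilb : X →ₗᵢ[ℂ] HilbC X).injective).symm.toLinearMap

/-- The closure, as an operator on the Hilbert space completion of `X`, of a linear operator on the
inner product space `X`. -/
def closedOp (A : Module.End ℂ X) : HilbC X →ₗ.[ℂ] HilbC X := (coreOp A).closure

theorem toHilb_mem_closedOp (A : Module.End ℂ X) (x : X) : toHilb x ∈ (closedOp A).domain :=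
  (LinearPMap.le_closure (coreOp A)).1 ⟨x, rfl⟩

theorem closedOp_dense (A : Module.End ℂ X) : Dense ((closedOp A).domain : Set (HilbC X)) := by
  refine Dense.mono ?_ (denseRange_toHilb (X := X))
  rintro _ ⟨x, rfl⟩
  exact toHilb_mem_closedOp A x

theorem closedOp_toHilb (A : Module.End ℂ X) (x : X) :
    closedOp A ⟨toHilb x, toHilb_mem_closedOp A x⟩ = toHilb (A x) := by
  refine ((LinearPMap.le_closure (coreOp A)).2 (x := ⟨toHilb x, ⟨x, rfl⟩⟩)
    (y := ⟨toHilb x, toHilb_mem_closedOp A x⟩) rfl).symm.trans ?_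
  have : (LinearEquiv.ofInjective (toHilb : X →ₗᵢ[ℂ] HilbC X).toLinearMap
      (toHilb : X →ₗᵢ[ℂ] HilbC X).injective).symm ⟨toHilb x, ⟨x, rfl⟩⟩ = x := by
    rw [LinearEquiv.symm_apply_eq]
    rfl
  exact congrArg (fun z : X => toHilb (A z)) this

variable {ι : Type*} [Fintype ι] {K : ι → Type*} [∀ i, NormedAddCommGroup (K i)]
  [∀ i, InnerProductSpace ℂ (K i)]

/-- The direct sum of a finite family of unbounded operators. -/
def directSumOp (T : ∀ i, K i →ₗ.[ℂ] K i) : PiLp 2 K →ₗ.[ℂ] PiLp 2 K where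
  domain :=
    { carrier := {x | ∀ i, x i ∈ (T i).domain}
      add_mem' := fun hx hy i => (T i).domain.add_mem (hx i) (hy i)
      zero_mem' := fun i => (T i).domain.zero_mem
      smul_mem' := fun c _ hx i => (T i).domain.smul_mem c (hx i) }
  toFun :=
    { toFun := fun x => WithLp.toLp 2 fun i => T i ⟨x.1 i, x.2 i⟩
      map_add' := fun x y => by
        ext i
        exact (T i).map_add ⟨x.1 i, x.2 i⟩ ⟨y.1 i, y.2 i⟩
      map_smul' := fun c x => by
        ext i
        exact (T i).map_smul c ⟨x.1 i, x.2 i⟩ }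

theorem directSumOp_dense {T : ∀ i, K i →ₗ.[ℂ] K i} (h : ∀ i, Dense ((T i).domain : Set (K i))) :
    Dense ((directSumOp T).domain : Set (PiLp 2 K)) := by
  have h1 : Dense (Set.univ.pi fun i => ((T i).domain : Set (K i))) :=
    dense_pi _ fun i _ => h i
  have h2 := h1.preimage (PiLp.homeomorph 2 K).isOpenMap
  refine h2.mono fun x hx => ?_
  exact fun i => hx i (Set.mem_univ i)

variable {E : Type*} [NormedAddCommGroup E] [InnerProductSpace ℂ E]

/-- The spectral projection of a self-adjoint operator with discrete spectrum for the eigenvalues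
less than `c`: the orthogonal projection onto the closed span of the eigenvectors with eigenvalue
less than `c`. -/
def spectralProj [CompleteSpace E] (T : E →ₗ.[ℂ] E) (c : ℝ) : E →L[ℂ] E :=
  (Submodule.span ℂ {x : E | ∃ μ : ℝ, μ < c ∧ ∃ h : x ∈ T.domain,
    T ⟨x, h⟩ = (μ : ℂ) • x}).topologicalClosure.starProjection

/-- The derivation defined by `D`: `x` is in its domain, with value `y`, if `x D ⊆ D x - y`. -/
def IsDerivation (D : E →ₗ.[ℂ] E) (x y : E →L[ℂ] E) : Prop :=
  ∀ ξ : D.domain, ∃ h : x ξ ∈ D.domain, x (D ξ) = D ⟨x ξ, h⟩ - y ξ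

open Classical in
/-- The value of the derivation defined by `D` (and `0` outside its domain). -/
def derivation (D : E →ₗ.[ℂ] E) (x : E →L[ℂ] E) : E →L[ℂ] E :=
  if h : ∃ y, IsDerivation D x y then h.choose else 0

end Unbounded

/-! ### The algebra of compact differentiable elements -/

section DiffAlg

variable {H K : Type*} [NormedAddCommGroup H] [InnerProductSpace ℂ H]
  [NormedAddCommGroup K] [InnerProductSpace ℂ K]

/-- A densely defined operator. -/
structure DenseOp (K : Type*) [NormedAddCommGroup K] [InnerProductSpace ℂ K] where
  /-- the operator -/
  op : K →ₗ.[ℂ] K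
  dense : Dense (op.domain : Set K)

theorem IsDerivation.unique {D : K →ₗ.[ℂ] K} (hD : Dense (D.domain : Set K))
    {x y y' : K →L[ℂ] K} (h : IsDerivation D x y) (h' : IsDerivation D x y') : y = y' := by
  refine ContinuousLinearMap.coeFn_injective
    (Continuous.ext_on hD y.continuous y'.continuous fun ξ hξ => ?_)
  obtain ⟨a, ha⟩ := h ⟨ξ, hξ⟩
  obtain ⟨b, hb⟩ := h' ⟨ξ, hξ⟩
  have := ha.symm.trans hb
  simpa using this

theorem IsDerivation.derivation_eq {D : K →ₗ.[ℂ] K} (hD : Dense (D.domain : Set K))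
    {x y : K →L[ℂ] K} (h : IsDerivation D x y) : derivation D x = y := by
  have h0 : ∃ y, IsDerivation D x y := ⟨y, h⟩
  rw [derivation, dif_pos h0]
  exact IsDerivation.unique hD h0.choose_spec h

theorem IsDerivation.zero (D : K →ₗ.[ℂ] K) : IsDerivation D 0 0 := fun ξ =>
  ⟨D.domain.zero_mem, by
    have : D ⟨(0 : K), D.domain.zero_mem⟩ = 0 := D.map_zero
    simp only [zero_apply, sub_zero]
    exact this.symm⟩

theorem IsDerivation.add {D : K →ₗ.[ℂ] K} {x y x' y' : K →L[ℂ] K} (h : IsDerivation D x y)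
    (h' : IsDerivation D x' y') : IsDerivation D (x + x') (y + y') := fun ξ => by
  obtain ⟨a, ha⟩ := h ξ
  obtain ⟨b, hb⟩ := h' ξ
  refine ⟨D.domain.add_mem a b, ?_⟩
  have := D.map_add ⟨_, a⟩ ⟨_, b⟩
  simp only [add_apply]
  rw [ha, hb, show D ⟨x ξ + x' ξ, D.domain.add_mem a b⟩ = D ⟨_, a⟩ + D ⟨_, b⟩ from this]
  abel

theorem IsDerivation.smul {D : K →ₗ.[ℂ] K} {x y : K →L[ℂ] K} (c : ℂ) (h : IsDerivation D x y) :
    IsDerivation D (c • x) (c • y) := fun ξ => by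
  obtain ⟨a, ha⟩ := h ξ
  refine ⟨D.domain.smul_mem c a, ?_⟩
  have := D.map_smul c ⟨_, a⟩
  simp only [smul_apply]
  rw [ha, show D ⟨c • x ξ, D.domain.smul_mem c a⟩ = c • D ⟨_, a⟩ from this, smul_sub]

theorem IsDerivation.mul {D : K →ₗ.[ℂ] K} {x y x' y' : K →L[ℂ] K} (h : IsDerivation D x y)
    (h' : IsDerivation D x' y') : IsDerivation D (x * x') (x * y' + y * x') := fun ξ => by
  obtain ⟨b, hb⟩ := h' ξ
  obtain ⟨a, ha⟩ := h ⟨_, b⟩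
  refine ⟨a, ?_⟩
  simp only [mul_apply_eq_comp, add_apply]
  rw [hb, map_sub, ha]
  abel

variable {B : Subalgebra ℂ (H →L[ℂ] H)}

/-- The compact elements `x` of `B` such that `P x` is in the domain of the derivation given by `D`
and such that the value of the derivation is compact. -/
def diffSubalgebra (P : B →ₙₐ[ℂ] (K →L[ℂ] K)) (D : DenseOp K) : NonUnitalSubalgebra ℂ B where
  carrier := {x | IsCompactOperator (x : H →L[ℂ] H) ∧
    ∃ y, IsDerivation D.op (P x) y ∧ IsCompactOperator y}
  add_mem' := by
    rintro x x' ⟨hx, y, hy, hc⟩ ⟨hx', y', hy', hc'⟩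
    exact ⟨hx.add hx', y + y', by simpa using hy.add hy', hc.add hc'⟩
  zero_mem' := ⟨isCompactOperator_zero, 0, by simpa using IsDerivation.zero D.op,
    isCompactOperator_zero⟩
  smul_mem' := by
    rintro c x ⟨hx, y, hy, hc⟩
    exact ⟨hx.smul c, c • y, by simpa using hy.smul c, hc.smul c⟩
  mul_mem' := by
    rintro x x' ⟨hx, y, hy, hc⟩ ⟨hx', y', hy', hc'⟩
    exact ⟨hx.comp_clm _, P x * y' + y * P x', by simpa using hy.mul hy',
      (hc'.clm_comp _).add (hc.comp_clm _)⟩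

/-- The algebra `diffSubalgebra P D` as a type, to be equipped with its own norm. The hypothesis on
`P` holds for every `*`-representation of a C*-algebra. -/
structure DiffAlg (P : B →ₙₐ[ℂ] (K →L[ℂ] K)) (D : DenseOp K) (hP : ∀ x, ‖P x‖ ≤ ‖x‖) where
  /-- the element of `B` -/
  elt : diffSubalgebra P D

namespace DiffAlg

variable {P : B →ₙₐ[ℂ] (K →L[ℂ] K)} {D : DenseOp K} {hP : ∀ x, ‖P x‖ ≤ ‖x‖}

/-- The operator underlying an element of the algebra. -/
def toOp (x : DiffAlg P D hP) : H →L[ℂ] H := ((x.elt : B) : H →L[ℂ] H)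

/-- The value of the derivation on (the image under `P` of) an element of the algebra. -/
def deriv (x : DiffAlg P D hP) : K →L[ℂ] K := derivation D.op (P (x.elt : B))

/-- The underlying bijection with the subalgebra. -/
def equiv (P : B →ₙₐ[ℂ] (K →L[ℂ] K)) (D : DenseOp K) (hP : ∀ x, ‖P x‖ ≤ ‖x‖) :
    DiffAlg P D hP ≃ diffSubalgebra P D where
  toFun x := x.elt
  invFun x := ⟨x⟩

instance : NonUnitalRing (DiffAlg P D hP) := (equiv P D hP).nonUnitalRing

instance : Module ℂ (DiffAlg P D hP) := (equiv P D hP).module ℂ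

theorem isDerivation (x : DiffAlg P D hP) : IsDerivation D.op (P (x.elt : B)) x.deriv := by
  obtain ⟨-, y, hy, -⟩ := x.elt.2
  rw [deriv, hy.derivation_eq D.dense]
  exact hy

theorem deriv_eq {x : DiffAlg P D hP} {y : K →L[ℂ] K} (h : IsDerivation D.op (P (x.elt : B)) y) :
    x.deriv = y := h.derivation_eq D.dense

theorem deriv_add (x y : DiffAlg P D hP) : (x + y).deriv = x.deriv + y.deriv := by
  refine deriv_eq ?_
  have := x.isDerivation.add y.isDerivation
  rwa [← map_add] at this

theorem deriv_smul (c : ℂ) (x : DiffAlg P D hP) : (c • x).deriv = c • x.deriv := by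
  refine deriv_eq ?_
  have := x.isDerivation.smul c
  rwa [← map_smul] at this

theorem deriv_mul (x y : DiffAlg P D hP) :
    (x * y).deriv = P (x.elt : B) * y.deriv + x.deriv * P (y.elt : B) := by
  refine deriv_eq ?_
  have := x.isDerivation.mul y.isDerivation
  rwa [← map_mul] at this

/-- The norm `‖x‖₁ = ‖x‖ + ‖δ(P x)‖`. -/
instance : Norm (DiffAlg P D hP) := ⟨fun x => ‖x.toOp‖ + ‖x.deriv‖⟩

theorem norm_def (x : DiffAlg P D hP) : ‖x‖ = ‖x.toOp‖ + ‖x.deriv‖ := rfl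

theorem norm_smul_eq (c : ℂ) (x : DiffAlg P D hP) : ‖c • x‖ = ‖c‖ * ‖x‖ := by
  rw [norm_def, norm_def, deriv_smul, show (c • x).toOp = c • x.toOp from rfl, norm_smul,
    norm_smul, mul_add]

theorem norm_core : NormedSpace.Core ℂ (DiffAlg P D hP) where
  norm_nonneg x := add_nonneg (norm_nonneg _) (norm_nonneg _)
  norm_smul c x := norm_smul_eq c x
  norm_triangle x y := by
    rw [norm_def, norm_def, norm_def, deriv_add, show (x + y).toOp = x.toOp + y.toOp from rfl]
    linarith [norm_add_le x.toOp y.toOp, norm_add_le x.deriv y.deriv]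
  norm_eq_zero_iff x := by
    constructor
    · intro h
      have h1 : ‖x.toOp‖ = 0 := by
        rw [norm_def] at h
        linarith [norm_nonneg x.toOp, norm_nonneg x.deriv]
      have h2 : x.toOp = 0 := norm_eq_zero.1 h1
      exact (equiv P D hP).injective (Subtype.ext (Subtype.ext h2))
    · rintro rfl
      have := norm_smul_eq 0 (0 : DiffAlg P D hP)
      simpa using this

instance : NormedAddCommGroup (DiffAlg P D hP) := NormedAddCommGroup.ofCore norm_core

instance : NormedSpace ℂ (DiffAlg P D hP) := NormedSpace.ofCore norm_core

instance : NonUnitalNormedRing (DiffAlg P D hP) where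
  __ := (inferInstance : NormedAddCommGroup (DiffAlg P D hP))
  __ := (inferInstance : NonUnitalRing (DiffAlg P D hP))
  norm_mul_le x y := by
    rw [norm_def, norm_def, norm_def, deriv_mul, show (x * y).toOp = x.toOp * y.toOp from rfl]
    have h1 := norm_mul_le x.toOp y.toOp
    have h2 := norm_mul_le (P (x.elt : B)) y.deriv
    have h3 := norm_mul_le x.deriv (P (y.elt : B))
    have h4 := norm_add_le (P (x.elt : B) * y.deriv) (x.deriv * P (y.elt : B))
    have h5 : ‖P (x.elt : B)‖ ≤ ‖x.toOp‖ := hP _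
    have h6 : ‖P (y.elt : B)‖ ≤ ‖y.toOp‖ := hP _
    have h7 := mul_le_mul_of_nonneg_right h5 (norm_nonneg y.deriv)
    have h8 := mul_le_mul_of_nonneg_left h6 (norm_nonneg x.deriv)
    nlinarith [mul_nonneg (norm_nonneg x.deriv) (norm_nonneg y.deriv)]

instance : IsScalarTower ℂ (DiffAlg P D hP) (DiffAlg P D hP) :=
  ⟨fun c x y => (equiv P D hP).injective
    (Subtype.ext (Subtype.ext (smul_mul_assoc c x.toOp y.toOp)))⟩

instance : SMulCommClass ℂ (DiffAlg P D hP) (DiffAlg P D hP) :=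
  ⟨fun c x y => (equiv P D hP).injective
    (Subtype.ext (Subtype.ext (mul_smul_comm c x.toOp y.toOp).symm))⟩

end DiffAlg

end DiffAlg

/-! ### Loop groups and their positive energy representations -/

section Loop

/-- The model space of `d`-dimensional manifolds. -/
abbrev ModelE (d : ℕ) : Type := EuclideanSpace ℝ (Fin d)

/-- The loop group `C^∞(S¹, G)`. -/
abbrev LoopGroup (d : ℕ) (G : Type*) [TopologicalSpace G] [ChartedSpace (ModelE d) G] : Type _ :=
  C^∞⟮𝓡 1, Circle; 𝓘(ℝ, ModelE d), G⟯

/-- The Lie algebra of the Lie group `G`. -/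
abbrev LieAlg (d : ℕ) (G : Type*) [TopologicalSpace G] [ChartedSpace (ModelE d) G] [Group G] :
    Type := GroupLieAlgebra 𝓘(ℝ, ModelE d) G

instance {d : ℕ} {G : Type*} [TopologicalSpace G] [ChartedSpace (ModelE d) G] [Group G]
    [LieGroup 𝓘(ℝ, ModelE d) ∞ G] : LieGroup 𝓘(ℝ, ModelE d) (minSmoothness ℝ 3) G :=
  LieGroup.of_le (n := ∞) (by
    rw [minSmoothness_of_isRCLikeNormedField]
    exact ENat.LEInfty.out)

instance {d : ℕ} {G : Type*} [TopologicalSpace G] [ChartedSpace (ModelE d) G] [Group G] :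
    Module.Finite ℝ (LieAlg d G) :=
  inferInstanceAs (Module.Finite ℝ (ModelE d))

/-- The real part of the `n`-th Fourier coefficient of a loop in the Lie algebra. -/
def fourierRe {d : ℕ} (ξ : Circle → ModelE d) (n : ℤ) : ModelE d :=
  (1 / (2 * Real.pi)) • ∫ θ in (0)..(2 * Real.pi), Real.cos (n * θ) • ξ (Circle.exp θ)

/-- The imaginary part of the `n`-th Fourier coefficient of a loop in the Lie algebra. -/
def fourierIm {d : ℕ} (ξ : Circle → ModelE d) (n : ℤ) : ModelE d :=
  -((1 / (2 * Real.pi)) • ∫ θ in (0)..(2 * Real.pi), Real.sin (n * θ) • ξ (Circle.exp θ))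

variable {d : ℕ} {G : Type*} [TopologicalSpace G] [ChartedSpace (ModelE d) G] [Group G]
  [LieGroup 𝓘(ℝ, ModelE d) ∞ G]

/-- The term with mode `n` of the action `∑ₙ π (ξₙ ⊗ tⁿ)` of the loop `ξ = ∑ₙ ξₙ tⁿ`; recall that
`J n x = i π (x ⊗ tⁿ)`. -/
def currentTerm {V : Type*} [AddCommGroup V] [Module ℂ V]
    (J : ℤ → LieAlg d G →ₗ[ℝ] Module.End ℂ V) (ξ : Circle → ModelE d) (n : ℤ) : Module.End ℂ V :=
  (-Complex.I) • (J n (fourierRe ξ n : ModelE d) + Complex.I • J n (fourierIm ξ n : ModelE d))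

variable (d G) in
/-- An irreducible projective unitary positive energy representation of level `ℓ` of the loop group
of `G`: an irreducible unitary highest weight representation of level `ℓ` of the affine Kac-Moody
algebra, together with the projective unitary representation `lam` of the loop group (given by a
choice of unitary representatives) to which it exponentiates: for every loop `ξ` in the Lie algebra,
the one-parameter group `t ↦ exp (t ξ)` of loops is represented by the unitary one-parameter group
generated by the action of `ξ`. -/
structure LoopRep (hv ℓ : ℕ) extends AffineRep.{u} (LieAlg d G) hv ℓ where
  /-- the unitary operators representing the loop group -/
  lam : LoopGroup d G → (HilbC V ≃ₗᵢ[ℂ] HilbC V)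
  lam_mul : ∀ a b, ∃ c : Circle, ∀ x, lam a (lam b x) = (c : ℂ) • lam (a * b) x
  exponentiates : ∀ ξ : Circle → ModelE d, ContMDiff (𝓡 1) 𝓘(ℝ, ModelE d) ∞ ξ →
    ∃ (γ : ℝ → LoopGroup d G) (U : ℝ → (HilbC V ≃ₗᵢ[ℂ] HilbC V)),
      (∀ s t, γ (s + t) = γ s * γ t) ∧
      (∀ z, HasMFDerivAt 𝓘(ℝ, ℝ) 𝓘(ℝ, ModelE d) (fun t => γ t z) 0
        (ContinuousLinearMap.toSpanSingleton ℝ (ξ z) : ℝ →L[ℝ] ModelE d)) ∧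
      (∀ s t, U (s + t) = U s * U t) ∧
      (∀ x, Continuous fun t => U t x) ∧
      (∀ t, ∃ c : Circle, ∀ x, U t x = (c : ℂ) • lam (γ t) x) ∧
      ∀ v : V, ∃ w : HilbC V,
        HasSum (fun n : ℤ => toHilb (currentTerm J ξ n v)) w ∧
        HasDerivAt (fun t => U t (toHilb v)) w 0

/-- Unitary equivalence of projective representations of the loop group. -/
def LoopRep.Equivalent {hv ℓ : ℕ} (π π' : LoopRep.{u} d G hv ℓ) : Prop :=
  ∃ W : π.Hilb ≃ₗᵢ[ℂ] π'.Hilb, ∀ a, ∃ c : Circle, ∀ x, W (π.lam a x) = (c : ℂ) • π'.lam a (W x)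

variable (d G) in
/-- The choices that enter the construction of the algebras associated with the level `ℓ`
representations of the loop group of `G`. -/
structure LevelData (ℓ : ℕ) where
  /-- the dual Coxeter number -/
  hv : ℕ
  isDualCoxeterNumber : IsDualCoxeterNumber (LieAlg d G) hv
  /-- an orthonormal basis of the Lie algebra -/
  e : Module.Basis (Fin d) ℝ (LieAlg d G)
  e_orthonormal : ∀ a b, normForm hv (e a) (e b) = if a = b then 1 else 0
  /-- the number of irreducible representations of level `ℓ` -/
  N : ℕ
  [neZero : NeZero N]
  /-- a maximal family of mutually inequivalent irreducible representations of level `ℓ` -/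
  rep : Fin N → LoopRep.{u} d G hv ℓ
  inequivalent : ∀ i j, i ≠ j → ¬ (rep i).Equivalent (rep j)
  maximal : ∀ π : LoopRep.{u} d G hv ℓ, ∃ i, π.Equivalent (rep i)
  vacuum : (rep 0).IsVacuum
  /-- the reduced representation: the direct sum of the projective representations `rep i` -/
  lamRed : LoopGroup d G → (PiLp 2 (fun i => (rep i).Hilb) ≃ₗᵢ[ℂ] PiLp 2 (fun i => (rep i).Hilb))
  lamRed_mul : ∀ a b, ∃ c : Circle, ∀ x, lamRed a (lamRed b x) = (c : ℂ) • lamRed (a * b) x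
  lamRed_apply : ∀ a i, ∃ c : Circle, ∀ x, lamRed a x i = (c : ℂ) • (rep i).lam a (x i)
  /-- the Ramond representation -/
  ramond : RamondRep.{v} d
  /-- a lowest energy unit vector of the vacuum representation -/
  Ω : (rep 0).V
  Ω_norm : ‖Ω‖ = 1
  Ω_lowest : (rep 0).IsLowestEnergy e Ω
  /-- an even lowest energy unit vector of the Ramond representation -/
  ψ : ramond.V
  ψ_norm : ‖ψ‖ = 1
  ψ_lowest : ramond.L0 ψ = ((d : ℂ) / 8) • ψ
  ψ_even : ramond.Γ ψ = ψ

attribute [instance] LevelData.neZero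

end Loop

/-! ### Direct sums of bounded operators -/

section DirectSum

variable {ι : Type*} [Fintype ι] [DecidableEq ι] (K : ι → Type*) [∀ i, NormedAddCommGroup (K i)]
  [∀ i, InnerProductSpace ℂ (K i)]

/-- The inclusion of a summand. -/
def inclCLM (i : ι) : K i →L[ℂ] PiLp 2 K :=
  (PiLp.continuousLinearEquiv 2 ℂ K).symm.toContinuousLinearMap ∘L
    ContinuousLinearMap.single ℂ K i

theorem inclCLM_apply (i j : ι) (x : K i) : inclCLM K i x j = Pi.single i x j := rfl

/-- The corner of a bounded operator on a direct sum. -/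
def corner (i : ι) (x : PiLp 2 K →L[ℂ] PiLp 2 K) : K i →L[ℂ] K i :=
  (PiLp.proj 2 K i : PiLp 2 K →L[ℂ] K i) ∘L x ∘L inclCLM K i

variable {K}

/-- The direct sum of bounded operators. -/
def directSumCLM (T : ∀ i, K i →L[ℂ] K i) : PiLp 2 K →L[ℂ] PiLp 2 K :=
  (PiLp.continuousLinearEquiv 2 ℂ K).symm.toContinuousLinearMap ∘L
    ContinuousLinearMap.pi fun i => T i ∘L (PiLp.proj 2 K i : PiLp 2 K →L[ℂ] K i)

theorem directSumCLM_apply (T : ∀ i, K i →L[ℂ] K i) (x : PiLp 2 K) (i : ι) :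
    directSumCLM T x i = T i (x i) := rfl

theorem norm_directSumCLM_le (T : ∀ i, K i →L[ℂ] K i) (c : ℝ) (hc : 0 ≤ c)
    (h : ∀ i, ‖T i‖ ≤ c) : ‖directSumCLM T‖ ≤ c := by
  refine ContinuousLinearMap.opNorm_le_bound _ hc fun x => ?_
  refine le_of_sq_le_sq ?_ (by positivity)
  rw [mul_pow, PiLp.norm_sq_eq_of_L2, PiLp.norm_sq_eq_of_L2, Finset.mul_sum]
  refine Finset.sum_le_sum fun i _ => ?_
  rw [directSumCLM_apply, ← mul_pow]
  gcongr
  exact (T i).le_of_opNorm_le (h i) _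

theorem norm_corner_le (i : ι) (x : PiLp 2 K →L[ℂ] PiLp 2 K) : ‖corner K i x‖ ≤ ‖x‖ := by
  refine ContinuousLinearMap.opNorm_le_bound _ (norm_nonneg x) fun ξ => ?_
  have h1 : ‖inclCLM K i ξ‖ = ‖ξ‖ := PiLp.norm_single 2 K i ξ
  calc ‖x (inclCLM K i ξ) i‖ ≤ ‖x (inclCLM K i ξ)‖ := PiLp.norm_apply_le _ i
    _ ≤ ‖x‖ * ‖ξ‖ := by rw [← h1]; exact x.le_opNorm _

end DirectSum

/-! ### The algebras associated with the level `ℓ` representations -/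

namespace LevelData

variable {d : ℕ} {G : Type*} [TopologicalSpace G] [ChartedSpace (ModelE d) G] [Group G]
  [LieGroup 𝓘(ℝ, ModelE d) ∞ G] {ℓ : ℕ} (S : LevelData.{u, v} d G ℓ)

/-- The Hilbert space of the reduced representation. -/
abbrev HRed : Type _ := PiLp 2 fun i => (S.rep i).Hilb

/-- The Hilbert space tensor product of the spaces of `λᵢ`, of `λ₀` and of the Ramond
representation. -/
def HHat (i : Fin S.N) : Type _ := HatH (S.rep i).toAffineRep (S.rep 0).toAffineRep S.ramond

instance (i : Fin S.N) : NormedAddCommGroup (S.HHat i) :=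
  inferInstanceAs (NormedAddCommGroup
    (HatH (S.rep i).toAffineRep (S.rep 0).toAffineRep S.ramond))

instance (i : Fin S.N) : InnerProductSpace ℂ (S.HHat i) :=
  inferInstanceAs (InnerProductSpace ℂ
    (HatH (S.rep i).toAffineRep (S.rep 0).toAffineRep S.ramond))

instance (i : Fin S.N) : CompleteSpace (S.HHat i) :=
  inferInstanceAs (CompleteSpace
    (HatH (S.rep i).toAffineRep (S.rep 0).toAffineRep S.ramond))

/-- The embedding of the finite energy vectors. -/
def toHHat (i : Fin S.N) :
    HatV (S.rep i).toAffineRep (S.rep 0).toAffineRep S.ramond →ₗᵢ[ℂ] S.HHat i :=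
  toHilb (X := HatV (S.rep i).toAffineRep (S.rep 0).toAffineRep S.ramond)

/-- The direct sum of the spaces `HHat i`. -/
abbrev HHatRed : Type _ := PiLp 2 S.HHat

/-- The reduced universal algebra: the bicommutant of the reduced representation. -/
def BAlg : Subalgebra ℂ (S.HRed →L[ℂ] S.HRed) :=
  Subalgebra.centralizer ℂ (Subalgebra.centralizer ℂ
    (Set.range fun a => (S.lamRed a : S.HRed →L[ℂ] S.HRed)) : Set (S.HRed →L[ℂ] S.HRed))

theorem BAlg_apply (x : S.BAlg) (ξ : S.HRed) (i : Fin S.N) :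
    (x : S.HRed →L[ℂ] S.HRed) ξ i =
      corner (fun i => (S.rep i).Hilb) i (x : S.HRed →L[ℂ] S.HRed) (ξ i) := by
  have hp : inclCLM (fun i => (S.rep i).Hilb) i ∘L (PiLp.proj 2 (fun i => (S.rep i).Hilb) i :
      S.HRed →L[ℂ] (S.rep i).Hilb) ∈ Subalgebra.centralizer ℂ
        (Set.range fun a => (S.lamRed a : S.HRed →L[ℂ] S.HRed)) := by
    rw [Subalgebra.mem_centralizer_iff]
    rintro _ ⟨a, rfl⟩
    ext ξ j
    obtain ⟨c, hc⟩ := S.lamRed_apply a j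
    obtain ⟨c', hc'⟩ := S.lamRed_apply a i
    change S.lamRed a (inclCLM (fun i => (S.rep i).Hilb) i (ξ i)) j =
      inclCLM (fun i => (S.rep i).Hilb) i (S.lamRed a ξ i) j
    rw [hc, inclCLM_apply, inclCLM_apply]
    by_cases h : j = i
    · subst h
      rw [Pi.single_eq_same, Pi.single_eq_same, hc]
    · rw [Pi.single_eq_of_ne h, Pi.single_eq_of_ne h, map_zero, smul_zero]
  have h := (Subalgebra.mem_centralizer_iff ℂ).1 x.2
  have h2 := congrArg (fun T : S.HRed →L[ℂ] S.HRed => T ξ i) (h _ hp)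
  have h3 : (inclCLM (fun i => (S.rep i).Hilb) i) ((x : S.HRed →L[ℂ] S.HRed) ξ i) i =
      (x : S.HRed →L[ℂ] S.HRed) (inclCLM (fun i => (S.rep i).Hilb) i (ξ i)) i := h2
  rw [inclCLM_apply, Pi.single_eq_same] at h3
  exact h3

/-- The representation `π_{λᵢ}` of the reduced universal algebra on the `i`-th summand. -/
def piRep (i : Fin S.N) (x : S.BAlg) : (S.rep i).Hilb →L[ℂ] (S.rep i).Hilb :=
  corner (fun i => (S.rep i).Hilb) i (x : S.HRed →L[ℂ] S.HRed)

theorem piRep_mul (i : Fin S.N) (x y : S.BAlg) :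
    S.piRep i (x * y) = S.piRep i x * S.piRep i y := by
  ext ξ
  change (x : S.HRed →L[ℂ] S.HRed) ((y : S.HRed →L[ℂ] S.HRed)
    (inclCLM (fun i => (S.rep i).Hilb) i ξ)) i = _
  rw [BAlg_apply]
  rfl

/-- The map `u ↦ u ⊗ Ω ⊗ ψ` on finite energy vectors. -/
def emb₀ (i : Fin S.N) : (S.rep i).V →ₗᵢ[ℂ]
    HatV (S.rep i).toAffineRep (S.rep 0).toAffineRep S.ramond where
  toFun u := hatTmul u S.Ω S.ψ
  map_add' u v := TensorProduct.add_tmul u v _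
  map_smul' c u := (TensorProduct.smul_tmul' c u _).symm
  norm_map' u := by
    refine (norm_hatTmul u S.Ω S.ψ).trans ?_
    rw [S.Ω_norm, S.ψ_norm, mul_one, mul_one]

/-- The isometry `ξ ↦ ξ ⊗ Ω ⊗ ψ`. -/
def emb (i : Fin S.N) : (S.rep i).Hilb →L[ℂ] S.HHat i :=
  mapHilb (S.emb₀ i).toContinuousLinearMap

theorem emb_toHilb (i : Fin S.N) (u : (S.rep i).V) :
    S.emb i (toHilb u) = S.toHHat i (hatTmul u S.Ω S.ψ) :=
  mapHilb_toHilb (S.emb₀ i).toContinuousLinearMap u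

theorem norm_emb (i : Fin S.N) (ξ : (S.rep i).Hilb) : ‖S.emb i ξ‖ = ‖ξ‖ := by
  refine denseRange_toHilb.induction_on (p := fun ξ => ‖S.emb i ξ‖ = ‖ξ‖) ξ
    (isClosed_eq (S.emb i).continuous.norm continuous_norm) fun u => ?_
  rw [emb_toHilb, LinearIsometry.norm_map, LinearIsometry.norm_map]
  exact (S.emb₀ i).norm_map u

theorem adjoint_emb_emb (i : Fin S.N) (ξ : (S.rep i).Hilb) :
    ContinuousLinearMap.adjoint (S.emb i) (S.emb i ξ) = ξ := by
  have := (ContinuousLinearMap.norm_map_iff_adjoint_comp_self (S.emb i)).1 (S.norm_emb i)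
  exact congrArg (fun T : (S.rep i).Hilb →L[ℂ] (S.rep i).Hilb => T ξ) this

/-- The degenerate representation `π̂_{λᵢ}(x) = π_{λᵢ}(x) ⊗ q_Ω ⊗ e_R`, where `q_Ω` and `e_R` are the
projections onto `ℂ Ω` and `ℂ ψ`; in terms of `W ξ = ξ ⊗ Ω ⊗ ψ` it is `W π_{λᵢ}(x) W*`. -/
def hatPi (i : Fin S.N) (x : S.BAlg) : S.HHat i →L[ℂ] S.HHat i :=
  S.emb i ∘L S.piRep i x ∘L ContinuousLinearMap.adjoint (S.emb i)

/-- On `u ⊗ v ⊗ w` the operator `π̂_{λᵢ}(x)` is `π_{λᵢ}(x) u ⊗ q_Ω v ⊗ e_R w`. -/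
theorem hatPi_tmul (i : Fin S.N) (x : S.BAlg) (u : (S.rep i).V) (v : (S.rep 0).V)
    (w : S.ramond.V) : S.hatPi i x (S.toHHat i (hatTmul u v w)) =
      (ip S.Ω v * ip S.ψ w) • S.emb i (S.piRep i x (toHilb u)) := by
  have : ContinuousLinearMap.adjoint (S.emb i) (S.toHHat i (hatTmul u v w)) =
      (ip S.Ω v * ip S.ψ w) • toHilb u := by
    refine ext_inner_left ℂ fun ξ => ?_
    refine (ContinuousLinearMap.adjoint_inner_right (S.emb i) ξ _).trans ?_
    refine denseRange_toHilb.induction_on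
      (p := fun ξ => ip (S.emb i ξ) (S.toHHat i (hatTmul u v w)) =
        ip ξ ((ip S.Ω v * ip S.ψ w) • toHilb u)) ξ
      (isClosed_eq ((S.emb i).continuous.inner continuous_const)
        (continuous_id.inner continuous_const)) fun u' => ?_
    rw [emb_toHilb]
    simp only [ip]
    rw [inner_smul_right, LinearIsometry.inner_map_map, LinearIsometry.inner_map_map]
    exact (ip_hatTmul u' u S.Ω v S.ψ w).trans (mul_comm _ _)
  rw [hatPi, ContinuousLinearMap.comp_apply, ContinuousLinearMap.comp_apply, this, map_smul,
    map_smul]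

/-- The representation `π̂_red = ⊕ᵢ π̂_{λᵢ}`. -/
def hatPiRed : S.BAlg →ₙₐ[ℂ] (S.HHatRed →L[ℂ] S.HHatRed) where
  toFun x := directSumCLM fun i => S.hatPi i x
  map_smul' c x := by
    ext ξ i
    change S.emb i (c • S.piRep i x _) = c • S.emb i (S.piRep i x _)
    rw [map_smul]
  map_zero' := by
    ext ξ i
    exact (S.emb i).map_zero
  map_add' x y := by
    ext ξ i
    change S.emb i (S.piRep i x _ + S.piRep i y _) =
      S.emb i (S.piRep i x _) + S.emb i (S.piRep i y _)
    rw [map_add]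
  map_mul' x y := by
    ext ξ i
    change S.emb i (S.piRep i (x * y) _) =
      S.emb i (S.piRep i x (ContinuousLinearMap.adjoint (S.emb i) (S.emb i (S.piRep i y _))))
    rw [adjoint_emb_emb, piRep_mul]
    rfl

theorem norm_hatPiRed_le (x : S.BAlg) : ‖S.hatPiRed x‖ ≤ ‖x‖ := by
  refine norm_directSumCLM_le _ _ (norm_nonneg x) fun i => ?_
  have h1 : ‖S.emb i‖ ≤ 1 :=
    ContinuousLinearMap.opNorm_le_bound _ zero_le_one fun ξ => by rw [norm_emb, one_mul]
  have h2 : ‖ContinuousLinearMap.adjoint (S.emb i)‖ ≤ 1 := by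
    rw [LinearIsometryEquiv.norm_map]
    exact h1
  have h3 : ‖S.piRep i x‖ ≤ ‖x‖ := norm_corner_le i _
  calc ‖S.hatPi i x‖ ≤ ‖S.emb i‖ * (‖S.piRep i x‖ * ‖ContinuousLinearMap.adjoint (S.emb i)‖) :=
        (ContinuousLinearMap.opNorm_comp_le _ _).trans
          (by gcongr; exact ContinuousLinearMap.opNorm_comp_le _ _)
    _ ≤ 1 * (‖x‖ * 1) := by gcongr
    _ = ‖x‖ := by ring

/-- The Dirac operator `D_{λᵢ}`: the self-adjoint closure of the supercurrent zero mode `G₀`. -/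
def dirac (i : Fin S.N) : S.HHat i →ₗ.[ℂ] S.HHat i :=
  closedOp (superG0 S.e (S.rep i).toAffineRep (S.rep 0).toAffineRep S.ramond)

/-- The direct sum `D_red` of the Dirac operators. -/
def diracRed : DenseOp S.HHatRed where
  op := directSumOp S.dirac
  dense := directSumOp_dense fun _ => closedOp_dense _

/-- The conformal Hamiltonian `L₀` of the reduced representation. -/
def L0Red : S.HRed →ₗ.[ℂ] S.HRed :=
  directSumOp fun i => closedOp ((S.rep i).L0 S.e)

/-- The compact differentiable algebra `𝔎¹`: the compact elements `x` of the reduced universal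
algebra with `π̂_red(x)` in the domain of the derivation defined by `D_red` and with compact
derivative, with the norm `‖x‖₁ = ‖x‖ + ‖δ(π̂_red(x))‖`. -/
abbrev KOne : Type _ := DiffAlg S.hatPiRed S.diracRed S.norm_hatPiRed_le

end LevelData

/-! ### Stably unital Banach algebras -/

section StablyUnital

variable (A : Type*) [NonUnitalNormedRing A] [NormedSpace ℂ A]

/-- The space `M_∞(A)` of infinite matrices over `A` with finitely many nonzero entries. -/
def MInf : Submodule ℂ (Matrix ℕ ℕ A) where
  carrier := {x | ∃ r : ℕ, ∀ i j, r ≤ i ∨ r ≤ j → x i j = 0}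
  add_mem' := by
    rintro x y ⟨r, hr⟩ ⟨s, hs⟩
    refine ⟨max r s, fun i j h => ?_⟩
    rw [Matrix.add_apply, hr i j (by omega), hs i j (by omega), add_zero]
  zero_mem' := ⟨0, fun _ _ _ => rfl⟩
  smul_mem' := by
    rintro c x ⟨r, hr⟩
    refine ⟨r, fun i j h => ?_⟩
    rw [Matrix.smul_apply, hr i j h, smul_zero]

variable {A}

/-- The matrix product on `M_∞(A)`. -/
instance : Mul (MInf A) where
  mul x y := ⟨fun i j => ∑ᶠ k, x.1 i k * y.1 k j, by
    obtain ⟨r, hr⟩ := x.2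
    obtain ⟨s, hs⟩ := y.2
    refine ⟨max r s, fun i j h => ?_⟩
    refine finsum_eq_zero_of_forall_eq_zero fun k => ?_
    by_cases hi : r ≤ i
    · rw [hr i k (Or.inl hi), zero_mul]
    · rw [hs k j (Or.inr (by omega)), mul_zero]⟩

/-- An algebra norm on `M_∞(A)` that makes each `M_r(A)` a Banach algebra (if `A` is one), with the
topology of entrywise convergence. -/
structure IsMatrixNorm (ν : MInf A → ℝ) : Prop where
  eq_zero_iff : ∀ x, ν x = 0 ↔ x = 0
  add_le : ∀ x y, ν (x + y) ≤ ν x + ν y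
  smul : ∀ (c : ℂ) x, ν (c • x) = ‖c‖ * ν x
  mul_le : ∀ x y, ν (x * y) ≤ ν x * ν y
  equivalent : ∀ r : ℕ, ∃ C : ℝ, ∀ x : MInf A, (∀ i j, r ≤ i ∨ r ≤ j → x.1 i j = 0) →
    (∀ i j, ‖x.1 i j‖ ≤ C * ν x) ∧
      ν x ≤ C * ∑ i ∈ Finset.range r, ∑ j ∈ Finset.range r, ‖x.1 i j‖

/-- The sum of the norms of the entries. -/
def sumNorm (x : MInf A) : ℝ := ∑ᶠ p : ℕ × ℕ, ‖x.1 p.1 p.2‖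

theorem sumNorm_eq (x : MInf A) (n : ℕ) (hn : ∀ i j, n ≤ i ∨ n ≤ j → x.1 i j = 0) :
    sumNorm x = ∑ i ∈ Finset.range n, ∑ j ∈ Finset.range n, ‖x.1 i j‖ := by
  rw [← Finset.sum_product' (f := fun i j => ‖x.1 i j‖)]
  refine finsum_eq_sum_of_support_subset _ fun p hp => ?_
  by_contra h
  simp only [Finset.coe_product, Set.mem_prod, Finset.coe_range, Set.mem_Iio] at h
  exact hp ((congrArg norm (hn p.1 p.2 (by omega))).trans norm_zero)

theorem MInf.exists_bound (x y : MInf A) : ∃ n : ℕ, (∀ i j, n ≤ i ∨ n ≤ j → x.1 i j = 0) ∧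
    ∀ i j, n ≤ i ∨ n ≤ j → y.1 i j = 0 := by
  obtain ⟨r, hr⟩ := x.2
  obtain ⟨s, hs⟩ := y.2
  exact ⟨max r s, fun i j h => hr i j (by omega), fun i j h => hs i j (by omega)⟩

/-- Admissible norms exist. -/
theorem isMatrixNorm_sumNorm : IsMatrixNorm (sumNorm : MInf A → ℝ) where
  eq_zero_iff x := by
    obtain ⟨n, hn⟩ := x.2
    rw [sumNorm_eq x n hn]
    constructor
    · intro h
      ext i j
      by_cases hij : n ≤ i ∨ n ≤ j
      · exact hn i j hij
      · have h1 := (Finset.sum_eq_zero_iff_of_nonneg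
          (f := fun i => ∑ j ∈ Finset.range n, ‖x.1 i j‖)
          (fun i _ => Finset.sum_nonneg fun j _ => norm_nonneg _)).1 h i
          (Finset.mem_range.2 (by omega))
        have h2 := (Finset.sum_eq_zero_iff_of_nonneg (f := fun j => ‖x.1 i j‖)
          (fun j _ => norm_nonneg _)).1 h1 j (Finset.mem_range.2 (by omega))
        exact norm_eq_zero.1 h2
    · rintro rfl
      exact Finset.sum_eq_zero fun i _ => Finset.sum_eq_zero fun j _ => norm_zero
  add_le x y := by
    obtain ⟨n, hx, hy⟩ := MInf.exists_bound x y
    have hxy : ∀ i j, n ≤ i ∨ n ≤ j → (x + y).1 i j = 0 := fun i j h => by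
      change x.1 i j + y.1 i j = 0
      rw [hx i j h, hy i j h, add_zero]
    rw [sumNorm_eq x n hx, sumNorm_eq y n hy, sumNorm_eq _ n hxy, ← Finset.sum_add_distrib]
    refine Finset.sum_le_sum fun i _ => ?_
    rw [← Finset.sum_add_distrib]
    exact Finset.sum_le_sum fun j _ => norm_add_le _ _
  smul c x := by
    obtain ⟨n, hx⟩ := x.2
    have hcx : ∀ i j, n ≤ i ∨ n ≤ j → (c • x).1 i j = 0 := fun i j h => by
      change c • x.1 i j = 0
      rw [hx i j h, smul_zero]
    rw [sumNorm_eq x n hx, sumNorm_eq _ n hcx, Finset.mul_sum]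
    refine Finset.sum_congr rfl fun i _ => ?_
    rw [Finset.mul_sum]
    exact Finset.sum_congr rfl fun j _ => norm_smul _ _
  mul_le x y := by
    obtain ⟨n, hx, hy⟩ := MInf.exists_bound x y
    have hm : ∀ i j, (x * y).1 i j = ∑ k ∈ Finset.range n, x.1 i k * y.1 k j := fun i j => by
      refine finsum_eq_sum_of_support_subset _ fun k hk => ?_
      by_contra h
      simp only [Finset.coe_range, Set.mem_Iio, not_lt] at h
      exact hk (by simp only [hx i k (Or.inr h), zero_mul])
    have hxy : ∀ i j, n ≤ i ∨ n ≤ j → (x * y).1 i j = 0 := fun i j h => by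
      rw [hm]
      refine Finset.sum_eq_zero fun k _ => ?_
      rcases h with h | h
      · rw [hx i k (Or.inl h), zero_mul]
      · rw [hy k j (Or.inr h), mul_zero]
    rw [sumNorm_eq x n hx, sumNorm_eq y n hy, sumNorm_eq _ n hxy, Finset.sum_mul]
    refine Finset.sum_le_sum fun i _ => ?_
    calc ∑ j ∈ Finset.range n, ‖(x * y).1 i j‖
        ≤ ∑ j ∈ Finset.range n, ∑ k ∈ Finset.range n, ‖x.1 i k‖ * ‖y.1 k j‖ := by
          refine Finset.sum_le_sum fun j _ => ?_
          rw [hm]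
          exact (norm_sum_le _ _).trans (Finset.sum_le_sum fun k _ => norm_mul_le _ _)
      _ = ∑ k ∈ Finset.range n, ‖x.1 i k‖ * ∑ j ∈ Finset.range n, ‖y.1 k j‖ := by
          rw [Finset.sum_comm]
          exact Finset.sum_congr rfl fun k _ => (Finset.mul_sum _ _ _).symm
      _ ≤ _ := by
          rw [Finset.sum_mul]
          refine Finset.sum_le_sum fun k hk => mul_le_mul_of_nonneg_left ?_ (norm_nonneg _)
          exact Finset.single_le_sum (f := fun k => ∑ j ∈ Finset.range n, ‖y.1 k j‖)
            (fun i _ => Finset.sum_nonneg fun j _ => norm_nonneg _) hk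
  equivalent r := by
    refine ⟨1, fun x hx => ⟨fun i j => ?_, ?_⟩⟩
    · rw [sumNorm_eq x r hx, one_mul]
      by_cases hij : r ≤ i ∨ r ≤ j
      · rw [hx i j hij, norm_zero]
        exact Finset.sum_nonneg fun i _ => Finset.sum_nonneg fun j _ => norm_nonneg _
      · refine le_trans ?_ (Finset.single_le_sum
          (f := fun i => ∑ j ∈ Finset.range r, ‖x.1 i j‖) (a := i)
          (fun i _ => Finset.sum_nonneg fun j _ => norm_nonneg _) (Finset.mem_range.2 (by omega)))
        exact Finset.single_le_sum (f := fun j => ‖x.1 i j‖) (a := j)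
          (fun j _ => norm_nonneg _) (Finset.mem_range.2 (by omega))
    · rw [sumNorm_eq x r hx, one_mul]

variable (A) in
/-- `A` is stably unital: `M_∞(A)`, with an arbitrary admissible norm, has an approximate identity
of idempotents, i.e. there is a net of idempotents `p` (described here by the filter which it
generates) such that `p x → x` and `x p → x` for every `x`. -/
def IsStablyUnital : Prop :=
  ∀ ν : MInf A → ℝ, IsMatrixNorm ν → ∃ F : Filter (MInf A), F.NeBot ∧
    (∀ᶠ p in F, p * p = p) ∧
    ∀ x, Filter.Tendsto (fun p => ν (p * x - x)) F (nhds 0) ∧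
      Filter.Tendsto (fun p => ν (x * p - x)) F (nhds 0)

end StablyUnital

end

/-!
Energy cutoffs are an approximate identity of the compact differentiable algebra because the Dirac
operator, which is unbounded, nevertheless commutes with the energy.

*The reduced universal algebra.* Differentiating the exponentiation property along the loops
`cos (k θ) x` and `sin (k θ) x` shows that an operator that commutes with a representation of the
loop group commutes weakly with the current modes (`LoopRep.inner_J_of_commute`). An irreducible
highest weight module is spanned by words of lowering operators on the highest weight vector
(`AffineRep.span_word`), whence Schur's lemma (`AffineRep.exists_scalar`). As the summands are
inequivalent, the commutant of the reduced representation consists of scalars on each summand, and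
the bicommutant contains all block diagonal operators (`LevelData.directSumCLM_mem_BAlg`), among
them the spectral projections `e_n` of the conformal Hamiltonian.

*Energy.* The commutation relations `[L₀, Jₙ] = -n Jₙ` follow from the Sugawara formula and the
value `-2 h^∨` of the Casimir element `∑ₐ eₐ²` in the adjoint representation (`casimir_adjoint`,
`AffineRep.L0_J`). The words of
lowering operators are therefore eigenvectors of `L₀`, and only finitely many nonzero words lie
below a given energy: `L₀` dominates the squares of the zero modes, so the weight of such a word is
bounded, hence its length (`AffineRep.exists_energy_basis`). So `e_n` has finite rank.

*The Dirac operator.* Let `L̂₀` be the conformal Hamiltonian of the triple tensor product. The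
supercurrent zero mode is symmetric (`superG0_symm`) and commutes with `L̂₀` (`hatL0_superG0`), and
so the spectral projections `Ê` of `L̂₀` reduce its closure `D` (`spectralProj_commute`). The
projection `π̂(e_n)` has finite rank and range in the domain of the symmetric operator `D`, which
puts it into the domain of the derivation, with a compact derivative
(`exists_isDerivation_of_finiteRank`).

*Approximate identity.* Since `Ω` and `ψ` are energy eigenvectors, `π̂(e_n)` agrees on the vectors
`ξ ⊗ Ω ⊗ ψ` with the spectral projection `Ê_n` of `L̂₀` at a shifted cutoff. Hence
`π̂(e_n x) = Ê_n π̂(x)` and, as `Ê_n` commutes with `D`, `δ(π̂(e_n x)) = Ê_n δ(π̂(x))`, and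
similarly on the other side. Both `x` and `δ(π̂(x))` are compact and the projections converge
strongly to the identity, so `e_n x → x` and `x e_n → x` in the norm `‖·‖₁`
(`DiffAlg.tendsto_mul_left`, `DiffAlg.tendsto_mul_right`). Density of the finite-rank elements and
stable unitality (`isStablyUnital_of_tendsto`) follow, and completeness holds because `D` is closed
(`DiffAlg.completeSpace`).
-/

/-! ### Compact operators and strongly convergent projections -/

section Compact

variable {H K : Type*} [NormedAddCommGroup H] [InnerProductSpace ℂ H] [CompleteSpace H]
  [NormedAddCommGroup K] [InnerProductSpace ℂ K] [CompleteSpace K]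

/-- A strongly convergent bounded sequence converges uniformly on the relatively compact image of
the unit ball under a compact operator. -/
theorem IsCompactOperator.tendsto_mul_left {E : ℕ → H →L[ℂ] H} (hE : ∀ n, ‖E n‖ ≤ 1)
    (hs : ∀ x, Filter.Tendsto (fun n => E n x) Filter.atTop (nhds x)) {T : H →L[ℂ] H}
    (hT : IsCompactOperator T) :
    Filter.Tendsto (fun n => E n * T) Filter.atTop (nhds T) := by
  rw [Metric.tendsto_atTop]
  intro ε hε
  obtain ⟨C, hC, hCT⟩ := hT.image_closedBall_subset_compact (f := (T : H →ₗ[ℂ] H)) 1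
  obtain ⟨t, -, htf, hcov⟩ := hC.finite_cover_balls (show 0 < ε / 6 by positivity)
  have hev : ∀ᶠ n in Filter.atTop, ∀ y ∈ t, ‖E n y - y‖ < ε / 6 := by
    rw [Filter.eventually_all_finite htf]
    intro y _
    have := (hs y).eventually (Metric.ball_mem_nhds y (show 0 < ε / 6 by positivity))
    filter_upwards [this] with n hn
    rwa [← dist_eq_norm]
  obtain ⟨N, hN⟩ := Filter.eventually_atTop.1 hev
  refine ⟨N, fun n hn => ?_⟩
  rw [dist_eq_norm]
  refine lt_of_le_of_lt (ContinuousLinearMap.opNorm_le_of_unit_norm (C := ε / 2)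
    (by positivity) fun x hx => ?_) (by linarith)
  have hx' : T x ∈ C := hCT ⟨x, by simp [hx], rfl⟩
  obtain ⟨y, hy, hxy⟩ := Set.mem_iUnion₂.1 (hcov hx')
  rw [Metric.mem_ball, dist_eq_norm] at hxy
  have h1 : ‖E n (T x - y)‖ ≤ ‖T x - y‖ := by
    simpa using (E n).le_of_opNorm_le (hE n) (T x - y)
  have h2 := hN n hn y hy
  have h3 : (E n * T - T) x = E n (T x - y) + (E n y - y) + (y - T x) := by
    rw [map_sub]
    change E n (T x) - T x = _
    abel
  rw [h3]
  have h4 := norm_add₃_le (a := E n (T x - y)) (b := E n y - y) (c := y - T x)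
  rw [norm_sub_rev y] at h4
  linarith

theorem IsCompactOperator.tendsto_mul_right {E : ℕ → H →L[ℂ] H} (hE : ∀ n, ‖E n‖ ≤ 1)
    (hsa : ∀ n, IsSelfAdjoint (E n))
    (hs : ∀ x, Filter.Tendsto (fun n => E n x) Filter.atTop (nhds x)) {T : H →L[ℂ] H}
    (hT : IsCompactOperator T) :
    Filter.Tendsto (fun n => T * E n) Filter.atTop (nhds T) := by
  have hc : IsCompactOperator (star T * T : H →L[ℂ] H) := hT.clm_comp (star T)
  have h1 := (hc.tendsto_mul_left hE hs)
  rw [tendsto_iff_norm_sub_tendsto_zero] at h1 ⊢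
  have h2 : ∀ n, ‖T * E n - T‖ ≤ Real.sqrt (2 * ‖E n * (star T * T) - star T * T‖) := by
    intro n
    refine Real.le_sqrt_of_sq_le ?_
    -- the C*-identity reduces the claim to the compact operator `T* T`
    have h3 : star (T * E n - T) * (T * E n - T) =
        (E n * (star T * T) - star T * T) * (E n - 1) := by
      rw [star_sub, star_mul, (hsa n).star_eq]
      noncomm_ring
    have h4 : ‖(1 : H →L[ℂ] H)‖ ≤ 1 := ContinuousLinearMap.norm_id_le
    rw [sq, ← CStarRing.norm_star_mul_self, h3, mul_comm (2 : ℝ)]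
    refine (norm_mul_le _ _).trans ?_
    gcongr
    exact (norm_sub_le _ _).trans (by linarith [hE n])
  refine squeeze_zero (fun _ => norm_nonneg _) h2 ?_
  have h5 := (h1.const_mul 2).sqrt
  simpa using h5

theorem isCompactOperator_of_range_finiteDimensional {T : H →L[ℂ] K}
    (hT : FiniteDimensional ℂ (LinearMap.range T.toLinearMap)) : IsCompactOperator T := by
  have : IsCompactOperator (T.rangeRestrict : H → LinearMap.range T.toLinearMap) := by
    have : ProperSpace (LinearMap.range T.toLinearMap) := FiniteDimensional.proper ℂ _
    refine ⟨Metric.closedBall 0 ‖T‖, isCompact_closedBall _ _, ?_⟩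
    refine Filter.mem_of_superset (Metric.closedBall_mem_nhds (0 : H) one_pos) fun x hx => ?_
    simp only [Set.mem_preimage, mem_closedBall_zero_iff] at hx ⊢
    change ‖T x‖ ≤ _
    exact (T.le_opNorm x).trans (mul_le_of_le_one_right (norm_nonneg _) hx)
  exact this.clm_comp (Submodule.subtypeL _)

end Compact

/-! ### Completeness of the compact differentiable algebra -/

section Complete

variable {H K : Type*} [NormedAddCommGroup H] [InnerProductSpace ℂ H] [CompleteSpace H]
  [NormedAddCommGroup K] [InnerProductSpace ℂ K] [CompleteSpace K]
  {B : Subalgebra ℂ (H →L[ℂ] H)}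

/-- A limit, in the norm `‖x‖₁`, of elements of the algebra is in the domain of the derivation
because the graph of `D` is closed. -/
theorem DiffAlg.completeSpace {P : B →ₙₐ[ℂ] (K →L[ℂ] K)} {D : DenseOp K}
    {hP : ∀ x, ‖P x‖ ≤ ‖x‖} (hB : IsClosed (B : Set (H →L[ℂ] H))) (hD : D.op.IsClosed) :
    CompleteSpace (DiffAlg P D hP) := by
  refine Metric.complete_of_cauchySeq_tendsto fun x hx => ?_
  have hsub : ∀ m n, ‖(x m).toOp - (x n).toOp‖ + ‖(x m).deriv - (x n).deriv‖ = ‖x m - x n‖ := by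
    intro m n
    have h1 : (x m - x n).deriv = (x m).deriv - (x n).deriv := by
      rw [sub_eq_add_neg, ← neg_one_smul ℂ, DiffAlg.deriv_add, DiffAlg.deriv_smul, neg_one_smul,
        sub_eq_add_neg]
    rw [DiffAlg.norm_def, h1]
    rfl
  have hc1 : CauchySeq fun n => (x n).toOp := by
    rw [Metric.cauchySeq_iff'] at hx ⊢
    intro ε hε
    obtain ⟨N, hN⟩ := hx ε hε
    refine ⟨N, fun n hn => ?_⟩
    have := hN n hn
    rw [dist_eq_norm, ← hsub] at this
    rw [dist_eq_norm]
    linarith [norm_nonneg ((x n).deriv - (x N).deriv)]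
  have hc2 : CauchySeq fun n => (x n).deriv := by
    rw [Metric.cauchySeq_iff'] at hx ⊢
    intro ε hε
    obtain ⟨N, hN⟩ := hx ε hε
    refine ⟨N, fun n hn => ?_⟩
    have := hN n hn
    rw [dist_eq_norm, ← hsub] at this
    rw [dist_eq_norm]
    linarith [norm_nonneg ((x n).toOp - (x N).toOp)]
  obtain ⟨T, hT⟩ := cauchySeq_tendsto_of_complete hc1
  obtain ⟨y, hy⟩ := cauchySeq_tendsto_of_complete hc2
  have hTB : T ∈ B := hB.mem_of_tendsto hT (Filter.Eventually.of_forall fun n => (x n).elt.1.2)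
  have hTc : IsCompactOperator T := by
    refine isClosed_setOfPred_isCompactOperator.mem_of_tendsto hT
      (Filter.Eventually.of_forall fun n => (x n).elt.2.1)
  have hyc : IsCompactOperator y := by
    refine isClosed_setOfPred_isCompactOperator.mem_of_tendsto hy
      (Filter.Eventually.of_forall fun n => ?_)
    obtain ⟨-, z, hz, hzc⟩ := (x n).elt.2
    rw [DiffAlg.deriv_eq hz]
    exact hzc
  have hPx : Filter.Tendsto (fun n => P (x n).elt.1) Filter.atTop (nhds (P ⟨T, hTB⟩)) := by
    rw [tendsto_iff_norm_sub_tendsto_zero] at hT ⊢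
    refine squeeze_zero (fun _ => norm_nonneg _) (fun n => ?_) hT
    rw [← map_sub]
    exact hP _
  have hder : IsDerivation D.op (P ⟨T, hTB⟩) y := by
    intro ξ
    have hev : ∀ (S : ℕ → K →L[ℂ] K) (S' : K →L[ℂ] K),
        Filter.Tendsto S Filter.atTop (nhds S') → ∀ η : K,
        Filter.Tendsto (fun n => S n η) Filter.atTop (nhds (S' η)) := fun S S' h η =>
      ((ContinuousLinearMap.apply ℂ K η).continuous.tendsto S').comp h
    have h1 : ((P ⟨T, hTB⟩ ξ : K), P ⟨T, hTB⟩ (D.op ξ) + y ξ) ∈ (D.op.graph : Set (K × K)) := by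
      refine hD.mem_of_tendsto ((hev _ _ hPx (ξ : K)).prodMk_nhds
        ((hev _ _ hPx (D.op ξ)).add (hev _ _ hy (ξ : K)))) (Filter.Eventually.of_forall fun n => ?_)
      obtain ⟨h, h'⟩ := (x n).isDerivation ξ
      refine (LinearPMap.mem_graph_iff _).2 ⟨⟨_, h⟩, rfl, ?_⟩
      change _ = P _ (D.op ξ) + _
      rw [h', sub_add_cancel]
    obtain ⟨z, hz, hz'⟩ := (LinearPMap.mem_graph_iff _).1 h1
    have hz1 : (z : K) = P ⟨T, hTB⟩ ξ := hz
    have hz2 : D.op z = P ⟨T, hTB⟩ (D.op ξ) + y ξ := hz'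
    refine ⟨hz1 ▸ z.2, ?_⟩
    have : (⟨P ⟨T, hTB⟩ ξ, hz1 ▸ z.2⟩ : D.op.domain) = z := Subtype.ext hz1.symm
    rw [this, hz2, add_sub_cancel_right]
  let X : DiffAlg P D hP := ⟨⟨⟨T, hTB⟩, hTc, y, hder, hyc⟩⟩
  have hX : X.deriv = y := DiffAlg.deriv_eq hder
  refine ⟨X, ?_⟩
  rw [tendsto_iff_norm_sub_tendsto_zero] at hT hy ⊢
  have := hT.add hy
  rw [add_zero] at this
  refine this.congr fun n => ?_
  have h1 : (x n - X).deriv = (x n).deriv - y := by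
    rw [sub_eq_add_neg, ← neg_one_smul ℂ, DiffAlg.deriv_add, DiffAlg.deriv_smul, neg_one_smul,
      hX, sub_eq_add_neg]
  rw [DiffAlg.norm_def, h1]
  rfl

end Complete

/-! ### Closures of symmetric operators -/

section Symmetric

variable {X : Type*} [NormedAddCommGroup X] [InnerProductSpace ℂ X]

theorem coreOp_toHilb (A : Module.End ℂ X) (x : X) :
    coreOp A ⟨toHilb x, ⟨x, rfl⟩⟩ = toHilb (A x) := by
  have : (LinearEquiv.ofInjective (toHilb : X →ₗᵢ[ℂ] HilbC X).toLinearMap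
      (toHilb : X →ₗᵢ[ℂ] HilbC X).injective).symm ⟨toHilb x, ⟨x, rfl⟩⟩ = x := by
    rw [LinearEquiv.symm_apply_eq]
    rfl
  exact congrArg (fun z : X => toHilb (A z)) this

theorem coreOp_dense (A : Module.End ℂ X) : Dense ((coreOp A).domain : Set (HilbC X)) := by
  refine Dense.mono ?_ (denseRange_toHilb (X := X))
  rintro _ ⟨x, rfl⟩
  exact ⟨x, rfl⟩

/-- A densely defined symmetric operator is closable, since its adjoint is a closed extension. -/
theorem coreOp_isClosable {A : Module.End ℂ X} (hA : ∀ u v, ip (A u) v = ip u (A v)) :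
    (coreOp A).IsClosable := by
  refine (LinearPMap.adjoint_isClosed (coreOp_dense A)).isClosable.leIsClosable
    (LinearPMap.IsFormalAdjoint.le_adjoint (coreOp_dense A) ?_)
  rintro ⟨_, x, rfl⟩ ⟨_, y, rfl⟩
  refine (congrArg (fun z => inner ℂ z (toHilb y)) (coreOp_toHilb A x)).trans ?_
  refine Eq.trans ?_ (congrArg (fun z => inner ℂ (toHilb x) z) (coreOp_toHilb A y)).symm
  rw [LinearIsometry.inner_map_map, LinearIsometry.inner_map_map]
  exact hA x y

theorem closedOp_isClosed {A : Module.End ℂ X} (hA : ∀ u v, ip (A u) v = ip u (A v)) :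
    (closedOp A).IsClosed :=
  (coreOp_isClosable hA).closure_isClosed

/-- To prove a closed condition on the graph of the closure of a symmetric operator, it suffices to
consider the core. -/
theorem closedOp_induction {A : Module.End ℂ X} (hA : ∀ u v, ip (A u) v = ip u (A v))
    {p : HilbC X × HilbC X → Prop} (hp : IsClosed {z | p z})
    (h : ∀ x : X, p (toHilb x, toHilb (A x))) (ξ : (closedOp A).domain) :
    p (ξ, closedOp A ξ) := by
  have h1 : ((ξ : HilbC X), closedOp A ξ) ∈ (closedOp A).graph :=
    (LinearPMap.mem_graph_iff _).2 ⟨ξ, rfl, rfl⟩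
  replace h1 : ((ξ : HilbC X), closedOp A ξ) ∈ (coreOp A).graph.topologicalClosure := by
    rw [(coreOp_isClosable hA).graph_closure_eq_closure_graph]
    exact h1
  have h2 : ((coreOp A).graph : Set (HilbC X × HilbC X)) ⊆ {z | p z} := by
    rintro ⟨a, b⟩ hab
    obtain ⟨⟨_, x, rfl⟩, rfl, rfl⟩ := (LinearPMap.mem_graph_iff _).1 hab
    have h3 := coreOp_toHilb A x
    change p (toHilb x, coreOp A ⟨toHilb x, ⟨x, rfl⟩⟩)
    rw [h3]
    exact h x
  exact closure_minimal h2 hp h1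

theorem closedOp_symmetric {A : Module.End ℂ X} (hA : ∀ u v, ip (A u) v = ip u (A v))
    (ξ η : (closedOp A).domain) :
    inner ℂ (closedOp A ξ) (η : HilbC X) = inner ℂ (ξ : HilbC X) (closedOp A η) := by
  refine closedOp_induction hA
    (p := fun z => inner ℂ (closedOp A ξ) z.1 = inner ℂ (ξ : HilbC X) z.2)
    (isClosed_eq (by fun_prop) (by fun_prop)) (fun y => ?_) η
  refine closedOp_induction hA
    (p := fun z => inner ℂ z.2 (toHilb y) = inner ℂ z.1 (toHilb (A y)))
    (isClosed_eq (by fun_prop) (by fun_prop)) (fun x => ?_) ξ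
  dsimp only
  rw [LinearIsometry.inner_map_map, LinearIsometry.inner_map_map]
  exact hA x y

end Symmetric

/-! ### Spectral projections of diagonalizable symmetric operators -/

section Spectral

variable {X : Type*} [NormedAddCommGroup X] [InnerProductSpace ℂ X]

/-- The eigenvectors of `L` with real eigenvalues span the space. -/
def IsDiagonalizable {X : Type*} [AddCommGroup X] [Module ℂ X] (L : Module.End ℂ X) : Prop :=
  Submodule.span ℂ {x | ∃ h : ℝ, L x = (h : ℂ) • x} = ⊤

theorem IsDiagonalizable.induction {X : Type*} [AddCommGroup X] [Module ℂ X] {L : Module.End ℂ X}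
    (hL : IsDiagonalizable L) {p : X → Prop} (h0 : p 0) (ha : ∀ x y, p x → p y → p (x + y))
    (hs : ∀ (c : ℂ) x, p x → p (c • x)) (he : ∀ (h : ℝ) x, L x = (h : ℂ) • x → p x) (x : X) :
    p x := by
  have hx : x ∈ Submodule.span ℂ {x | ∃ h : ℝ, L x = (h : ℂ) • x} := by
    rw [hL]
    trivial
  induction hx using Submodule.span_induction with
  | mem x hx => exact he _ x hx.choose_spec
  | zero => exact h0
  | add x y _ _ hx hy => exact ha x y hx hy
  | smul c x _ hx => exact hs c x hx

variable {L : Module.End ℂ X} (hL : ∀ u v, ip (L u) v = ip u (L v))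

theorem spectralProj_norm_le {E : Type*} [NormedAddCommGroup E] [InnerProductSpace ℂ E]
    [CompleteSpace E] (T : E →ₗ.[ℂ] E) (c : ℝ) : ‖spectralProj T c‖ ≤ 1 :=
  Submodule.starProjection_norm_le _

theorem spectralProj_isSelfAdjoint {E : Type*} [NormedAddCommGroup E] [InnerProductSpace ℂ E]
    [CompleteSpace E] (T : E →ₗ.[ℂ] E) (c : ℝ) : IsSelfAdjoint (spectralProj T c) :=
  isSelfAdjoint_starProjection _

theorem spectralProj_mul_self {E : Type*} [NormedAddCommGroup E] [InnerProductSpace ℂ E]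
    [CompleteSpace E] (T : E →ₗ.[ℂ] E) (c : ℝ) :
    spectralProj T c * spectralProj T c = spectralProj T c :=
  Submodule.isIdempotentElem_starProjection _

theorem spectralProj_toHilb_of_lt {c h : ℝ} (hc : h < c) {x : X} (hx : L x = (h : ℂ) • x) :
    spectralProj (closedOp L) c (toHilb x) = toHilb x := by
  refine Submodule.starProjection_eq_self_iff.2 (Submodule.le_topologicalClosure _
    (Submodule.subset_span ⟨h, hc, toHilb_mem_closedOp L x, ?_⟩))
  rw [closedOp_toHilb, hx, map_smul]

include hL in
theorem inner_eigenvector_closedOp {μ h : ℝ} (hμ : μ ≠ h) {x : X} (hx : L x = (h : ℂ) • x)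
    {ξ : HilbC X} (hξ : ξ ∈ (closedOp L).domain) (he : closedOp L ⟨ξ, hξ⟩ = (μ : ℂ) • ξ) :
    inner ℂ ξ (toHilb x) = 0 := by
  have h1 := closedOp_symmetric hL ⟨ξ, hξ⟩ ⟨toHilb x, toHilb_mem_closedOp L x⟩
  rw [closedOp_toHilb, he, hx, map_smul, inner_smul_left, inner_smul_right, Complex.conj_ofReal]
    at h1
  have h2 : ((μ : ℂ) - h) * inner ℂ ξ (toHilb x) = 0 := by
    rw [sub_mul]
    exact sub_eq_zero.2 h1
  refine (mul_eq_zero.1 h2).resolve_left ?_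
  exact fun h3 => hμ (by exact_mod_cast sub_eq_zero.1 h3)

include hL in
theorem spectralProj_toHilb_of_le {c h : ℝ} (hc : c ≤ h) {x : X} (hx : L x = (h : ℂ) • x) :
    spectralProj (closedOp L) c (toHilb x) = 0 := by
  refine (Submodule.starProjection_apply_eq_zero_iff _).2 ?_
  rw [Submodule.orthogonal_closure, Submodule.mem_orthogonal]
  intro u hu
  induction hu using Submodule.span_induction with
  | mem u hu =>
    obtain ⟨μ, hμ, hd, he⟩ := hu
    exact inner_eigenvector_closedOp hL (by linarith) hx hd he
  | zero => exact inner_zero_left _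
  | add a b _ _ ha hb => rw [inner_add_left, ha, hb, add_zero]
  | smul c a _ ha => rw [inner_smul_left, ha, mul_zero]

include hL in
theorem spectralProj_tendsto (hd : IsDiagonalizable L) {c : ℕ → ℝ}
    (hc : Filter.Tendsto c Filter.atTop Filter.atTop) (ξ : HilbC X) :
    Filter.Tendsto (fun n => spectralProj (closedOp L) (c n) ξ) Filter.atTop (nhds ξ) := by
  have hcore : ∀ x : X, ∀ᶠ n in Filter.atTop,
      spectralProj (closedOp L) (c n) (toHilb x) = toHilb x := by
    refine hd.induction (by simp) (fun x y hx hy => ?_) (fun a x hx => ?_) fun h x hx => ?_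
    · filter_upwards [hx, hy] with n h1 h2
      rw [map_add, map_add, h1, h2]
    · filter_upwards [hx] with n h1
      rw [map_smul, map_smul, h1]
    · filter_upwards [hc.eventually_gt_atTop h] with n hn
      exact spectralProj_toHilb_of_lt hn hx
  rw [Metric.tendsto_atTop]
  intro ε hε
  obtain ⟨x, hx⟩ := denseRange_toHilb.exists_dist_lt ξ (show 0 < ε / 2 by positivity)
  obtain ⟨N, hN⟩ := Filter.eventually_atTop.1 (hcore x)
  refine ⟨N, fun n hn => ?_⟩
  rw [dist_eq_norm] at hx ⊢
  have h1 : ‖spectralProj (closedOp L) (c n) (ξ - toHilb x)‖ ≤ ‖ξ - toHilb x‖ := by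
    simpa using (spectralProj (closedOp L) (c n)).le_of_opNorm_le (spectralProj_norm_le _ _)
      (ξ - toHilb x)
  have h2 : spectralProj (closedOp L) (c n) ξ - ξ =
      spectralProj (closedOp L) (c n) (ξ - toHilb x) - (ξ - toHilb x) := by
    rw [map_sub, hN n hn]
    abel
  rw [h2]
  linarith [norm_sub_le (spectralProj (closedOp L) (c n) (ξ - toHilb x)) (ξ - toHilb x)]

/-- The spectral projections of `L` reduce the closure of every symmetric operator that commutes
with `L`. -/
theorem spectralProj_commute (hL : ∀ u v, ip (L u) v = ip u (L v)) (hd : IsDiagonalizable L)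
    {A : Module.End ℂ X} (hA : ∀ u v, ip (A u) v = ip u (A v)) (hLA : ∀ x, L (A x) = A (L x))
    (c : ℝ) (ξ : (closedOp A).domain) :
    ∃ h : spectralProj (closedOp L) c ξ ∈ (closedOp A).domain,
      closedOp A ⟨_, h⟩ = spectralProj (closedOp L) c (closedOp A ξ) := by
  have hcl : IsClosed {z : HilbC X × HilbC X | (spectralProj (closedOp L) c z.1,
      spectralProj (closedOp L) c z.2) ∈ ((closedOp A).graph : Set (HilbC X × HilbC X))} :=
    (closedOp_isClosed hA).preimage (by fun_prop)
  have h := closedOp_induction hA hcl (fun x => ?_) ξ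
  · obtain ⟨z, hz, hz'⟩ := (LinearPMap.mem_graph_iff _).1 h
    have hz1 : (z : HilbC X) = spectralProj (closedOp L) c ξ := hz
    refine ⟨hz1 ▸ z.2, ?_⟩
    have : (⟨spectralProj (closedOp L) c ξ, hz1 ▸ z.2⟩ : (closedOp A).domain) = z :=
      Subtype.ext hz1.symm
    rw [this]
    exact hz'
  · refine hd.induction (p := fun x => (spectralProj (closedOp L) c (toHilb x),
      spectralProj (closedOp L) c (toHilb (A x))) ∈ (closedOp A).graph) ?_ (fun x y hx hy => ?_)
      (fun a x hx => ?_) (fun h x hx => ?_) x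
    · simp only [map_zero]
      exact (closedOp A).graph.zero_mem
    · simp only [map_add]
      exact (closedOp A).graph.add_mem hx hy
    · simp only [map_smul]
      exact (closedOp A).graph.smul_mem a hx
    · have hAx : L (A x) = (h : ℂ) • A x := by rw [hLA, hx, map_smul]
      rcases lt_or_ge h c with hc | hc
      · rw [spectralProj_toHilb_of_lt hc hx, spectralProj_toHilb_of_lt hc hAx]
        exact (LinearPMap.mem_graph_iff _).2 ⟨⟨_, toHilb_mem_closedOp A x⟩, rfl,
          closedOp_toHilb A x⟩
      · rw [spectralProj_toHilb_of_le hL hc hx, spectralProj_toHilb_of_le hL hc hAx]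
        exact (closedOp A).graph.zero_mem

/-- The range of a spectral projection consists of vectors of the core if only finitely many
eigenvectors from a spanning family have a small eigenvalue. -/
theorem spectralProj_mem_map_toHilb (hL : ∀ u v, ip (L u) v = ip u (L v)) {ι : Type*} {b : ι → X}
    {h : ι → ℝ} (hb : ∀ i, L (b i) = (h i : ℂ) • b i) (hspan : Submodule.span ℂ (Set.range b) = ⊤)
    (c : ℝ) (hfin : FiniteDimensional ℂ (Submodule.span ℂ (b '' {i | h i < c}))) (ξ : HilbC X) :
    spectralProj (closedOp L) c ξ ∈ (Submodule.span ℂ (b '' {i | h i < c})).map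
      (toHilb : X →ₗᵢ[ℂ] HilbC X).toLinearMap := by
  have hcl : IsClosed (((Submodule.span ℂ (b '' {i | h i < c})).map
      (toHilb : X →ₗᵢ[ℂ] HilbC X).toLinearMap : Submodule ℂ (HilbC X)) : Set (HilbC X)) :=
    Submodule.closed_of_finiteDimensional _
  refine denseRange_toHilb.induction_on (p := fun ξ => spectralProj (closedOp L) c ξ ∈ _) ξ
    (hcl.preimage (spectralProj (closedOp L) c).continuous) fun x => ?_
  have hx : x ∈ Submodule.span ℂ (Set.range b) := by
    rw [hspan]
    trivial
  induction hx using Submodule.span_induction with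
  | mem x hx =>
    obtain ⟨i, rfl⟩ := hx
    rcases lt_or_ge (h i) c with hc | hc
    · rw [spectralProj_toHilb_of_lt hc (hb i)]
      exact ⟨b i, Submodule.subset_span ⟨i, hc, rfl⟩, rfl⟩
    · rw [spectralProj_toHilb_of_le hL hc (hb i)]
      exact Submodule.zero_mem _
  | zero => simp
  | add x y _ _ hx hy =>
    rw [map_add, map_add]
    exact Submodule.add_mem _ hx hy
  | smul c x _ hx =>
    rw [map_smul, map_smul]
    exact Submodule.smul_mem _ c hx

end Spectral

/-! ### Direct sums of unbounded operators -/

section DirectSumOp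

variable {ι : Type*} [Fintype ι] [DecidableEq ι] {K : ι → Type*} [∀ i, NormedAddCommGroup (K i)]
  [∀ i, InnerProductSpace ℂ (K i)]

theorem sum_inclCLM (x : PiLp 2 K) : ∑ i, inclCLM K i (x i) = x := by
  ext j
  rw [WithLp.ofLp_sum, Finset.sum_apply]
  simp only [inclCLM_apply]
  rw [Finset.sum_eq_single j (fun i _ hi => Pi.single_eq_of_ne hi.symm _) (by simp),
    Pi.single_eq_same]

theorem directSumOp_apply (T : ∀ i, K i →ₗ.[ℂ] K i) (x : (directSumOp T).domain) (i : ι) :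
    directSumOp T x i = T i ⟨x.1 i, x.2 i⟩ := rfl

theorem directSumOp_isClosed {T : ∀ i, K i →ₗ.[ℂ] K i} (hT : ∀ i, (T i).IsClosed) :
    (directSumOp T).IsClosed := by
  have h1 : ((directSumOp T).graph : Set (PiLp 2 K × PiLp 2 K)) =
      ⋂ i, (fun z : PiLp 2 K × PiLp 2 K => (z.1 i, z.2 i)) ⁻¹' ((T i).graph : Set (K i × K i)) := by
    ext ⟨a, b⟩
    simp only [Set.mem_iInter, Set.mem_preimage, SetLike.mem_coe]
    constructor
    · intro h i
      obtain ⟨z, rfl, rfl⟩ := (LinearPMap.mem_graph_iff _).1 h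
      exact (LinearPMap.mem_graph_iff _).2 ⟨⟨z.1 i, z.2 i⟩, rfl, rfl⟩
    · intro h
      have h2 : ∀ i, ∃ hi : a i ∈ (T i).domain, T i ⟨a i, hi⟩ = b i := fun i => by
        obtain ⟨⟨z, hz⟩, hz1, hz2⟩ := (LinearPMap.mem_graph_iff _).1 (h i)
        dsimp only at hz1 hz2
        subst hz1
        exact ⟨hz, hz2⟩
      refine (LinearPMap.mem_graph_iff _).2 ⟨⟨a, fun i => (h2 i).1⟩, rfl, ?_⟩
      ext i
      exact (h2 i).2
  rw [LinearPMap.IsClosed, h1]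
  exact isClosed_iInter fun i => (hT i).preimage (by fun_prop)

theorem directSumOp_symmetric {T : ∀ i, K i →ₗ.[ℂ] K i}
    (hT : ∀ i (x y : (T i).domain), inner ℂ (T i x) (y : K i) = inner ℂ (x : K i) (T i y))
    (x y : (directSumOp T).domain) :
    inner ℂ (directSumOp T x) (y : PiLp 2 K) = inner ℂ (x : PiLp 2 K) (directSumOp T y) := by
  rw [PiLp.inner_apply, PiLp.inner_apply]
  exact Finset.sum_congr rfl fun i _ => hT i ⟨x.1 i, x.2 i⟩ ⟨y.1 i, y.2 i⟩

/-- Spectral projections are formed summand by summand. -/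
theorem spectralProj_directSumOp [∀ i, CompleteSpace (K i)] (T : ∀ i, K i →ₗ.[ℂ] K i) (c : ℝ) :
    spectralProj (directSumOp T) c = directSumCLM fun i => spectralProj (T i) c := by
  ext1 ξ
  refine Submodule.eq_starProjection_of_mem_orthogonal ?_ ?_
  · have h1 : ∀ i, inclCLM K i (spectralProj (T i) c (ξ i)) ∈ (Submodule.span ℂ
        {x : PiLp 2 K | ∃ μ : ℝ, μ < c ∧ ∃ h : x ∈ (directSumOp T).domain,
          directSumOp T ⟨x, h⟩ = (μ : ℂ) • x}).topologicalClosure := by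
      intro i
      have h2 : (Submodule.span ℂ {x : K i | ∃ μ : ℝ, μ < c ∧ ∃ h : x ∈ (T i).domain,
          T i ⟨x, h⟩ = (μ : ℂ) • x}).topologicalClosure ≤ ((Submodule.span ℂ
        {x : PiLp 2 K | ∃ μ : ℝ, μ < c ∧ ∃ h : x ∈ (directSumOp T).domain,
          directSumOp T ⟨x, h⟩ = (μ : ℂ) • x}).topologicalClosure).comap
            (inclCLM K i).toLinearMap := by
        refine Submodule.topologicalClosure_minimal _ (Submodule.span_le.2 ?_)
          ((Submodule.isClosed_topologicalClosure _).preimage (inclCLM K i).continuous)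
        rintro x ⟨μ, hμ, hd, he⟩
        have hmem : inclCLM K i x ∈ (directSumOp T).domain := fun j => by
          rw [inclCLM_apply]
          rcases eq_or_ne j i with rfl | hj
          · rwa [Pi.single_eq_same]
          · rw [Pi.single_eq_of_ne hj]
            exact (T j).domain.zero_mem
        refine Submodule.le_topologicalClosure _ (Submodule.subset_span ⟨μ, hμ, hmem, ?_⟩)
        ext j
        rw [directSumOp_apply]
        have h3 : ∀ y (hy : y ∈ (T j).domain), y = Pi.single i x j →
            T j ⟨y, hy⟩ = (μ : ℂ) • y := by
          intro y hy hyx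
          rcases eq_or_ne j i with rfl | hj
          · rw [Pi.single_eq_same] at hyx
            subst hyx
            exact he
          · rw [Pi.single_eq_of_ne hj] at hyx
            subst hyx
            rw [smul_zero]
            exact (T j).map_zero
        exact h3 _ (hmem j) rfl
      exact h2 (Submodule.starProjection_apply_mem _ _)
    rw [← sum_inclCLM (directSumCLM _ ξ)]
    exact Submodule.sum_mem _ fun i _ => h1 i
  · rw [Submodule.orthogonal_closure, Submodule.mem_orthogonal]
    intro u hu
    induction hu using Submodule.span_induction with
    | mem u hu =>
      obtain ⟨μ, hμ, hd, he⟩ := hu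
      rw [PiLp.inner_apply]
      refine Finset.sum_eq_zero fun i _ => ?_
      have h1 : u i ∈ (Submodule.span ℂ {x : K i | ∃ μ : ℝ, μ < c ∧ ∃ h : x ∈ (T i).domain,
          T i ⟨x, h⟩ = (μ : ℂ) • x}).topologicalClosure := by
        refine Submodule.le_topologicalClosure _ (Submodule.subset_span ⟨μ, hμ, hd i, ?_⟩)
        exact congrArg (fun z : PiLp 2 K => z i) he
      exact (Submodule.mem_orthogonal _ _).1
        (Submodule.sub_starProjection_mem_orthogonal (ξ i)) _ h1
    | zero => exact inner_zero_left _
    | add a b _ _ ha hb => rw [inner_add_left, ha, hb, add_zero]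
    | smul c a _ ha => rw [inner_smul_left, ha, mul_zero]

end DirectSumOp

/-! ### Finite-rank projections in the domain of the derivation -/

section FiniteRank

variable {K : Type*} [NormedAddCommGroup K] [InnerProductSpace ℂ K] [CompleteSpace K]

/-- If `D` is symmetric and the finite-dimensional range of the projection `P` lies in the domain
of `D`, then `z = D P` is bounded, `P D` is contained in `z*`, and the derivation maps `P` to
`z - z*`. -/
theorem exists_isDerivation_of_finiteRank {D : K →ₗ.[ℂ] K}
    (hD : ∀ x y : D.domain, inner ℂ (D x) (y : K) = inner ℂ (x : K) (D y)) {P : K →L[ℂ] K}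
    (hsa : IsSelfAdjoint P) (hid : P * P = P)
    (hfin : FiniteDimensional ℂ (LinearMap.range P.toLinearMap))
    (hmem : ∀ ξ, P ξ ∈ D.domain) : ∃ y, IsDerivation D P y ∧ IsCompactOperator y := by
  have hfin' : FiniteDimensional ℂ (LinearMap.range P.toLinearMap) := hfin
  let f : LinearMap.range P.toLinearMap →ₗ[ℂ] K :=
    D.toFun ∘ₗ Submodule.inclusion (by rintro _ ⟨ξ, rfl⟩; exact hmem ξ)
  let z : K →L[ℂ] K := f.toContinuousLinearMap ∘L P.rangeRestrict
  have hz : ∀ ξ, z ξ = D ⟨P ξ, hmem ξ⟩ := fun ξ => rfl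
  have hPc : IsCompactOperator P := isCompactOperator_of_range_finiteDimensional hfin
  have hzP : z * P = z := by
    ext ξ
    change z (P ξ) = z ξ
    have : P (P ξ) = P ξ := congrArg (fun T : K →L[ℂ] K => T ξ) hid
    simp only [hz, this]
  have hPz : P * star z = star z := by
    have := congrArg star hzP
    rwa [star_mul, hsa.star_eq] at this
  have hadj : ∀ ξ : D.domain, star z (ξ : K) = P (D ξ) := by
    intro ξ
    refine ext_inner_right ℂ fun η => ?_
    rw [ContinuousLinearMap.star_eq_adjoint, ContinuousLinearMap.adjoint_inner_left, hz, ← hD]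
    have := ContinuousLinearMap.adjoint_inner_left P η (D ξ)
    rw [← ContinuousLinearMap.star_eq_adjoint, hsa.star_eq] at this
    exact this.symm
  refine ⟨z - star z, fun ξ => ⟨hmem ξ, ?_⟩, ?_⟩
  · rw [sub_apply, hadj, hz]
    abel
  · refine IsCompactOperator.sub ?_ ?_
    · rw [← hzP]
      exact hPc.clm_comp z
    · rw [← hPz]
      exact hPc.comp_clm (star z)

end FiniteRank

/-! ### The normalized invariant form -/

section NormForm

variable {g : Type*} [LieRing g] [LieAlgebra ℝ g] {hv d : ℕ} {e : Module.Basis (Fin d) ℝ g}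

theorem normForm_smul_left (c : ℝ) (x z : g) : normForm hv (c • x) z = c * normForm hv x z := by
  simp only [normForm, map_smul, LinearMap.smul_apply, smul_eq_mul]
  ring

theorem normForm_comm (x y : g) : normForm hv x y = normForm hv y x := by
  simp only [normForm, killingForm, LieModule.traceForm_comm ℝ g g x y]

theorem normForm_neg_left (x z : g) : normForm hv (-x) z = -normForm hv x z := by
  rw [← neg_one_smul ℝ x, normForm_smul_left, neg_one_mul]

theorem normForm_neg_right (x z : g) : normForm hv x (-z) = -normForm hv x z := by
  rw [normForm_comm, normForm_neg_left, normForm_comm]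

theorem normForm_sum_left {ι : Type*} (s : Finset ι) (f : ι → g) (z : g) :
    normForm hv (∑ i ∈ s, f i) z = ∑ i ∈ s, normForm hv (f i) z := by
  simp only [normForm, map_sum, LinearMap.sum_apply, Finset.mul_sum]

theorem normForm_lie (x y z : g) : normForm hv ⁅x, y⁆ z = normForm hv x ⁅y, z⁆ := by
  simp only [normForm, killingForm, LieModule.traceForm_apply_lie_apply ℝ g g x y z]

theorem normForm_lie_left (x y z : g) : normForm hv ⁅x, y⁆ z = -normForm hv y ⁅x, z⁆ := by
  rw [← lie_skew, normForm_neg_left, normForm_lie]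

variable (he : ∀ a b, normForm hv (e a) (e b) = if a = b then 1 else 0)
include he

theorem repr_eq_normForm (x : g) (a : Fin d) : e.repr x a = normForm hv x (e a) := by
  conv_rhs => rw [← e.sum_repr x, normForm_sum_left]
  simp [normForm_smul_left, he]

theorem sum_normForm_smul (x : g) : ∑ a, normForm hv x (e a) • e a = x := by
  simp only [← repr_eq_normForm he]
  exact e.sum_repr x

/-- The invariant form is the standard form in the coordinates of an orthonormal basis; in
particular it is positive. -/
theorem normForm_eq_sum (x y : g) :
    normForm hv x y = ∑ a, normForm hv x (e a) * normForm hv y (e a) := by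
  conv_lhs => rw [normForm_comm, ← sum_normForm_smul he y, normForm_sum_left]
  refine Finset.sum_congr rfl fun a _ => ?_
  rw [normForm_smul_left, normForm_comm (e a) x, mul_comm]

theorem normForm_ext {x y : g} (h : ∀ z, normForm hv x z = normForm hv y z) : x = y := by
  rw [← sum_normForm_smul he x, ← sum_normForm_smul he y]
  simp only [h]

/-- The element `∑ₐ eₐ ⊗ [eₐ, x]` is antisymmetric. -/
theorem sum_bilin_lie {V : Type*} [AddCommGroup V] [Module ℝ V] (A : g →ₗ[ℝ] g →ₗ[ℝ] V) (x : g) :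
    ∑ a, A ⁅e a, x⁆ (e a) = -∑ a, A (e a) ⁅e a, x⁆ := by
  have h1 : ∀ a, A ⁅e a, x⁆ (e a) = ∑ b, normForm hv ⁅e a, x⁆ (e b) • A (e b) (e a) := fun a => by
    conv_lhs => rw [← sum_normForm_smul he ⁅e a, x⁆]
    simp
  have h2 : ∀ a, A (e a) ⁅e a, x⁆ = ∑ b, normForm hv ⁅e a, x⁆ (e b) • A (e a) (e b) := fun a => by
    conv_lhs => rw [← sum_normForm_smul he ⁅e a, x⁆]
    simp
  simp only [h1, h2]
  rw [Finset.sum_comm, ← Finset.sum_neg_distrib]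
  refine Finset.sum_congr rfl fun a _ => ?_
  rw [← Finset.sum_neg_distrib]
  refine Finset.sum_congr rfl fun b _ => ?_
  rw [← neg_smul]
  congr 1
  rw [normForm_lie, ← lie_skew, normForm_neg_right, normForm_comm]

theorem killingForm_eq_sum (x y : g) :
    killingForm ℝ g x y = -∑ a, normForm hv ⁅x, e a⁆ ⁅y, e a⁆ := by
  rw [killingForm_apply_apply, LinearMap.trace_eq_matrix_trace ℝ e, Matrix.trace,
    ← Finset.sum_neg_distrib]
  refine Finset.sum_congr rfl fun a _ => ?_
  rw [Matrix.diag_apply, LinearMap.toMatrix_apply, repr_eq_normForm he]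
  change normForm hv ⁅x, ⁅y, e a⁆⁆ (e a) = _
  rw [normForm_lie_left, normForm_comm]

/-- The Casimir element acts in the adjoint representation by `-2 h^∨`. -/
theorem casimir_adjoint (hhv : hv ≠ 0) (x : g) :
    ∑ a, ⁅e a, ⁅e a, x⁆⁆ = -((2 * hv : ℝ) • x) := by
  refine normForm_ext he fun z => ?_
  have h1 : killingForm ℝ g x z = -(2 * hv : ℝ) * normForm hv x z := by
    have : (hv : ℝ) ≠ 0 := by exact_mod_cast hhv
    rw [normForm]
    field_simp
  rw [normForm_neg_left, normForm_smul_left, ← neg_mul, ← h1, killingForm_eq_sum he,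
    normForm_sum_left, ← Finset.sum_neg_distrib]
  refine Finset.sum_congr rfl fun a _ => ?_
  rw [normForm_lie_left, ← lie_skew (e a) x, ← lie_skew (e a) z, normForm_neg_left,
    normForm_neg_right, neg_neg]

end NormForm

/-! ### Sums of locally finite families -/

section LocSum

variable {ι X : Type*} [AddCommGroup X] [Module ℂ X]

theorem locSum_apply {T : ι → Module.End ℂ X} (h : ∀ v, (Function.support fun i => T i v).Finite)
    (v : X) : locSum T v = ∑ᶠ i, T i v := by
  rw [locSum, dif_pos h]
  rfl

theorem ip_finsum {X : Type*} [NormedAddCommGroup X] [InnerProductSpace ℂ X] {f : ι → X}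
    (hf : (Function.support f).Finite) (u : X) : ip u (∑ᶠ i, f i) = ∑ᶠ i, ip u (f i) :=
  (innerSL ℂ u).toLinearMap.toAddMonoidHom.map_finsum hf

theorem finsum_ip {X : Type*} [NormedAddCommGroup X] [InnerProductSpace ℂ X] {f : ι → X}
    (hf : (Function.support f).Finite) (u : X) : ip (∑ᶠ i, f i) u = ∑ᶠ i, ip (f i) u :=
  (AddMonoidHom.mk' (fun v : X => ip v u) fun a b => inner_add_left a b u).map_finsum hf

/-- If the adjoint of each member of a locally finite family belongs to a second one, then the sums
are adjoint to each other. -/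
theorem locSum_adjoint {X : Type*} [NormedAddCommGroup X] [InnerProductSpace ℂ X]
    {T S : ι → Module.End ℂ X} (h : ∀ v, (Function.support fun i => T i v).Finite)
    (h' : ∀ v, (Function.support fun i => S i v).Finite) (σ : ι ≃ ι)
    (hσ : ∀ i u v, ip (T i u) v = ip u (S (σ i) v)) (u v : X) :
    ip (locSum T u) v = ip u (locSum S v) := by
  rw [locSum_apply h, locSum_apply h', finsum_ip (h u), ip_finsum (h' v)]
  simp only [hσ]
  exact finsum_comp_equiv σ (f := fun i => ip u (S i v))

end LocSum

/-! ### The Sugawara construction -/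

namespace AffineRep

variable {g : Type u} [LieRing g] [LieAlgebra ℝ g] {hv ℓ : ℕ} (π : AffineRep.{v} g hv ℓ)
  {d : ℕ} {e : Module.Basis (Fin d) ℝ g}

theorem J_J (m n : ℤ) (x y : g) (v : π.V) : π.J m x (π.J n y v) = π.J n y (π.J m x v) +
    (Complex.I • π.J (m + n) ⁅x, y⁆ v +
      if m + n = 0 then ((m * ℓ * normForm hv x y : ℝ) : ℂ) • v else 0) := by
  rw [← π.comm, add_sub_cancel]

/-- Every finite energy vector is annihilated by all modes of sufficiently large index: such vectors
form an invariant subspace that contains the highest weight vector. -/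
theorem exists_J_eq_zero (v : π.V) : ∃ M : ℕ, ∀ m : ℤ, M ≤ m → ∀ x, π.J m x v = 0 := by
  let S : Submodule ℂ π.V :=
    { carrier := {v | ∃ M : ℕ, ∀ m : ℤ, M ≤ m → ∀ x, π.J m x v = 0}
      add_mem' := by
        rintro v w ⟨M, hM⟩ ⟨N, hN⟩
        refine ⟨max M N, fun m hm x => ?_⟩
        rw [map_add, hM m (by omega), hN m (by omega), add_zero]
      zero_mem' := ⟨0, fun m _ x => map_zero _⟩
      smul_mem' := by
        rintro c v ⟨M, hM⟩
        refine ⟨M, fun m hm x => ?_⟩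
        rw [map_smul, hM m hm, smul_zero] }
  have hS : ∀ n x, ∀ v ∈ S, π.J n x v ∈ S := by
    rintro n x v ⟨M, hM⟩
    refine ⟨M + n.natAbs + 1, fun m hm y => ?_⟩
    rw [J_J, hM m (by omega), hM (m + n) (by omega), if_neg (by omega)]
    simp
  have htop : S = ⊤ := by
    refine (π.irreducible S hS).resolve_left fun hbot => ?_
    obtain ⟨ξ₀, -, μ, v, hv⟩ := π.highestWeight
    have : v ∈ S := ⟨1, fun m hm x => hv.pos_mode m (by omega) x⟩
    rw [hbot] at this
    exact hv.ne_zero this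
  have : v ∈ S := by
    rw [htop]
    trivial
  exact this

variable (e) in
/-- The normally ordered square `∑ₐ Jᵃ₋ₘ Jᵃₘ`. -/
noncomputable def quad (m : ℕ) : Module.End ℂ π.V := ∑ a, π.J (-m) (e a) * π.J m (e a)

theorem quad_apply (m : ℕ) (v : π.V) :
    π.quad e m v = ∑ a, π.J (-m) (e a) (π.J m (e a) v) := by
  rw [quad, LinearMap.sum_apply]
  rfl

theorem quad_support_finite (v : π.V) :
    (Function.support fun m : ℤ => π.quad e m.natAbs v).Finite := by
  obtain ⟨M, hM⟩ := π.exists_J_eq_zero v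
  refine (Set.finite_Icc (-(M : ℤ)) M).subset fun m hm => ?_
  by_contra h
  refine hm ?_
  have h1 : (M : ℤ) ≤ (m.natAbs : ℤ) := by
    rw [Set.mem_Icc] at h
    omega
  simp only [quad_apply, hM _ h1, map_zero, Finset.sum_const_zero]

theorem L0_eq : π.L0 e = (1 / (2 * ((ℓ : ℂ) + hv))) • locSum fun m : ℤ => π.quad e m.natAbs := by
  simp only [L0, quad, Int.abs_eq_natAbs]

theorem quad_symm (m : ℕ) (u v : π.V) : ip (π.quad e m u) v = ip u (π.quad e m v) := by
  simp only [quad_apply, ip, sum_inner, inner_sum]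
  refine Finset.sum_congr rfl fun a _ => ?_
  have h1 := π.adj (-m) (e a) (π.J m (e a) u) v
  have h2 := π.adj m (e a) u (π.J m (e a) v)
  rw [neg_neg] at h1
  exact h1.trans h2

theorem L0_symm (u v : π.V) : ip (π.L0 e u) v = ip u (π.L0 e v) := by
  have h := locSum_adjoint (π.quad_support_finite (e := e)) π.quad_support_finite (Equiv.refl ℤ)
    (fun i u v => π.quad_symm i.natAbs u v) u v
  rw [L0_eq]
  simp only [ip, LinearMap.smul_apply] at h ⊢
  rw [inner_smul_left, inner_smul_right, h]
  congr 1
  rw [show (1 / (2 * ((ℓ : ℂ) + hv))) = ((1 / (2 * ((ℓ : ℝ) + hv)) : ℝ) : ℂ) by push_cast; rfl]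
  exact Complex.conj_ofReal _

theorem finsum_natAbs {V : Type*} [AddCommGroup V] {f : ℕ → V} {N : ℕ} (hf : ∀ m, N < m → f m = 0) :
    ∑ᶠ m : ℤ, f m.natAbs = f 0 + 2 • ∑ m ∈ Finset.range N, f (m + 1) := by
  have h1 : ∑ᶠ m : ℤ, f m.natAbs = ∑ m ∈ Finset.Icc (-(N : ℤ)) N, f m.natAbs := by
    refine finsum_eq_sum_of_support_subset _ fun m hm => ?_
    by_contra h
    refine hm (hf _ ?_)
    simp only [Finset.coe_Icc, Set.mem_Icc] at h
    omega
  have h2 : ∀ N : ℕ, ∑ m ∈ Finset.Icc (-(N : ℤ)) N, f m.natAbs =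
      f 0 + 2 • ∑ m ∈ Finset.range N, f (m + 1) := by
    intro N
    induction N with
    | zero => simp
    | succ N ih =>
      have h3 : Finset.Icc (-((N + 1 : ℕ) : ℤ)) (N + 1 : ℕ) =
          insert ((N : ℤ) + 1) (insert (-((N : ℤ) + 1)) (Finset.Icc (-(N : ℤ)) N)) := by
        ext m
        simp only [Finset.mem_Icc, Finset.mem_insert]
        omega
      rw [h3, Finset.sum_insert (by simp only [Finset.mem_Icc, Finset.mem_insert]; omega),
        Finset.sum_insert (by simp only [Finset.mem_Icc]; omega), ih, Finset.sum_range_succ,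
        show ((N : ℤ) + 1).natAbs = N + 1 by omega, show (-((N : ℤ) + 1)).natAbs = N + 1 by omega,
        smul_add, two_smul ℕ (f (N + 1))]
      abel
  rw [h1, h2]

theorem L0_apply_eq (hhv : hv ≠ 0) (v : π.V) {N : ℕ}
    (hN : ∀ m : ℤ, N < m → ∀ x, π.J m x v = 0) : (2 * ((ℓ : ℂ) + hv)) • π.L0 e v =
      π.quad e 0 v + 2 • ∑ m ∈ Finset.range N, π.quad e (m + 1) v := by
  have hk : (2 * ((ℓ : ℂ) + hv)) ≠ 0 := by
    have h : (2 * (ℓ + hv) : ℕ) ≠ 0 := by omega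
    exact_mod_cast h
  rw [L0_eq, LinearMap.smul_apply, locSum_apply π.quad_support_finite, smul_smul,
    mul_one_div_cancel hk, one_smul]
  rw [finsum_natAbs (f := fun m => π.quad e m v) (N := N) fun m hm => ?_]
  rw [quad_apply]
  refine Finset.sum_eq_zero fun a _ => ?_
  rw [hN m (by exact_mod_cast hm), map_zero]

/-- The sum `∑ₐ Jᵃ₋ₘ J([eₐ, x])ₘ₊ₙ`. -/
noncomputable def quadLie (e : Module.Basis (Fin d) ℝ g) (n : ℤ) (x : g) (v : π.V) (m : ℤ) : π.V :=
  ∑ a, π.J (-m) (e a) (π.J (m + n) ⁅e a, x⁆ v)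

section

variable (he : ∀ a b, normForm hv (e a) (e b) = if a = b then 1 else 0)
include he

/-- Invariance of the Casimir element, for currents of arbitrary modes. -/
theorem sum_J_J_lie (p q : ℤ) (x : g) (v : π.V) :
    ∑ a, π.J p ⁅e a, x⁆ (π.J q (e a) v) = -∑ a, π.J p (e a) (π.J q ⁅e a, x⁆ v) := by
  let A : g →ₗ[ℝ] g →ₗ[ℝ] π.V := LinearMap.mk₂ ℝ (fun y z => π.J p y (π.J q z v))
    (by simp) (by intros; simp) (by simp) (by
      intro c y z
      rw [map_smul, LinearMap.smul_apply, ← Complex.coe_smul c (π.J q z v), map_smul,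
        Complex.coe_smul])
  exact sum_bilin_lie he A x

/-- The commutator of `∑ₐ Jᵃ₋ₘ Jᵃₘ` with a current mode `Jₙ`. After summation over `m` the terms
`quadLie` telescope, and what remains of them is evaluated by `quadLie_add_quadLie`. -/
theorem quad_J (m n : ℕ) (x : g) (v : π.V) : π.quad e m (π.J n x v) = π.J n x (π.quad e m v) +
    (Complex.I • (π.quadLie e n x v m - π.quadLie e n x v (m - n)) -
      if m = n then ((m * ℓ : ℝ) : ℂ) • π.J n x v else 0) := by
  have h1 : ∀ a, π.J (-m) (e a) (π.J m (e a) (π.J n x v)) =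
      π.J n x (π.J (-m) (e a) (π.J m (e a) v)) +
      (Complex.I • π.J (-m) (e a) (π.J (m + n) ⁅e a, x⁆ v) +
      Complex.I • π.J (n - m) ⁅e a, x⁆ (π.J m (e a) v)
      - if m = n then ((m * ℓ * normForm hv x (e a) : ℝ) : ℂ) • π.J m (e a) v else 0) := by
    intro a
    have h3 : (if (m : ℤ) + n = 0 then (((m : ℤ) * ℓ * normForm hv (e a) x : ℝ) : ℂ) • v else 0)
        = 0 := by
      split_ifs with h
      · have : m = 0 := by omega
        simp [this]
      · rfl
    have h4 : (-m : ℤ) + n = n - m := by ring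
    rw [J_J π m n, h3, add_zero, map_add, map_smul, J_J π (-m) n, h4, normForm_comm (e a) x]
    have h5 : ((n : ℤ) - m = 0) ↔ m = n := by omega
    simp only [h5]
    split_ifs with h
    · push_cast
      simp only [neg_mul, neg_smul]
      abel
    · abel
  rw [quad_apply, quad_apply, map_sum, quadLie, quadLie]
  simp only [h1]
  rw [Finset.sum_add_distrib, Finset.sum_sub_distrib, Finset.sum_add_distrib, ← Finset.smul_sum,
    ← Finset.smul_sum, π.sum_J_J_lie he]
  have h6 : -((m : ℤ) - n) = n - m := by ring
  have h7 : (m : ℤ) - n + n = m := by ring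
  simp only [h6, h7]
  rw [sub_eq_add_neg (∑ a, _ : π.V), smul_add]
  congr 2
  split_ifs with h
  · subst h
    conv_rhs => rw [← sum_normForm_smul he x]
    rw [map_sum, LinearMap.sum_apply, Finset.smul_sum]
    refine Finset.sum_congr rfl fun a _ => ?_
    rw [map_smul, LinearMap.smul_apply, ← Complex.coe_smul, smul_smul, ← Complex.ofReal_mul]
  · exact Finset.sum_const_zero

/-- Reordering one of the two sums produces the Casimir operator of the adjoint representation, the
source of the shift `h^∨` in the Sugawara formula. -/
theorem quadLie_add_quadLie (hhv : hv ≠ 0) {n : ℕ} (hn : 0 < n) (x : g) (v : π.V) (j : ℤ) :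
    π.quadLie e n x v (-j) + π.quadLie e n x v (-(n - j)) =
      (-(2 * hv) * Complex.I : ℂ) • π.J n x v := by
  rw [quadLie, quadLie]
  have h1 : (-j + n : ℤ) = n - j := by ring
  have h2 : (-(n - j) + n : ℤ) = j := by ring
  simp only [h1, h2, neg_neg]
  rw [← neg_neg (∑ a, π.J (n - j) (e a) (π.J j ⁅e a, x⁆ v)), ← π.sum_J_J_lie he,
    ← Finset.sum_neg_distrib, ← Finset.sum_add_distrib]
  have h3 : ∀ a, π.J j (e a) (π.J (n - j) ⁅e a, x⁆ v) + -π.J (n - j) ⁅e a, x⁆ (π.J j (e a) v) =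
      Complex.I • π.J n ⁅e a, ⁅e a, x⁆⁆ v := by
    intro a
    rw [J_J π j, show j + (n - j) = (n : ℤ) by ring, if_neg (by omega)]
    abel
  simp only [h3]
  rw [← Finset.smul_sum, ← LinearMap.sum_apply, ← map_sum, casimir_adjoint he hhv, map_neg,
    map_smul, LinearMap.neg_apply, LinearMap.smul_apply, ← Complex.coe_smul, ← neg_smul,
    smul_smul]
  congr 1
  push_cast
  ring

end

/-- A telescoping sum. -/
theorem sum_sub_shift {V : Type*} [AddCommGroup V] (f : ℤ → V) (N n : ℕ)
    (hf : ∀ j : ℕ, j < n → f (N - j) = 0) :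
    ∑ m ∈ Finset.range N, (f (m + 1) - f (m + 1 - n)) = -∑ j ∈ Finset.range n, f (-j) := by
  induction n with
  | zero => simp
  | succ n ih =>
    have h1 := ih fun j hj => hf j (by omega)
    have h2 : ∑ m ∈ Finset.range N, (f (m + 1 - n) - f (m + 1 - (n + 1 : ℕ))) = -f (-n) := by
      have := Finset.sum_range_sub (fun m : ℕ => f (m - n)) N
      rw [hf n (by omega)] at this
      rw [← zero_sub, ← zero_sub (n : ℤ), ← Nat.cast_zero (R := ℤ), ← this]
      refine Finset.sum_congr rfl fun m _ => ?_
      push_cast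
      rw [add_sub_add_right_eq_sub]
    rw [Finset.sum_range_succ, neg_add, ← h1, ← h2, ← Finset.sum_add_distrib]
    refine Finset.sum_congr rfl fun m _ => ?_
    abel

/-- The commutation relation `[L₀, Jₙ] = -n Jₙ` for `n ≥ 0`. -/
theorem L0_J_nat (he : ∀ a b, normForm hv (e a) (e b) = if a = b then 1 else 0) (hhv : hv ≠ 0)
    (n : ℕ) (x : g) (v : π.V) :
    π.L0 e (π.J n x v) = π.J n x (π.L0 e v) - (n : ℂ) • π.J n x v := by
  obtain ⟨M, hM⟩ := π.exists_J_eq_zero v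
  obtain ⟨M', hM'⟩ := π.exists_J_eq_zero (π.J n x v)
  set N := M + M' + n with hN
  have hk : (2 * ((ℓ : ℂ) + hv)) ≠ 0 := by
    have h : (2 * (ℓ + hv) : ℕ) ≠ 0 := by omega
    exact_mod_cast h
  have h1 := π.L0_apply_eq hhv (e := e) v (N := N) fun m hm y => hM m (by omega) y
  have h2 := π.L0_apply_eq hhv (e := e) (π.J n x v) (N := N) fun m hm y => hM' m (by omega) y
  set f := π.quadLie e n x v with hf
  have hsum : ∑ m ∈ Finset.range N, π.quad e (m + 1) (π.J n x v) =
      π.J n x (∑ m ∈ Finset.range N, π.quad e (m + 1) v) +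
      (Complex.I • (-∑ j ∈ Finset.range n, f (-j)) - ((n * ℓ : ℝ) : ℂ) • π.J n x v) := by
    rw [← sum_sub_shift f N n (fun j hj => ?_), map_sum, Finset.smul_sum]
    · have h3 : ((n * ℓ : ℝ) : ℂ) • π.J n x v = ∑ m ∈ Finset.range N,
          if m + 1 = n then (((m + 1 : ℕ) * ℓ : ℝ) : ℂ) • π.J n x v else 0 := by
        rcases Nat.eq_zero_or_pos n with rfl | hn
        · simp
        · rw [Finset.sum_eq_single (n - 1)]
          · rw [if_pos (by omega), Nat.sub_add_cancel hn]
          · intro m _ hm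
            rw [if_neg (by omega)]
          · intro hm
            exact absurd (Finset.mem_range.2 (by omega)) hm
      rw [h3, ← Finset.sum_sub_distrib, ← Finset.sum_add_distrib]
      refine Finset.sum_congr rfl fun m _ => ?_
      rw [π.quad_J he]
      push_cast
      rfl
    · rw [hf, quadLie]
      refine Finset.sum_eq_zero fun a _ => ?_
      rw [hM _ (by omega), map_zero]
  have hzero : π.quad e 0 (π.J n x v) = π.J n x (π.quad e 0 v) + Complex.I • (f 0 - f (-n)) := by
    rw [π.quad_J he]
    congr 1
    rw [Nat.cast_zero, zero_sub]
    split_ifs <;> simp [hf]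
  -- the terms `f (-j)` pair up with the terms `f (-(n - j))` to Casimir operators
  have hpair : f 0 - f (-n) - 2 • ∑ j ∈ Finset.range n, f (-j) =
      (n : ℂ) • (2 * hv * Complex.I : ℂ) • π.J n x v := by
    rcases Nat.eq_zero_or_pos n with rfl | hn
    · simp
    have h3 : ∑ j ∈ Finset.range n, (f (-j) + f (-(n - j))) =
        (n : ℂ) • (-(2 * hv) * Complex.I : ℂ) • π.J n x v := by
      rw [hf, Finset.sum_congr rfl fun (j : ℕ) _ => π.quadLie_add_quadLie he hhv hn x v j,
        Finset.sum_const, Finset.card_range, ← Nat.cast_smul_eq_nsmul ℂ]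
    have h4 : ∑ j ∈ Finset.range n, f (-(n - j)) = ∑ j ∈ Finset.range n, f (-j) - f 0 + f (-n) := by
      have h5 : ∑ j ∈ Finset.range n, f (-(n - j)) = ∑ j ∈ Finset.range n, f (-(j + 1)) := by
        rw [← Finset.sum_range_reflect]
        refine Finset.sum_congr rfl fun j hj => ?_
        rw [Finset.mem_range] at hj
        congr 1
        omega
      have h6 := Finset.sum_range_succ (fun j : ℕ => f (-j)) n
      rw [Finset.sum_range_succ' (fun j : ℕ => f (-j)) n] at h6
      push_cast at h6
      rw [neg_zero] at h6
      rw [h5, eq_sub_of_add_eq h6]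
      abel
    rw [Finset.sum_add_distrib, h4] at h3
    rw [← neg_inj]
    rw [neg_mul, neg_smul, smul_neg] at h3
    rw [← h3, two_smul]
    abel
  have htot : (2 * ((ℓ : ℂ) + hv)) • π.L0 e (π.J n x v) = (2 * ((ℓ : ℂ) + hv)) •
      (π.J n x (π.L0 e v) - (n : ℂ) • π.J n x v) := by
    rw [smul_sub, ← map_smul (π.J n x), h1, h2, hsum, hzero, map_add, map_nsmul]
    have h7 : (π.J n x (π.quad e 0 v) + Complex.I • (f 0 - f (-n)) + 2 •
        (π.J n x (∑ m ∈ Finset.range N, π.quad e (m + 1) v) +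
        (Complex.I • (-∑ j ∈ Finset.range n, f (-j)) - ((n * ℓ : ℝ) : ℂ) • π.J n x v))) =
        π.J n x (π.quad e 0 v) + 2 • π.J n x (∑ m ∈ Finset.range N, π.quad e (m + 1) v) +
        (Complex.I • (f 0 - f (-n) - 2 • ∑ j ∈ Finset.range n, f (-j)) -
          (2 * ((n * ℓ : ℝ) : ℂ)) • π.J n x v) := by
      module
    rw [h7, hpair]
    have h8 : Complex.I * n * (2 * hv * Complex.I) = -(n * (2 * hv) : ℂ) := by
      linear_combination (n * (2 * hv) : ℂ) * Complex.I_mul_I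
    rw [smul_smul, smul_smul, smul_smul, h8, ← sub_smul, sub_eq_add_neg _ (_ • _), ← neg_smul]
    congr 2
    push_cast
    ring
  exact smul_right_injective _ hk htot

theorem L0_J (he : ∀ a b, normForm hv (e a) (e b) = if a = b then 1 else 0) (hhv : hv ≠ 0)
    (n : ℤ) (x : g) (v : π.V) :
    π.L0 e (π.J n x v) = π.J n x (π.L0 e v) - (n : ℂ) • π.J n x v := by
  rcases Int.eq_nat_or_neg n with ⟨m, rfl | rfl⟩
  · simpa using π.L0_J_nat he hhv m x v
  · -- the adjoint of the relation for the opposite mode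
    refine ext_inner_right ℂ fun u => ?_
    have h1 := congrArg (fun w => ip v w) (π.L0_J_nat he hhv m x u)
    simp only [ip, inner_sub_right, inner_smul_right] at h1
    rw [inner_sub_left, inner_smul_left]
    have a1 := π.adj (-m) x v (π.L0 e u)
    have a2 := π.adj (-m) x (π.L0 e v) u
    have a3 := π.adj (-m) x v u
    have b1 := π.L0_symm (e := e) (π.J (-m) x v) u
    have b2 := π.L0_symm (e := e) v (π.J m x u)
    simp only [ip, neg_neg] at a1 a2 a3 b1 b2
    rw [b1, a1, a2, a3, b2, h1]
    simp

end AffineRep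

/-! ### Root vectors of a compact Lie algebra -/

/-- A spanning family of vectors `x j` which, with vectors `y j`, span the real planes on which
`ad ξ₀` is the rotation generator with the frequency `r j`. Thus `x j ± i y j` are root vectors or,
for `r j = 0`, elements of the centralizer of `ξ₀`. -/
structure RootFrame {g : Type*} [LieRing g] [LieAlgebra ℝ g] (ξ₀ : g) (d : ℕ) where
  /-- the first vectors of the planes -/
  x : Fin d → g
  /-- the second vectors of the planes -/
  y : Fin d → g
  /-- the frequencies -/
  r : Fin d → ℝ
  r_nonneg : ∀ j, 0 ≤ r j
  lie_x : ∀ j, ⁅ξ₀, x j⁆ = r j • y j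
  lie_y : ∀ j, ⁅ξ₀, y j⁆ = -(r j • x j)
  span_x : Submodule.span ℝ (Set.range x) = ⊤

section RootFrame

variable {g : Type*} [LieRing g] [LieAlgebra ℝ g] {hv d : ℕ} {e : Module.Basis (Fin d) ℝ g}

/-- The operator `-(ad ξ₀)²` is symmetric and positive for the invariant form. Its eigenvectors
serve as the vectors `x j`, the square roots of its eigenvalues as the frequencies. -/
theorem exists_rootFrame (he : ∀ a b, normForm hv (e a) (e b) = if a = b then 1 else 0) (ξ₀ : g) :
    Nonempty (RootFrame ξ₀ d) := by
  let ψ : EuclideanSpace ℝ (Fin d) ≃ₗ[ℝ] g :=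
    (WithLp.linearEquiv 2 ℝ (Fin d → ℝ)).trans e.equivFun.symm
  have hψ : ∀ v w, inner ℝ v w = normForm hv (ψ v) (ψ w) := by
    intro v w
    have h1 : ∀ (v : EuclideanSpace ℝ (Fin d)) a, normForm hv (ψ v) (e a) = v a := fun v a => by
      rw [← repr_eq_normForm he]
      exact congrFun (e.equivFun.apply_symm_apply (WithLp.ofLp v)) a
    rw [normForm_eq_sum he, PiLp.inner_apply]
    refine Finset.sum_congr rfl fun a _ => ?_
    rw [h1, h1]
    simp [mul_comm]
  let A : EuclideanSpace ℝ (Fin d) →ₗ[ℝ] EuclideanSpace ℝ (Fin d) :=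
    -(ψ.symm.toLinearMap ∘ₗ (LieAlgebra.ad ℝ g ξ₀ ∘ₗ LieAlgebra.ad ℝ g ξ₀) ∘ₗ ψ.toLinearMap)
  have hA : ∀ v, ψ (A v) = -⁅ξ₀, ⁅ξ₀, ψ v⁆⁆ := fun v => by simp [A]
  have hsq : ∀ v w, inner ℝ (A v) w = normForm hv ⁅ξ₀, ψ v⁆ ⁅ξ₀, ψ w⁆ := fun v w => by
    rw [hψ, hA, normForm_neg_left, normForm_lie_left, neg_neg]
  have hsymm : A.IsSymmetric := fun v w => by
    rw [hsq, real_inner_comm, hsq, normForm_comm]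
  have hn : Module.finrank ℝ (EuclideanSpace ℝ (Fin d)) = d := by simp
  let B := hsymm.eigenvectorBasis hn
  let lam := hsymm.eigenvalues hn
  have hB : ∀ j, A (B j) = lam j • B j := fun j => hsymm.apply_eigenvectorBasis hn j
  have hnorm : ∀ j, normForm hv ⁅ξ₀, ψ (B j)⁆ ⁅ξ₀, ψ (B j)⁆ = lam j := fun j => by
    rw [← hsq, hB, inner_smul_left, real_inner_self_eq_norm_sq, B.orthonormal.1 j]
    simp
  have hpos : ∀ z : g, 0 ≤ normForm hv z z := fun z => by
    rw [normForm_eq_sum he]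
    exact Finset.sum_nonneg fun a _ => mul_self_nonneg _
  have hlam : ∀ j, 0 ≤ lam j := fun j => hnorm j ▸ hpos _
  have hlie : ∀ j, √(lam j) = 0 → ⁅ξ₀, ψ (B j)⁆ = 0 := fun j hj => by
    rw [Real.sqrt_eq_zero (hlam j), ← hnorm, ← LinearEquiv.apply_symm_apply ψ ⁅ξ₀, ψ (B j)⁆, ← hψ,
      inner_self_eq_zero] at hj
    rw [← LinearEquiv.apply_symm_apply ψ ⁅ξ₀, ψ (B j)⁆, hj, map_zero]
  refine ⟨⟨fun j => ψ (B j), fun j => (√(lam j))⁻¹ • ⁅ξ₀, ψ (B j)⁆, fun j => √(lam j),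
    fun j => Real.sqrt_nonneg _, fun j => ?_, fun j => ?_, ?_⟩⟩
  · rcases eq_or_ne √(lam j) 0 with h | h
    · simp only [hlie j h, smul_zero]
    · rw [smul_inv_smul₀ h]
  · have h1 : ⁅ξ₀, ⁅ξ₀, ψ (B j)⁆⁆ = -(lam j • ψ (B j)) := by
      rw [← map_smul, ← hB, hA, neg_neg]
    rcases eq_or_ne √(lam j) 0 with h | h
    · simp only [hlie j h, smul_zero, lie_zero, h, zero_smul, neg_zero]
    · rw [lie_smul, h1, smul_neg, smul_smul]
      congr 2
      rw [inv_mul_eq_iff_eq_mul₀ h, Real.mul_self_sqrt (hlam j)]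
  · rw [Set.range_comp' ψ B, ← LinearEquiv.coe_coe, Submodule.span_image, ← B.coe_toBasis,
      B.toBasis.span_eq, Submodule.map_top, LinearEquiv.range]

end RootFrame

/-! ### Words of lowering operators on a highest weight vector -/

namespace AffineRep

variable {g : Type u} [LieRing g] [LieAlgebra ℝ g] {hv ℓ : ℕ} (π : AffineRep.{v} g hv ℓ)
  {d : ℕ} {e : Module.Basis (Fin d) ℝ g}

theorem J_real_smul (n : ℤ) (c : ℝ) (x : g) (v : π.V) : π.J n (c • x) v = (c : ℂ) • π.J n x v := by
  rw [map_smul, LinearMap.smul_apply, ← Complex.coe_smul]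

/-- In the Sugawara formula all terms are positive, so the zero mode terms are bounded by the
energy. -/
theorem sum_norm_sq_J_zero_le (hhv : hv ≠ 0) (v : π.V) :
    ∑ a, ‖π.J 0 (e a) v‖ ^ 2 ≤ 2 * ((ℓ : ℝ) + hv) * (ip v (π.L0 e v)).re := by
  obtain ⟨M, hM⟩ := π.exists_J_eq_zero v
  have h1 := congrArg (fun w => (ip v w).re)
    (π.L0_apply_eq hhv (e := e) v (N := M) fun m hm y => hM m (by omega) y)
  have h2 : ∀ m : ℕ, ip v (π.quad e m v) = ((∑ a, ‖π.J m (e a) v‖ ^ 2 : ℝ) : ℂ) := by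
    intro m
    rw [quad_apply, ip, inner_sum]
    push_cast
    refine Finset.sum_congr rfl fun a _ => ?_
    have := π.adj m (e a) v (π.J m (e a) v)
    rw [ip, ip] at this
    rw [← this, inner_self_eq_norm_sq_to_K]
    rfl
  have h3 : ip v (π.quad e 0 v + 2 • ∑ m ∈ Finset.range M, π.quad e (m + 1) v) =
      ((∑ a, ‖π.J 0 (e a) v‖ ^ 2 + 2 * ∑ m ∈ Finset.range M, ∑ a,
        ‖π.J (m + 1 : ℕ) (e a) v‖ ^ 2 : ℝ) : ℂ) := by
    rw [two_smul, ip, inner_add_right, inner_add_right, inner_sum]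
    have h4 := h2 0
    rw [ip] at h4
    rw [h4]
    have h5 : ∀ m ∈ Finset.range M, inner ℂ v (π.quad e (m + 1) v) =
        ((∑ a, ‖π.J (m + 1 : ℕ) (e a) v‖ ^ 2 : ℝ) : ℂ) := fun m _ => h2 (m + 1)
    rw [Finset.sum_congr rfl h5]
    push_cast
    ring
  rw [h3, Complex.ofReal_re, ip, inner_smul_right] at h1
  rw [show (2 * ((ℓ : ℂ) + hv)) = ((2 * ((ℓ : ℝ) + hv) : ℝ) : ℂ) by push_cast; rfl,
    Complex.re_ofReal_mul] at h1
  rw [h1]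
  have : 0 ≤ ∑ m ∈ Finset.range M, ∑ a, ‖π.J (m + 1 : ℕ) (e a) v‖ ^ 2 := by positivity
  linarith

/-- On vectors of bounded energy the zero modes are bounded. -/
theorem norm_sq_J_zero_le (he : ∀ a b, normForm hv (e a) (e b) = if a = b then 1 else 0)
    (hhv : hv ≠ 0) (x : g) (v : π.V) : ‖π.J 0 x v‖ ^ 2 ≤
      normForm hv x x * (2 * ((ℓ : ℝ) + hv) * (ip v (π.L0 e v)).re) := by
  have h1 : ‖π.J 0 x v‖ ≤ ∑ a, |normForm hv x (e a)| * ‖π.J 0 (e a) v‖ := by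
    conv_lhs => rw [← sum_normForm_smul he x]
    rw [map_sum, LinearMap.sum_apply]
    refine (norm_sum_le _ _).trans (Finset.sum_le_sum fun a _ => ?_)
    rw [J_real_smul, norm_smul, Complex.norm_real, Real.norm_eq_abs]
  have h2 := Finset.sum_mul_sq_le_sq_mul_sq Finset.univ (fun a => |normForm hv x (e a)|)
    (fun a => ‖π.J 0 (e a) v‖)
  have h3 : ∑ a, |normForm hv x (e a)| ^ 2 = normForm hv x x := by
    rw [normForm_eq_sum he]
    refine Finset.sum_congr rfl fun a _ => ?_
    rw [sq_abs, sq]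
  calc ‖π.J 0 x v‖ ^ 2 ≤ (∑ a, |normForm hv x (e a)| * ‖π.J 0 (e a) v‖) ^ 2 := by gcongr
    _ ≤ normForm hv x x * ∑ a, ‖π.J 0 (e a) v‖ ^ 2 := h3 ▸ h2
    _ ≤ _ := by
      refine mul_le_mul_of_nonneg_left (π.sum_norm_sq_J_zero_le hhv v) ?_
      rw [← h3]
      positivity

variable {ξ₀ : g} (f : RootFrame ξ₀ d)

/-- The labels `(n, j, ±)` of the operators `Jₙ (x j ± i y j)`. -/
abbrev Letter (d : ℕ) : Type := ℤ × Fin d × Bool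

/-- The sign of a letter. -/
def Letter.sign (a : Letter d) : ℝ := if a.2.2 then 1 else -1

theorem Letter.sign_mul_self (a : Letter d) : a.sign * a.sign = 1 := by
  unfold Letter.sign
  split_ifs <;> norm_num

/-- The label of the adjoint operator. -/
def Letter.dual (a : Letter d) : Letter d := (-a.1, a.2.1, !a.2.2)

theorem Letter.sign_dual (a : Letter d) : a.dual.sign = -a.sign := by
  unfold Letter.sign Letter.dual
  rcases a.2.2 with _ | _ <;> simp

theorem Letter.dual_dual (a : Letter d) : a.dual.dual = a := by
  simp [Letter.dual]

/-- The operator `Jₙ (x j ± i y j)`. -/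
noncomputable def op (a : Letter d) : Module.End ℂ π.V :=
  π.J a.1 (f.x a.2.1) + ((a.sign : ℂ) * Complex.I) • π.J a.1 (f.y a.2.1)

/-- A lowering operator has negative mode, or mode zero and a negative root. -/
def IsLowering (a : Letter d) : Prop := a.1 < 0 ∨ a.1 = 0 ∧ a.sign * f.r a.2.1 < 0

theorem op_apply (a : Letter d) (v : π.V) : π.op f a v =
    π.J a.1 (f.x a.2.1) v + ((a.sign : ℂ) * Complex.I) • π.J a.1 (f.y a.2.1) v := rfl

theorem op_adj (a : Letter d) (u v : π.V) : ip (π.op f a u) v = ip u (π.op f a.dual v) := by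
  have h1 := π.adj a.1 (f.x a.2.1) u v
  have h2 := π.adj a.1 (f.y a.2.1) u v
  rw [op_apply, op_apply, Letter.sign_dual]
  simp only [ip] at h1 h2 ⊢
  rw [inner_add_left, inner_add_right, inner_smul_left, inner_smul_right]
  simp only [Letter.dual, h1, h2, map_mul, Complex.conj_ofReal, Complex.conj_I]
  push_cast
  ring

theorem L0_op (he : ∀ a b, normForm hv (e a) (e b) = if a = b then 1 else 0) (hhv : hv ≠ 0)
    (a : Letter d) (v : π.V) :
    π.L0 e (π.op f a v) = π.op f a (π.L0 e v) - (a.1 : ℂ) • π.op f a v := by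
  simp only [op_apply, map_add, map_smul, π.L0_J he hhv]
  module

theorem J_zero_op (a : Letter d) (v : π.V) : π.J 0 ξ₀ (π.op f a v) =
    π.op f a (π.J 0 ξ₀ v) + ((a.sign * f.r a.2.1 : ℝ) : ℂ) • π.op f a v := by
  have h1 : ∀ z, π.J 0 ξ₀ (π.J a.1 z v) =
      π.J a.1 z (π.J 0 ξ₀ v) + Complex.I • π.J a.1 ⁅ξ₀, z⁆ v := by
    intro z
    rw [J_J, zero_add]
    simp
  have h2 := a.sign_mul_self
  have hx := h1 (f.x a.2.1)
  have hy := h1 (f.y a.2.1)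
  rw [f.lie_x, J_real_smul] at hx
  rw [f.lie_y, map_neg, LinearMap.neg_apply, J_real_smul] at hy
  simp only [op_apply, map_add, map_smul (π.J 0 ξ₀), hx, hy]
  have h3 : ((a.sign : ℂ) * Complex.I) • Complex.I • -((f.r a.2.1 : ℂ) • π.J a.1 (f.x a.2.1) v) =
      ((a.sign * f.r a.2.1 : ℝ) : ℂ) • π.J a.1 (f.x a.2.1) v := by
    rw [smul_neg, smul_neg, smul_smul, smul_smul, ← neg_smul]
    congr 1
    push_cast
    linear_combination (-(a.sign : ℂ) * f.r a.2.1) * Complex.I_mul_I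
  have h4 : ((a.sign * f.r a.2.1 : ℝ) : ℂ) • ((a.sign : ℂ) * Complex.I) • π.J a.1 (f.y a.2.1) v =
      Complex.I • (f.r a.2.1 : ℂ) • π.J a.1 (f.y a.2.1) v := by
    rw [smul_smul, smul_smul]
    congr 1
    have h5 : (a.sign : ℂ) * a.sign = 1 := by exact_mod_cast h2
    push_cast
    linear_combination (f.r a.2.1 * Complex.I) * h5
  rw [smul_add, smul_add, h3, h4]
  abel

theorem J_mem_of_op_mem {S : Submodule ℂ π.V} {v : π.V} (h : ∀ a, π.op f a v ∈ S) (n : ℤ) (z : g) :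
    π.J n z v ∈ S := by
  have hz : z ∈ Submodule.span ℝ (Set.range f.x) := by
    rw [f.span_x]
    trivial
  induction hz using Submodule.span_induction with
  | mem z hz =>
    obtain ⟨j, rfl⟩ := hz
    have h1 : π.J n (f.x j) v = (1 / 2 : ℂ) • (π.op f (n, j, true) v + π.op f (n, j, false) v) := by
      simp only [op_apply, Letter.sign]
      simp only [if_true, Bool.false_eq_true, if_false]
      push_cast
      module
    rw [h1]
    exact S.smul_mem _ (S.add_mem (h _) (h _))
  | zero => simp
  | add x y _ _ hx hy =>
    rw [map_add]
    exact S.add_mem hx hy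
  | smul c x _ hx =>
    rw [J_real_smul]
    exact S.smul_mem _ hx

variable {μ : g → ℂ} {v₀ : π.V} (hw : IsHighestWeightVector π.J ξ₀ μ v₀)

/-- The adjoints of the lowering operators annihilate the highest weight vector. -/
theorem op_dual_highestWeight {ξ₀ : g} {f : RootFrame ξ₀ d} {μ : g → ℂ} {v₀ : π.V}
    (hw : IsHighestWeightVector π.J ξ₀ μ v₀) {a : Letter d} (ha : IsLowering f a) :
    π.op f a.dual v₀ = 0 := by
  rw [op_apply, Letter.sign_dual]
  rcases ha with h | ⟨h0, h⟩
  · rw [hw.pos_mode _ (by simp only [Letter.dual]; omega), hw.pos_mode _ (by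
      simp only [Letter.dual]; omega), smul_zero, add_zero]
  · have hr : 0 < f.r a.2.1 := by
      refine lt_of_le_of_ne (f.r_nonneg _) fun h1 => ?_
      rw [← h1, mul_zero] at h
      exact lt_irrefl _ h
    have hs : a.sign = -1 := by
      unfold Letter.sign at h ⊢
      split_ifs at h ⊢ with h1
      · linarith
      · rfl
    have := hw.pos_root (f.r a.2.1) (f.x a.2.1) (f.y a.2.1) hr (f.lie_x _) (f.lie_y _)
    simpa [Letter.dual, h0, hs] using this

/-- The vector obtained by applying a list of lowering operators to `v`. -/
noncomputable def word (v : π.V) (l : List {a // IsLowering f a}) : π.V :=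
  l.foldr (fun a w => π.op f a w) v

theorem word_nil (v : π.V) : π.word f v [] = v := rfl

theorem word_cons (v : π.V) (a : {a // IsLowering f a}) (l : List {a // IsLowering f a}) :
    π.word f v (a :: l) = π.op f a (π.word f v l) := rfl

/-- If all current modes map `v` into `S`, so do the commutators of the letters, since they are
combinations of current modes and scalars. -/
theorem op_op_sub_mem {S : Submodule ℂ π.V} {v : π.V} (h : ∀ n z, π.J n z v ∈ S) (hvS : v ∈ S)
    (a b : Letter d) : π.op f a (π.op f b v) - π.op f b (π.op f a v) ∈ S := by
  have h1 : ∀ m n x y, π.J m x (π.J n y v) - π.J n y (π.J m x v) ∈ S := by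
    intro m n x y
    rw [π.comm]
    refine S.add_mem (S.smul_mem _ (h _ _)) ?_
    split_ifs
    · exact S.smul_mem _ hvS
    · exact S.zero_mem
  have h2 : π.op f a (π.op f b v) - π.op f b (π.op f a v) =
      (π.J a.1 (f.x a.2.1) (π.J b.1 (f.x b.2.1) v) - π.J b.1 (f.x b.2.1) (π.J a.1 (f.x a.2.1) v)) +
      ((b.sign : ℂ) * Complex.I) • (π.J a.1 (f.x a.2.1) (π.J b.1 (f.y b.2.1) v) -
        π.J b.1 (f.y b.2.1) (π.J a.1 (f.x a.2.1) v)) +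
      ((a.sign : ℂ) * Complex.I) • (π.J a.1 (f.y a.2.1) (π.J b.1 (f.x b.2.1) v) -
        π.J b.1 (f.x b.2.1) (π.J a.1 (f.y a.2.1) v)) +
      (((a.sign : ℂ) * Complex.I) * ((b.sign : ℂ) * Complex.I)) •
        (π.J a.1 (f.y a.2.1) (π.J b.1 (f.y b.2.1) v) -
        π.J b.1 (f.y b.2.1) (π.J a.1 (f.y a.2.1) v)) := by
    simp only [op_apply, map_add, map_smul]
    module
  rw [h2]
  exact S.add_mem (S.add_mem (S.add_mem (h1 _ _ _ _) (S.smul_mem _ (h1 _ _ _ _)))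
    (S.smul_mem _ (h1 _ _ _ _))) (S.smul_mem _ (h1 _ _ _ _))

include hw in
/-- An irreducible highest weight module is spanned by words of lowering operators on the highest
weight vector. -/
theorem span_word : Submodule.span ℂ (Set.range (π.word f v₀)) = ⊤ := by
  set S := Submodule.span ℂ (Set.range (π.word f v₀)) with hS
  have hlow : ∀ a : {a // IsLowering f a}, ∀ v ∈ S, π.op f a v ∈ S := by
    intro a v hv
    rw [hS] at hv
    induction hv using Submodule.span_induction with
    | mem v hv =>
      obtain ⟨l, rfl⟩ := hv
      exact Submodule.subset_span ⟨a :: l, rfl⟩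
    | zero => simp
    | add x y _ _ hx hy =>
      rw [map_add]
      exact S.add_mem hx hy
    | smul c x _ hx =>
      rw [map_smul]
      exact S.smul_mem _ hx
  have hword : ∀ l : List {a // IsLowering f a}, π.word f v₀ l ∈ S := fun l =>
    Submodule.subset_span ⟨l, rfl⟩
  have hJ : ∀ l : List {a // IsLowering f a}, ∀ n z, π.J n z (π.word f v₀ l) ∈ S := by
    intro l
    induction l with
    | nil =>
      refine π.J_mem_of_op_mem f fun a => ?_
      rw [word_nil]
      by_cases ha : IsLowering f a
      · exact hword [⟨a, ha⟩]
      by_cases ha' : IsLowering f a.dual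
      · have := π.op_dual_highestWeight hw ha'
        rw [Letter.dual_dual] at this
        rw [this]
        exact S.zero_mem
      -- the remaining letters belong to the Cartan subalgebra
      have h0 : a.1 = 0 ∧ a.sign * f.r a.2.1 = 0 := by
        unfold IsLowering at ha ha'
        rw [Letter.sign_dual] at ha'
        simp only [Letter.dual] at ha'
        push Not at ha ha'
        have h1 : a.1 = 0 := by omega
        refine ⟨h1, le_antisymm ?_ (ha.2 h1)⟩
        have := ha'.2 (by omega)
        linarith
      have hr : f.r a.2.1 = 0 := by
        refine (mul_eq_zero.1 h0.2).resolve_left fun h => ?_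
        have := a.sign_mul_self
        rw [h] at this
        norm_num at this
      rw [op_apply, h0.1, hw.cartan _ (by rw [f.lie_x, hr, zero_smul]),
        hw.cartan _ (by rw [f.lie_y, hr, zero_smul, neg_zero])]
      exact S.add_mem (S.smul_mem _ (hword [])) (S.smul_mem _ (S.smul_mem _ (hword [])))
    | cons a l ih =>
      refine π.J_mem_of_op_mem f fun b => ?_
      rw [word_cons, ← sub_add_cancel (π.op f b _) (π.op f a (π.op f b (π.word f v₀ l)))]
      refine S.add_mem (π.op_op_sub_mem f ih (hword l) _ _) (hlow a _ ?_)
      rw [op_apply]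
      exact S.add_mem (ih _ _) (S.smul_mem _ (ih _ _))
  refine (π.irreducible S fun n x v hv => ?_).resolve_left fun hbot => ?_
  · rw [hS] at hv
    induction hv using Submodule.span_induction with
    | mem v hv =>
      obtain ⟨l, rfl⟩ := hv
      exact hJ l n x
    | zero => simp
    | add x y _ _ hx hy =>
      rw [map_add]
      exact S.add_mem hx hy
    | smul c x _ hx =>
      rw [map_smul]
      exact S.smul_mem _ hx
  · have := hword []
    rw [hbot] at this
    exact hw.ne_zero this

include hw in
/-- A functional is zero if it vanishes on the highest weight vector and on the ranges of the
lowering operators. -/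
theorem functional_eq_zero {φ : π.V →ₗ[ℂ] ℂ} (h0 : φ v₀ = 0)
    (hl : ∀ a : {a // IsLowering f a}, ∀ v, φ (π.op f a v) = 0) : φ = 0 := by
  refine LinearMap.ext_on_range (π.span_word f hw) fun l => ?_
  cases l with
  | nil => exact h0
  | cons a l => exact hl a _

include hw in
/-- The highest weight vector is an eigenvector of the conformal Hamiltonian: the component of
`L₀ v₀` orthogonal to `v₀` is annihilated by the raising operators, so it is orthogonal to all
words. -/
theorem exists_L0_highestWeight (he : ∀ a b, normForm hv (e a) (e b) = if a = b then 1 else 0)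
    (hhv : hv ≠ 0) : ∃ c : ℝ, π.L0 e v₀ = (c : ℂ) • v₀ := by
  obtain ⟨f⟩ := exists_rootFrame he ξ₀
  have hne : ip v₀ v₀ ≠ 0 := inner_self_ne_zero.2 hw.ne_zero
  set c : ℂ := ip v₀ (π.L0 e v₀) / ip v₀ v₀ with hc
  have hu : π.L0 e v₀ - c • v₀ = 0 := by
    have h1 : (innerₛₗ ℂ (π.L0 e v₀ - c • v₀) : π.V →ₗ[ℂ] ℂ) = 0 := by
      refine π.functional_eq_zero f hw ?_ fun a v => ?_
      · have h2 : inner ℂ v₀ (π.L0 e v₀ - c • v₀) = 0 := by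
          rw [inner_sub_right, inner_smul_right, hc]
          exact sub_eq_zero.2 (div_mul_cancel₀ _ hne).symm
        rw [innerₛₗ_apply_apply]
        exact inner_eq_zero_symm.1 h2
      · rw [innerₛₗ_apply_apply]
        have h2 := π.op_adj f (Letter.dual a.1) (π.L0 e v₀ - c • v₀) v
        rw [Letter.dual_dual] at h2
        have h3 : π.op f (Letter.dual a.1) (π.L0 e v₀ - c • v₀) = 0 := by
          have h4 := π.L0_op f he hhv (Letter.dual a.1) v₀
          rw [π.op_dual_highestWeight hw a.2, map_zero, smul_zero, sub_zero] at h4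
          rw [map_sub, map_smul, π.op_dual_highestWeight hw a.2, ← h4, smul_zero, sub_zero]
        rw [h3] at h2
        simp only [ip, inner_zero_left] at h2
        exact h2.symm
    have h5 := LinearMap.congr_fun h1 (π.L0 e v₀ - c • v₀)
    rw [innerₛₗ_apply_apply, LinearMap.zero_apply] at h5
    exact inner_self_eq_zero.1 h5
  rw [sub_eq_zero] at hu
  have hreal : (starRingEnd ℂ) c = c := by
    have h1 := π.L0_symm (e := e) v₀ v₀
    rw [hu] at h1
    simp only [ip] at h1 hne
    rw [inner_smul_left, inner_smul_right] at h1
    exact mul_right_cancel₀ hne h1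
  exact ⟨c.re, by rw [Complex.conj_eq_iff_re.1 hreal, hu]⟩

include hw in
theorem exists_weight_highestWeight : ∃ η : ℝ, π.J 0 ξ₀ v₀ = (η : ℂ) • v₀ := by
  have hne : ip v₀ v₀ ≠ 0 := inner_self_ne_zero.2 hw.ne_zero
  have h1 := hw.cartan ξ₀ (lie_self _)
  have h2 := π.adj 0 ξ₀ v₀ v₀
  rw [neg_zero, h1] at h2
  simp only [ip] at h2 hne
  rw [inner_smul_left, inner_smul_right] at h2
  exact ⟨(μ ξ₀).re, by rw [Complex.conj_eq_iff_re.1 (mul_right_cancel₀ hne h2), h1]⟩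

/-- The total mode number of a list of letters, up to sign. -/
def energy (l : List {a // IsLowering f a}) : ℝ := (l.map fun a => -(a.1.1 : ℝ)).sum

/-- The sum of the roots of a list of letters, evaluated at `ξ₀`. -/
def weight (l : List {a // IsLowering f a}) : ℝ := (l.map fun a => a.1.sign * f.r a.1.2.1).sum

theorem L0_word (he : ∀ a b, normForm hv (e a) (e b) = if a = b then 1 else 0) (hhv : hv ≠ 0)
    {c : ℝ} {v : π.V} (hc : π.L0 e v = (c : ℂ) • v) (l : List {a // IsLowering f a}) :
    π.L0 e (π.word f v l) = ((c + energy f l : ℝ) : ℂ) • π.word f v l := by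
  induction l with
  | nil => simpa [energy, word_nil] using hc
  | cons a l ih =>
    rw [word_cons, π.L0_op f he hhv, ih, map_smul, ← sub_smul]
    congr 1
    simp only [energy, List.map_cons, List.sum_cons]
    push_cast
    ring

theorem J_zero_word {η : ℝ} {v : π.V} (hη : π.J 0 ξ₀ v = (η : ℂ) • v)
    (l : List {a // IsLowering f a}) :
    π.J 0 ξ₀ (π.word f v l) = ((η + weight f l : ℝ) : ℂ) • π.word f v l := by
  induction l with
  | nil => simpa [weight, word_nil] using hη
  | cons a l ih =>
    rw [word_cons, π.J_zero_op f, ih, map_smul, ← add_smul]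
    congr 1
    simp only [weight, List.map_cons, List.sum_cons]
    push_cast
    ring

theorem le_energy_of_mem {l : List {a // IsLowering f a}} {a : {a // IsLowering f a}} (ha : a ∈ l) :
    -(a.1.1 : ℝ) ≤ energy f l := by
  refine List.single_le_sum (fun x hx => ?_) _ (List.mem_map_of_mem ha)
  obtain ⟨b, -, rfl⟩ := List.mem_map.1 hx
  have h1 : b.1.1 ≤ 0 := by rcases b.2 with h | ⟨h, -⟩ <;> omega
  have : (b.1.1 : ℝ) ≤ 0 := by exact_mod_cast h1
  linarith

/-- The length of a word is controlled by its energy and its weight. -/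
theorem exists_length_le : ∃ δ > 0, ∃ R : ℝ, 0 ≤ R ∧ ∀ l : List {a // IsLowering f a},
    δ * l.length ≤ R * energy f l - weight f l := by
  obtain ⟨δ, hδ, hδr⟩ : ∃ δ > 0, ∀ j, 0 < f.r j → δ ≤ f.r j := by
    have hfin : (Set.range f.r ∩ Set.Ioi 0).Finite := (Set.finite_range _).inter_of_left _
    rcases (Set.range f.r ∩ Set.Ioi 0).eq_empty_or_nonempty with h | h
    · refine ⟨1, one_pos, fun j hj => ?_⟩
      have : f.r j ∈ Set.range f.r ∩ Set.Ioi 0 := ⟨⟨j, rfl⟩, hj⟩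
      rw [h] at this
      exact this.elim
    · obtain ⟨δ, hδ, hmin⟩ := hfin.exists_minimalFor id _ h
      refine ⟨δ, hδ.2, fun j hj => ?_⟩
      by_contra hlt
      push Not at hlt
      exact hlt.not_ge (hmin ⟨⟨j, rfl⟩, hj⟩ hlt.le)
  have hsum : ∀ j, f.r j ≤ ∑ j, f.r j := fun j =>
    Finset.single_le_sum (fun j _ => f.r_nonneg j) (Finset.mem_univ j)
  have hsum0 : 0 ≤ ∑ j, f.r j := Finset.sum_nonneg fun j _ => f.r_nonneg j
  refine ⟨δ, hδ, ∑ j, f.r j + δ, by linarith, fun l => ?_⟩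
  induction l with
  | nil => simp [energy, weight]
  | cons a l ih =>
    simp only [energy, weight, List.map_cons, List.sum_cons, List.length_cons] at ih ⊢
    push_cast
    suffices h : δ ≤ (∑ j, f.r j + δ) * -(a.1.1 : ℝ) - a.1.sign * f.r a.1.2.1 by
      linear_combination ih + h
    have hr := f.r_nonneg a.1.2.1
    have hs : a.1.sign = 1 ∨ a.1.sign = -1 := by
      unfold Letter.sign
      split_ifs <;> simp
    rcases a.2 with h | ⟨h0, h⟩
    · have h1 : (1 : ℝ) ≤ -(a.1.1 : ℝ) := by
        have : (1 : ℤ) ≤ -a.1.1 := by omega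
        exact_mod_cast this
      have h2 : ∑ j, f.r j + δ ≤ (∑ j, f.r j + δ) * -(a.1.1 : ℝ) :=
        le_mul_of_one_le_right (by linarith) h1
      have h3 : a.1.sign * f.r a.1.2.1 ≤ f.r a.1.2.1 := by
        rcases hs with h | h <;> rw [h] <;> linarith
      linarith [hsum a.1.2.1]
    · rcases hs with h' | h'
      · rw [h'] at h
        linarith
      · rw [h'] at h ⊢
        have := hδr _ (by linarith : 0 < f.r a.1.2.1)
        rw [h0]
        simpa using this

theorem finite_words (K : ℕ) (B : ℝ) :
    {l : List {a // IsLowering f a} | l.length ≤ K ∧ energy f l ≤ B}.Finite := by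
  have hA : {a : {a // IsLowering f a} | -(a.1.1 : ℝ) ≤ B}.Finite := by
    have h1 : ((Set.Icc (-⌊B⌋) 0) ×ˢ (Set.univ : Set (Fin d × Bool))).Finite :=
      (Set.finite_Icc _ _).prod Set.finite_univ
    refine (h1.preimage (f := Subtype.val) Subtype.val_injective.injOn).subset fun a ha => ?_
    simp only [Set.mem_preimage, Set.mem_prod, Set.mem_Icc, Set.mem_univ, and_true]
    have h2 : -a.1.1 ≤ ⌊B⌋ := Int.le_floor.2 (by push_cast; exact ha)
    have h3 : a.1.1 ≤ 0 := by rcases a.2 with h | ⟨h, -⟩ <;> omega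
    exact ⟨by omega, h3⟩
  have : Finite {a : {a // IsLowering f a} | -(a.1.1 : ℝ) ≤ B} := hA
  refine ((List.finite_length_le {a : {a // IsLowering f a} | -(a.1.1 : ℝ) ≤ B} K).image
    (List.map Subtype.val)).subset fun l hl => ?_
  refine ⟨l.attach.map fun a => ⟨a.1, (le_energy_of_mem f a.2).trans hl.2⟩, ?_, ?_⟩
  · change _ ≤ K
    simpa using hl.1
  · rw [List.map_map]
    exact List.attach_map_subtype_val l

/-- The eigenspaces of the conformal Hamiltonian are finite dimensional and span the space of finite
energy vectors. The spanning family consists of the words of lowering operators; on a nonzero word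
of bounded energy the weight is bounded by `norm_sq_J_zero_le`, hence so is the length. -/
theorem exists_energy_basis (he : ∀ a b, normForm hv (e a) (e b) = if a = b then 1 else 0)
    (hhv : hv ≠ 0) : ∃ (ι : Type) (b : ι → π.V) (h : ι → ℝ),
      (∀ i, π.L0 e (b i) = (h i : ℂ) • b i) ∧ Submodule.span ℂ (Set.range b) = ⊤ ∧
      ∀ c : ℝ, FiniteDimensional ℂ (Submodule.span ℂ (b '' {i | h i < c})) := by
  obtain ⟨ξ₀, -, μ, v₀, hw⟩ := π.highestWeight
  obtain ⟨f⟩ := exists_rootFrame he ξ₀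
  obtain ⟨c₀, hc₀⟩ := π.exists_L0_highestWeight hw he hhv
  obtain ⟨η, hη⟩ := π.exists_weight_highestWeight hw
  have hL := π.L0_word f he hhv hc₀
  have hJ := π.J_zero_word f hη
  refine ⟨_, π.word f v₀, fun l => c₀ + energy f l, hL, π.span_word f hw, fun c => ?_⟩
  obtain ⟨δ, hδ, R, hR, hlen⟩ := exists_length_le f
  -- on vectors of energy at most `c`, the eigenvalues of `J₀ ξ₀` are bounded by `B`
  set κ := normForm hv ξ₀ ξ₀ * (2 * ((ℓ : ℝ) + hv)) with hκ
  have hκ0 : 0 ≤ κ := by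
    refine mul_nonneg ?_ (by positivity)
    rw [normForm_eq_sum he]
    exact Finset.sum_nonneg fun a _ => mul_self_nonneg _
  set B := √(κ * c) with hB
  obtain ⟨K, hK⟩ := exists_nat_ge ((R * (c - c₀) + (B + η)) / δ)
  have hfin : (insert 0 (π.word f v₀ '' {l | l.length ≤ K ∧ energy f l ≤ c - c₀})).Finite :=
    ((finite_words f K (c - c₀)).image _).insert 0
  refine FiniteDimensional.span_of_finite ℂ (hfin.subset ?_)
  rintro _ ⟨l, hl, rfl⟩
  change c₀ + energy f l < c at hl
  rcases eq_or_ne (π.word f v₀ l) 0 with h0 | h0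
  · exact Or.inl h0
  refine Or.inr ⟨l, ⟨?_, by linarith⟩, rfl⟩
  have h1 := π.norm_sq_J_zero_le he hhv ξ₀ (π.word f v₀ l)
  have hpos : 0 < ‖π.word f v₀ l‖ ^ 2 := by positivity
  rw [hJ, hL, norm_smul, mul_pow, ip, inner_smul_right, inner_self_eq_norm_sq_to_K,
    Complex.re_ofReal_mul, Complex.norm_real, Real.norm_eq_abs, sq_abs] at h1
  have h2 : (((‖π.word f v₀ l‖ : ℝ) : ℂ) ^ 2).re = ‖π.word f v₀ l‖ ^ 2 := by
    rw [← Complex.ofReal_pow, Complex.ofReal_re]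
  have h3 : (η + weight f l) ^ 2 * ‖π.word f v₀ l‖ ^ 2 ≤
      (κ * (c₀ + energy f l)) * ‖π.word f v₀ l‖ ^ 2 := by
    refine h1.trans (le_of_eq ?_)
    refine Eq.trans ?_ (show normForm hv ξ₀ ξ₀ * (2 * ((ℓ : ℝ) + hv) * ((c₀ + energy f l) *
      ‖π.word f v₀ l‖ ^ 2)) = _ by rw [hκ]; ring)
    rw [← h2]
    rfl
  have h4 : (η + weight f l) ^ 2 ≤ κ * c :=
    (le_of_mul_le_mul_right h3 hpos).trans (mul_le_mul_of_nonneg_left hl.le hκ0)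
  have h5 : |η + weight f l| ≤ B := Real.abs_le_sqrt h4
  have h6 : δ * l.length ≤ R * (c - c₀) + (B + η) := by
    have h7 : R * energy f l ≤ R * (c - c₀) := mul_le_mul_of_nonneg_left (by linarith) hR
    linarith [hlen l, neg_abs_le (η + weight f l)]
  have h8 : (l.length : ℝ) ≤ K := by
    refine le_trans ?_ hK
    rw [le_div_iff₀ hδ]
    linarith
  exact_mod_cast h8

/-- Schur's lemma: a bounded operator that commutes weakly with the current modes is a scalar. -/
theorem exists_scalar (he : ∀ a b, normForm hv (e a) (e b) = if a = b then 1 else 0)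
    {T : π.Hilb →L[ℂ] π.Hilb} (hT : ∀ n x u v, inner ℂ (T (toHilb (π.J n x u))) (toHilb v) =
      inner ℂ (T (toHilb u)) (toHilb (π.J (-n) x v))) : ∃ c : ℂ, T = c • 1 := by
  obtain ⟨ξ₀, -, μ, v₀, hw⟩ := π.highestWeight
  obtain ⟨f⟩ := exists_rootFrame he ξ₀
  have hop : ∀ a u v, inner ℂ (T (toHilb (π.op f a u))) (toHilb v) =
      inner ℂ (T (toHilb u)) (toHilb (π.op f (Letter.dual a) v)) := by
    intro a u v
    rw [op_apply, op_apply, Letter.sign_dual]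
    simp only [map_add, map_smul, inner_add_left, inner_add_right, inner_smul_left,
      inner_smul_right, hT, Letter.dual, map_mul, Complex.conj_ofReal, Complex.conj_I]
    push_cast
    ring
  have hne : inner ℂ (toHilb v₀) (toHilb v₀) ≠ 0 := by
    rw [LinearIsometry.inner_map_map]
    exact inner_self_ne_zero.2 hw.ne_zero
  set c : ℂ := inner ℂ (toHilb v₀) (T (toHilb v₀)) / inner ℂ (toHilb v₀) (toHilb v₀) with hc
  have h0 : ∀ u, inner ℂ (T (toHilb v₀)) (toHilb u) = inner ℂ (c • toHilb v₀) (toHilb u) := by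
    intro u
    have h1 : (innerₛₗ ℂ (T (toHilb v₀) - c • toHilb v₀) : π.Hilb →ₗ[ℂ] ℂ) ∘ₗ
        (toHilb : π.V →ₗᵢ[ℂ] π.Hilb).toLinearMap = 0 := by
      refine π.functional_eq_zero f hw ?_ fun a v => ?_
      · change inner ℂ (T (toHilb v₀) - c • toHilb v₀) (toHilb v₀) = 0
        refine inner_eq_zero_symm.1 ?_
        rw [inner_sub_right, inner_smul_right, hc, div_mul_cancel₀ _ hne, sub_self]
      · change inner ℂ (T (toHilb v₀) - c • toHilb v₀) (toHilb (π.op f a v)) = 0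
        have h2 := hop (Letter.dual a.1) v₀ v
        have h3 := π.op_adj f (Letter.dual a.1) v₀ v
        rw [Letter.dual_dual, π.op_dual_highestWeight hw a.2] at h2 h3
        rw [map_zero, map_zero, inner_zero_left] at h2
        simp only [ip, inner_zero_left] at h3
        rw [inner_sub_left, ← h2, inner_smul_left, LinearIsometry.inner_map_map, ← h3, mul_zero,
          sub_zero]
    have h2 := LinearMap.congr_fun h1 u
    change inner ℂ (T (toHilb v₀) - c • toHilb v₀) (toHilb u) = 0 at h2
    rwa [inner_sub_left, sub_eq_zero] at h2
  have hword : ∀ l u, inner ℂ (T (toHilb (π.word f v₀ l))) (toHilb u) =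
      inner ℂ (c • toHilb (π.word f v₀ l)) (toHilb u) := by
    intro l
    induction l with
    | nil => exact h0
    | cons a l ih =>
      intro u
      have h1 := π.op_adj f a (π.word f v₀ l) u
      rw [word_cons, hop, ih, inner_smul_left, inner_smul_left, LinearIsometry.inner_map_map,
        LinearIsometry.inner_map_map]
      simp only [ip] at h1
      rw [h1]
  refine ⟨c, ?_⟩
  have hv : ∀ v : π.V, T (toHilb v) = c • toHilb v := by
    intro v
    have hv : v ∈ Submodule.span ℂ (Set.range (π.word f v₀)) := by
      rw [π.span_word f hw]
      trivial
    induction hv using Submodule.span_induction with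
    | mem v hv =>
      obtain ⟨l, rfl⟩ := hv
      refine ext_inner_right ℂ fun ζ => ?_
      refine denseRange_toHilb.induction_on (p := fun ζ => inner ℂ (T (toHilb (π.word f v₀ l))) ζ =
        inner ℂ (c • toHilb (π.word f v₀ l)) ζ) ζ
        (isClosed_eq (continuous_const.inner continuous_id) (continuous_const.inner continuous_id))
        fun u => hword l u
    | zero => simp
    | add x y _ _ hx hy => rw [map_add, map_add, hx, hy, smul_add]
    | smul a x _ hx => rw [map_smul, map_smul, hx, smul_comm]
  ext ζ
  exact denseRange_toHilb.induction_on (p := fun ζ => T ζ = (c • (1 : π.Hilb →L[ℂ] π.Hilb)) ζ) ζ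
    (isClosed_eq T.continuous (ContinuousLinearMap.continuous _)) fun u => hv u

end AffineRep

/-! ### Fourier coefficients of trigonometric loops -/

section Fourier

variable {d : ℕ}

theorem integral_cos_int_mul (m : ℤ) :
    ∫ θ in (0)..(2 * Real.pi), Real.cos (m * θ) = if m = 0 then 2 * Real.pi else 0 := by
  split_ifs with h
  · simp [h]
  · have hm : (m : ℝ) ≠ 0 := by exact_mod_cast h
    rw [intervalIntegral.integral_comp_mul_left (fun x => Real.cos x) hm, integral_cos,
      show (m : ℝ) * (2 * Real.pi) = ((2 * m : ℤ) : ℝ) * Real.pi by push_cast; ring,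
      Real.sin_int_mul_pi]
    simp

theorem integral_sin_int_mul (m : ℤ) :
    ∫ θ in (0)..(2 * Real.pi), Real.sin (m * θ) = 0 := by
  rcases eq_or_ne m 0 with rfl | h
  · simp
  · have hm : (m : ℝ) ≠ 0 := by exact_mod_cast h
    rw [intervalIntegral.integral_comp_mul_left (fun x => Real.sin x) hm, integral_sin,
      Real.cos_int_mul_two_pi]
    simp

theorem integral_cos_mul_cos (n k : ℤ) :
    ∫ θ in (0)..(2 * Real.pi), Real.cos (n * θ) * Real.cos (k * θ) =
      (if n = k then Real.pi else 0) + if n = -k then Real.pi else 0 := by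
  have h1 : ∀ θ : ℝ, Real.cos (n * θ) * Real.cos (k * θ) =
      (1 / 2) * (Real.cos ((n - k : ℤ) * θ) + Real.cos ((n + k : ℤ) * θ)) := fun θ => by
    push_cast
    rw [sub_mul, add_mul, Real.cos_sub, Real.cos_add]
    ring
  simp only [h1]
  rw [intervalIntegral.integral_const_mul, intervalIntegral.integral_add
    (Continuous.intervalIntegrable (by fun_prop) _ _)
    (Continuous.intervalIntegrable (by fun_prop) _ _), integral_cos_int_mul, integral_cos_int_mul]
  simp only [sub_eq_zero, add_eq_zero_iff_eq_neg]
  split_ifs <;> ring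

theorem integral_sin_mul_sin (n k : ℤ) :
    ∫ θ in (0)..(2 * Real.pi), Real.sin (n * θ) * Real.sin (k * θ) =
      (if n = k then Real.pi else 0) - if n = -k then Real.pi else 0 := by
  have h1 : ∀ θ : ℝ, Real.sin (n * θ) * Real.sin (k * θ) =
      (1 / 2) * (Real.cos ((n - k : ℤ) * θ) - Real.cos ((n + k : ℤ) * θ)) := fun θ => by
    push_cast
    rw [sub_mul, add_mul, Real.cos_sub, Real.cos_add]
    ring
  simp only [h1]
  rw [intervalIntegral.integral_const_mul, intervalIntegral.integral_sub
    (Continuous.intervalIntegrable (by fun_prop) _ _)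
    (Continuous.intervalIntegrable (by fun_prop) _ _), integral_cos_int_mul, integral_cos_int_mul]
  simp only [sub_eq_zero, add_eq_zero_iff_eq_neg]
  split_ifs <;> ring

theorem integral_sin_mul_cos (n k : ℤ) :
    ∫ θ in (0)..(2 * Real.pi), Real.sin (n * θ) * Real.cos (k * θ) = 0 := by
  have h1 : ∀ θ : ℝ, Real.sin (n * θ) * Real.cos (k * θ) =
      (1 / 2) * (Real.sin ((n + k : ℤ) * θ) + Real.sin ((n - k : ℤ) * θ)) := fun θ => by
    push_cast
    rw [sub_mul, add_mul, Real.sin_sub, Real.sin_add]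
    ring
  simp only [h1]
  rw [intervalIntegral.integral_const_mul, intervalIntegral.integral_add
    (Continuous.intervalIntegrable (by fun_prop) _ _)
    (Continuous.intervalIntegrable (by fun_prop) _ _), integral_sin_int_mul, integral_sin_int_mul]
  simp

/-- The loop `θ ↦ cos (k θ) x`. -/
def cosLoop (k : ℕ) (x : ModelE d) (z : Circle) : ModelE d := ((z : ℂ) ^ k).re • x

/-- The loop `θ ↦ sin (k θ) x`. -/
def sinLoop (k : ℕ) (x : ModelE d) (z : Circle) : ModelE d := ((z : ℂ) ^ k).im • x

theorem cosLoop_exp (k : ℕ) (x : ModelE d) (θ : ℝ) :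
    cosLoop k x (Circle.exp θ) = Real.cos ((k : ℤ) * θ) • x := by
  rw [cosLoop, Circle.coe_exp, ← Complex.exp_nat_mul, ← mul_assoc, ← Complex.ofReal_natCast,
    ← Complex.ofReal_mul, Complex.exp_ofReal_mul_I_re]
  rfl

theorem sinLoop_exp (k : ℕ) (x : ModelE d) (θ : ℝ) :
    sinLoop k x (Circle.exp θ) = Real.sin ((k : ℤ) * θ) • x := by
  rw [sinLoop, Circle.coe_exp, ← Complex.exp_nat_mul, ← mul_assoc, ← Complex.ofReal_natCast,
    ← Complex.ofReal_mul, Complex.exp_ofReal_mul_I_im]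
  rfl

theorem contMDiff_circle_pow (k : ℕ) :
    ContMDiff (𝓡 1) 𝓘(ℝ, ℂ) ∞ fun z : Circle => (z : ℂ) ^ k := by
  have : Fact (Module.finrank ℝ ℂ = 1 + 1) := ⟨Complex.finrank_real_complex⟩
  have h1 : ContMDiff (𝓡 1) 𝓘(ℝ, ℂ) ∞ fun z : Circle => (z : ℂ) :=
    contMDiff_coe_sphere (E := ℂ) (n := 1)
  have h2 : ContDiff ℝ ∞ fun w : ℂ => w ^ k := contDiff_id.pow k
  exact h2.contMDiff.comp h1

theorem contMDiff_cosLoop (k : ℕ) (x : ModelE d) :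
    ContMDiff (𝓡 1) 𝓘(ℝ, ModelE d) ∞ (cosLoop k x) := by
  have h : ContDiff ℝ ∞ fun w : ℂ => w.re • x := Complex.reCLM.contDiff.smul contDiff_const
  exact h.contMDiff.comp (contMDiff_circle_pow k)

theorem contMDiff_sinLoop (k : ℕ) (x : ModelE d) :
    ContMDiff (𝓡 1) 𝓘(ℝ, ModelE d) ∞ (sinLoop k x) := by
  have h : ContDiff ℝ ∞ fun w : ℂ => w.im • x := Complex.imCLM.contDiff.smul contDiff_const
  exact h.contMDiff.comp (contMDiff_circle_pow k)

theorem fourierRe_cosLoop (k : ℕ) (x : ModelE d) (n : ℤ) : fourierRe (cosLoop k x) n =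
    ((if n = k then 1 / 2 else 0) + if n = -k then 1 / 2 else 0 : ℝ) • x := by
  simp only [fourierRe, cosLoop_exp, smul_smul]
  rw [intervalIntegral.integral_smul_const, integral_cos_mul_cos, smul_smul]
  congr 1
  have := Real.pi_ne_zero
  split_ifs <;> field_simp <;> norm_num

theorem fourierIm_cosLoop (k : ℕ) (x : ModelE d) (n : ℤ) : fourierIm (cosLoop k x) n = 0 := by
  simp only [fourierIm, cosLoop_exp, smul_smul]
  rw [intervalIntegral.integral_smul_const, integral_sin_mul_cos]
  simp

theorem fourierRe_sinLoop (k : ℕ) (x : ModelE d) (n : ℤ) : fourierRe (sinLoop k x) n = 0 := by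
  simp only [fourierRe, sinLoop_exp, smul_smul]
  rw [intervalIntegral.integral_smul_const]
  simp only [mul_comm (Real.cos _)]
  rw [integral_sin_mul_cos]
  simp

theorem fourierIm_sinLoop (k : ℕ) (x : ModelE d) (n : ℤ) : fourierIm (sinLoop k x) n =
    ((if n = k then -(1 / 2) else 0) + if n = -k then 1 / 2 else 0 : ℝ) • x := by
  simp only [fourierIm, sinLoop_exp, smul_smul]
  rw [intervalIntegral.integral_smul_const, integral_sin_mul_sin, smul_smul, ← neg_smul]
  congr 1
  have := Real.pi_ne_zero
  split_ifs <;> field_simp <;> norm_num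

end Fourier

/-! ### Intertwiners of loop group representations -/

namespace LoopRep

variable {d : ℕ} {G : Type*} [TopologicalSpace G] [ChartedSpace (ModelE d) G] [Group G]
  [LieGroup 𝓘(ℝ, ModelE d) ∞ G] {hv ℓ : ℕ} (π : LoopRep.{u} d G hv ℓ)

theorem currentTerm_apply {ξ : Circle → ModelE d} {n : ℤ} {a b : ℝ} {x : LieAlg d G}
    (hre : fourierRe ξ n = a • (x : ModelE d)) (him : fourierIm ξ n = b • (x : ModelE d))
    (v : π.V) :
    currentTerm π.J ξ n v = (-Complex.I * (a + Complex.I * b)) • π.J n x v := by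
  have h : currentTerm π.J ξ n = (-Complex.I) • (π.J n (a • x) + Complex.I • π.J n (b • x)) := by
    unfold currentTerm
    rw [hre, him]
  rw [h, LinearMap.smul_apply, LinearMap.add_apply, LinearMap.smul_apply,
    π.toAffineRep.J_real_smul, π.toAffineRep.J_real_smul]
  module

theorem hasSum_cosLoop (k : ℕ) (x : LieAlg d G) (v : π.V) :
    HasSum (fun n : ℤ => toHilb (currentTerm π.J (cosLoop (d := d) k x) n v))
      ((-Complex.I / 2) • toHilb (π.J k x v) + (-Complex.I / 2) • toHilb (π.J (-k) x v)) := by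
  have h1 : ∀ n : ℤ, toHilb (currentTerm π.J (cosLoop (d := d) k x) n v) =
      (if n = k then (-Complex.I / 2) • toHilb (π.J k x v) else 0) +
      if n = -k then (-Complex.I / 2) • toHilb (π.J (-k) x v) else 0 := by
    intro n
    rw [π.currentTerm_apply (b := 0) (fourierRe_cosLoop k _ n)
      ((fourierIm_cosLoop k _ n).trans (zero_smul ℝ (x : ModelE d)).symm), map_smul,
      Complex.ofReal_add, Complex.ofReal_zero, mul_zero, add_zero, mul_add, add_smul]
    congr 1
    · split_ifs with h
      · subst h
        congr 1
        push_cast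
        ring
      · simp
    · split_ifs with h
      · subst h
        congr 1
        push_cast
        ring
      · simp
  simp only [h1]
  exact (hasSum_ite_eq _ _).add (hasSum_ite_eq _ _)

theorem hasSum_sinLoop (k : ℕ) (x : LieAlg d G) (v : π.V) :
    HasSum (fun n : ℤ => toHilb (currentTerm π.J (sinLoop (d := d) k x) n v))
      ((-1 / 2 : ℂ) • toHilb (π.J k x v) + (1 / 2 : ℂ) • toHilb (π.J (-k) x v)) := by
  have h1 : ∀ n : ℤ, toHilb (currentTerm π.J (sinLoop (d := d) k x) n v) =
      (if n = k then (-1 / 2 : ℂ) • toHilb (π.J k x v) else 0) +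
      if n = -k then (1 / 2 : ℂ) • toHilb (π.J (-k) x v) else 0 := by
    intro n
    rw [π.currentTerm_apply (a := 0)
      ((fourierRe_sinLoop k _ n).trans (zero_smul ℝ (x : ModelE d)).symm)
      (fourierIm_sinLoop k _ n), map_smul, Complex.ofReal_zero, zero_add, ← mul_assoc, neg_mul,
      Complex.I_mul_I, neg_neg, one_mul, Complex.ofReal_add, add_smul]
    congr 1
    · split_ifs with h
      · subst h
        congr 1
        push_cast
        ring
      · simp
    · split_ifs with h
      · subst h
        congr 1
        push_cast
        ring
      · simp
  simp only [h1]
  exact (hasSum_ite_eq _ _).add (hasSum_ite_eq _ _)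

variable {π} in
/-- Differentiating the commutation relation with a one-parameter group of loops. -/
theorem inner_add_inner_eq_zero {T : π.Hilb →L[ℂ] π.Hilb}
    (hT : ∀ a x, T (π.lam a x) = π.lam a (T x)) {ξ : Circle → ModelE d}
    (hξ : ContMDiff (𝓡 1) 𝓘(ℝ, ModelE d) ∞ ξ) {u v : π.V} {wu wv : π.Hilb}
    (hu : HasSum (fun n : ℤ => toHilb (currentTerm π.J ξ n u)) wu)
    (hv : HasSum (fun n : ℤ => toHilb (currentTerm π.J ξ n v)) wv) :
    inner ℂ (T wv) (toHilb u) + inner ℂ (T (toHilb v)) wu = 0 := by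
  obtain ⟨γ, U, -, -, hU, -, hUl, hder⟩ := π.exponentiates ξ hξ
  obtain ⟨wu', hu', hdu⟩ := hder u
  obtain ⟨wv', hv', hdv⟩ := hder v
  rw [← hu.unique hu'] at hdu
  rw [← hv.unique hv'] at hdv
  have hU0 : U 0 = 1 := by
    have := hU 0 0
    rw [add_zero] at this
    exact (left_eq_mul.1 this)
  have hinv : ∀ t x, U (-t) (U t x) = x := fun t x => by
    have := congrArg (fun W : π.Hilb ≃ₗᵢ[ℂ] π.Hilb => W x) (hU (-t) t)
    rw [neg_add_cancel, hU0] at this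
    exact this.symm
  have hTU : ∀ t x, T (U t x) = U t (T x) := fun t x => by
    obtain ⟨c, hc⟩ := hUl t
    rw [hc, hc, map_smul, hT]
  have hφ : ∀ t, inner ℂ (T (U t (toHilb v))) (toHilb u) =
      inner ℂ (T (toHilb v)) (U (-t) (toHilb u)) := fun t => by
    rw [hTU, ← (U (-t)).inner_map_map, hinv]
  have h1 : HasDerivAt (fun t : ℝ => T (U t (toHilb v))) (T wv) 0 :=
    (T.restrictScalars ℝ).hasFDerivAt.comp_hasDerivAt (0 : ℝ) hdv
  have h2 : HasDerivAt (fun t : ℝ => U (-t) (toHilb u)) (-wu) 0 := by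
    have h3 : HasDerivAt (fun t : ℝ => U t (toHilb u)) wu (-0) := by rwa [neg_zero]
    have := h3.scomp (0 : ℝ) (hasDerivAt_neg (0 : ℝ))
    rwa [neg_one_smul] at this
  have h4 := h1.inner ℂ (hasDerivAt_const (0 : ℝ) (toHilb u))
  have h5 := (hasDerivAt_const (0 : ℝ) (T (toHilb v))).inner ℂ h2
  simp only [hφ] at h4
  have h6 := h4.unique h5
  rw [inner_zero_right, inner_zero_left, zero_add, add_zero, inner_neg_right] at h6
  rw [h6, neg_add_cancel]

/-- An operator that commutes with the loop group commutes weakly with the current modes. -/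
theorem inner_J_of_commute {T : π.Hilb →L[ℂ] π.Hilb}
    (hT : ∀ a x, T (π.lam a x) = π.lam a (T x)) (n : ℤ) (x : LieAlg d G) (u v : π.V) :
    inner ℂ (T (toHilb (π.J n x u))) (toHilb v) =
      inner ℂ (T (toHilb u)) (toHilb (π.J (-n) x v)) := by
  have hmain : ∀ k : ℕ,
      inner ℂ (T (toHilb (π.J k x u))) (toHilb v) =
        inner ℂ (T (toHilb u)) (toHilb (π.J (-k) x v)) ∧
      inner ℂ (T (toHilb (π.J (-k) x u))) (toHilb v) =
        inner ℂ (T (toHilb u)) (toHilb (π.J k x v)) := by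
    intro k
    have h1 := inner_add_inner_eq_zero hT (contMDiff_cosLoop (d := d) k x) (π.hasSum_cosLoop k x v)
      (π.hasSum_cosLoop k x u)
    have h2 := inner_add_inner_eq_zero hT (contMDiff_sinLoop (d := d) k x) (π.hasSum_sinLoop k x v)
      (π.hasSum_sinLoop k x u)
    simp only [map_add, map_smul, inner_add_left, inner_add_right, inner_smul_left,
      inner_smul_right, map_div₀, map_neg, Complex.conj_I, map_one, map_ofNat] at h1 h2
    constructor
    · linear_combination (-Complex.I) * h1 - h2 + (1 / 2 : ℂ) *
        (inner ℂ (T (toHilb (π.J k x u))) (toHilb v) +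
          inner ℂ (T (toHilb (π.J (-k) x u))) (toHilb v) -
          inner ℂ (T (toHilb u)) (toHilb (π.J k x v)) -
          inner ℂ (T (toHilb u)) (toHilb (π.J (-k) x v))) * Complex.I_mul_I
    · linear_combination (-Complex.I) * h1 + h2 + (1 / 2 : ℂ) *
        (inner ℂ (T (toHilb (π.J k x u))) (toHilb v) +
          inner ℂ (T (toHilb (π.J (-k) x u))) (toHilb v) -
          inner ℂ (T (toHilb u)) (toHilb (π.J k x v)) -
          inner ℂ (T (toHilb u)) (toHilb (π.J (-k) x v))) * Complex.I_mul_I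
  rcases Int.eq_nat_or_neg n with ⟨k, rfl | rfl⟩
  · exact (hmain k).1
  · rw [neg_neg]
    exact (hmain k).2

theorem exists_scalar {e : Module.Basis (Fin d) ℝ (LieAlg d G)}
    (he : ∀ a b, normForm hv (e a) (e b) = if a = b then 1 else 0) {T : π.Hilb →L[ℂ] π.Hilb}
    (hT : ∀ a x, T (π.lam a x) = π.lam a (T x)) : ∃ c : ℂ, T = c • 1 :=
  π.toAffineRep.exists_scalar he (π.inner_J_of_commute hT)

variable {π} {π' : LoopRep.{u} d G hv ℓ}

theorem exists_adjoint_mul_self {e : Module.Basis (Fin d) ℝ (LieAlg d G)}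
    (he : ∀ a b, normForm hv (e a) (e b) = if a = b then 1 else 0) {W : π.Hilb →L[ℂ] π'.Hilb}
    (hW : ∀ a, ∃ c : Circle, ∀ x, W (π.lam a x) = (c : ℂ) • π'.lam a (W x)) :
    ∃ s : ℂ, ∀ x y, inner ℂ (W x) (W y) = s * inner ℂ x y := by
  obtain ⟨s, hs⟩ := π.exists_scalar he (T := ContinuousLinearMap.adjoint W ∘L W) fun a x => by
    refine ext_inner_right ℂ fun y => ?_
    obtain ⟨z, rfl⟩ := (π.lam a).surjective y
    obtain ⟨c, hc⟩ := hW a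
    have hcc : (starRingEnd ℂ) (c : ℂ) * c = 1 := by
      rw [mul_comm, Complex.mul_conj, Circle.normSq_coe, Complex.ofReal_one]
    rw [LinearIsometryEquiv.inner_map_map, ContinuousLinearMap.comp_apply,
      ContinuousLinearMap.comp_apply, ContinuousLinearMap.adjoint_inner_left,
      ContinuousLinearMap.adjoint_inner_left, hc, hc, inner_smul_left, inner_smul_right,
      LinearIsometryEquiv.inner_map_map, ← mul_assoc, hcc, one_mul]
  refine ⟨s, fun x y => ?_⟩
  rw [← ContinuousLinearMap.adjoint_inner_right]
  have := congrArg (fun T : π.Hilb →L[ℂ] π.Hilb => T y) hs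
  simp only [ContinuousLinearMap.comp_apply] at this
  rw [this]
  exact inner_smul_right _ _ _

/-- Schur's lemma: a nonzero projective intertwiner is a multiple of a unitary one. -/
theorem intertwiner_eq_zero {e : Module.Basis (Fin d) ℝ (LieAlg d G)}
    (he : ∀ a b, normForm hv (e a) (e b) = if a = b then 1 else 0) {W : π.Hilb →L[ℂ] π'.Hilb}
    (hW : ∀ a, ∃ c : Circle, ∀ x, W (π.lam a x) = (c : ℂ) • π'.lam a (W x))
    (hne : ¬ π.Equivalent π') : W = 0 := by
  by_contra h0
  obtain ⟨x₀, hx₀⟩ : ∃ x, W x ≠ 0 := by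
    by_contra h
    push Not at h
    exact h0 (ContinuousLinearMap.ext h)
  obtain ⟨s, hs⟩ := exists_adjoint_mul_self he hW
  have hW' : ∀ a, ∃ c : Circle, ∀ y, ContinuousLinearMap.adjoint W (π'.lam a y) =
      (c : ℂ) • π.lam a (ContinuousLinearMap.adjoint W y) := by
    intro a
    obtain ⟨c, hc⟩ := hW a
    refine ⟨c⁻¹, fun y => ext_inner_right ℂ fun z => ?_⟩
    obtain ⟨z, rfl⟩ := (π.lam a).surjective z
    rw [ContinuousLinearMap.adjoint_inner_left, hc, inner_smul_right, inner_smul_left,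
      LinearIsometryEquiv.inner_map_map, LinearIsometryEquiv.inner_map_map,
      ContinuousLinearMap.adjoint_inner_left, Circle.coe_inv_eq_conj, Complex.conj_conj]
  obtain ⟨s', hs'⟩ := exists_adjoint_mul_self he hW'
  have hWW' : ∀ y, W (ContinuousLinearMap.adjoint W y) = s' • y := by
    intro y
    refine ext_inner_left ℂ fun z => ?_
    rw [← ContinuousLinearMap.adjoint_inner_left, hs', inner_smul_right]
  have hW'W : ∀ x, ContinuousLinearMap.adjoint W (W x) = s • x := by
    intro x
    refine ext_inner_left ℂ fun z => ?_
    rw [ContinuousLinearMap.adjoint_inner_right, hs, inner_smul_right]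
  have hss : s' = s := by
    have h1 := hWW' (W x₀)
    rw [hW'W, map_smul] at h1
    exact (smul_left_injective ℂ hx₀ h1).symm
  have hx₀' : x₀ ≠ 0 := fun h => hx₀ (by rw [h, map_zero])
  set r : ℝ := ‖W x₀‖ / ‖x₀‖ with hr
  have hr0 : 0 < r := div_pos (norm_pos_iff.2 hx₀) (norm_pos_iff.2 hx₀')
  have hsr : s = (r : ℂ) ^ 2 := by
    have h1 := hs x₀ x₀
    rw [inner_self_eq_norm_sq_to_K, inner_self_eq_norm_sq_to_K] at h1
    have h2 : ((‖x₀‖ : ℝ) : ℂ) ≠ 0 := by exact_mod_cast (norm_pos_iff.2 hx₀').ne'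
    rw [hr, Complex.ofReal_div, div_pow, eq_div_iff (pow_ne_zero 2 h2)]
    exact h1.symm
  have hrC : (r : ℂ) ≠ 0 := by exact_mod_cast hr0.ne'
  let V : π.Hilb →ₗᵢ[ℂ] π'.Hilb :=
    { toLinearMap := ((r : ℂ)⁻¹ • W).toLinearMap
      norm_map' := fun x => by
        change ‖(r : ℂ)⁻¹ • W x‖ = ‖x‖
        have h1 := hs x x
        rw [inner_self_eq_norm_sq_to_K, inner_self_eq_norm_sq_to_K, hsr, ← mul_pow] at h1
        have h2 : ‖W x‖ ^ 2 = (r * ‖x‖) ^ 2 := by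
          apply Complex.ofReal_injective
          push_cast
          exact h1
        have h3 : ‖W x‖ = r * ‖x‖ :=
          (sq_eq_sq₀ (norm_nonneg _) (mul_nonneg hr0.le (norm_nonneg _))).1 h2
        rw [norm_smul, norm_inv, Complex.norm_real, Real.norm_of_nonneg hr0.le, h3,
          inv_mul_cancel_left₀ hr0.ne'] }
  have hV : ∀ x, V x = (r : ℂ)⁻¹ • W x := fun x => rfl
  have hsurj : Function.Surjective V := fun y => by
    refine ⟨(r : ℂ)⁻¹ • ContinuousLinearMap.adjoint W y, ?_⟩
    rw [hV, map_smul, hWW', hss, hsr, smul_smul, smul_smul]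
    rw [show (r : ℂ)⁻¹ * (r : ℂ)⁻¹ * (r : ℂ) ^ 2 = 1 by field_simp, one_smul]
  refine hne ⟨LinearIsometryEquiv.ofSurjective V hsurj, fun a => ?_⟩
  obtain ⟨c, hc⟩ := hW a
  refine ⟨c, fun x => ?_⟩
  change (r : ℂ)⁻¹ • W (π.lam a x) = (c : ℂ) • π'.lam a ((r : ℂ)⁻¹ • W x)
  rw [hc, map_smul, smul_comm]

end LoopRep

/-! ### The reduced universal algebra -/

namespace LevelData

variable {d : ℕ} {G : Type*} [TopologicalSpace G] [ChartedSpace (ModelE d) G] [Group G]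
  [LieGroup 𝓘(ℝ, ModelE d) ∞ G] {ℓ : ℕ} (S : LevelData.{u, v} d G ℓ)

/-- The commutant of the reduced representation consists of diagonal operators. -/
theorem exists_diagonal {T : S.HRed →L[ℂ] S.HRed}
    (hT : ∀ a x, T (S.lamRed a x) = S.lamRed a (T x)) :
    ∃ c : Fin S.N → ℂ, ∀ ξ i, T ξ i = c i • ξ i := by
  let K := fun i => (S.rep i).Hilb
  let B : ∀ i j, K j →L[ℂ] K i := fun i j => (PiLp.proj 2 K i : PiLp 2 K →L[ℂ] K i) ∘L T ∘L
    inclCLM K j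
  have hB : ∀ i j x, B i j x = T (inclCLM K j x) i := fun i j x => rfl
  have hincl : ∀ a j, ∃ c : Circle, ∀ x,
      S.lamRed a (inclCLM K j x) = inclCLM K j ((c : ℂ) • (S.rep j).lam a x) := by
    intro a j
    obtain ⟨c, hc⟩ := S.lamRed_apply a j
    refine ⟨c, fun x => ?_⟩
    ext k
    obtain ⟨c', hc'⟩ := S.lamRed_apply a k
    rcases eq_or_ne k j with rfl | h
    · rw [hc, inclCLM_apply, inclCLM_apply, Pi.single_eq_same, Pi.single_eq_same]
    · rw [hc', inclCLM_apply, inclCLM_apply, Pi.single_eq_of_ne h, Pi.single_eq_of_ne h, map_zero,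
        smul_zero]
  have hrel : ∀ a i j (cj ci : Circle),
      (∀ x, S.lamRed a (inclCLM K j x) = inclCLM K j ((cj : ℂ) • (S.rep j).lam a x)) →
      (∀ x, S.lamRed a x i = (ci : ℂ) • (S.rep i).lam a (x i)) →
      ∀ x, (cj : ℂ) • B i j ((S.rep j).lam a x) = (ci : ℂ) • (S.rep i).lam a (B i j x) := by
    intro a i j cj ci hj hi x
    rw [← map_smul, hB, ← hj, hT, hi, hB]
  have hoff : ∀ i j, i ≠ j → B i j = 0 := by
    intro i j hij
    refine LoopRep.intertwiner_eq_zero S.e_orthonormal (fun a => ?_) (S.inequivalent j i hij.symm)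
    obtain ⟨cj, hj⟩ := hincl a j
    obtain ⟨ci, hi⟩ := S.lamRed_apply a i
    refine ⟨cj⁻¹ * ci, fun x => ?_⟩
    have h1 := hrel a i j cj ci hj hi x
    rw [Circle.coe_mul, mul_smul, ← h1, smul_smul, ← Circle.coe_mul, inv_mul_cancel,
      Circle.coe_one, one_smul]
  have hdiag : ∀ i, ∃ c : ℂ, B i i = c • 1 := by
    intro i
    refine (S.rep i).exists_scalar S.e_orthonormal fun a x => ?_
    obtain ⟨c, hc⟩ := S.lamRed_apply a i
    obtain ⟨c', hc'⟩ := hincl a i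
    have h1 := hrel a i i c' c hc' hc x
    have h2 : (c' : ℂ) • (S.rep i).lam a x = (c : ℂ) • (S.rep i).lam a x := by
      have h3 := congrArg (fun z : S.HRed => z i) (hc' x)
      dsimp only at h3
      rw [hc, inclCLM_apply, inclCLM_apply, Pi.single_eq_same, Pi.single_eq_same] at h3
      exact h3.symm
    have h4 : (c : ℂ) • B i i ((S.rep i).lam a x) = (c : ℂ) • (S.rep i).lam a (B i i x) := by
      have h5 := congrArg (B i i) h2
      rw [map_smul, map_smul] at h5
      rw [← h1, h5]
    exact smul_right_injective _ (Circle.coe_ne_zero c) h4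
  choose c hc using hdiag
  refine ⟨c, fun ξ i => ?_⟩
  have h2 : T ξ i = ∑ j, B i j (ξ j) := by
    conv_lhs => rw [← sum_inclCLM ξ]
    rw [map_sum, WithLp.ofLp_sum, Finset.sum_apply]
    rfl
  rw [h2, Finset.sum_eq_single i (fun j _ hj => by rw [hoff i j hj.symm]; rfl) (by simp), hc i]
  rfl

/-- By the inequivalence and irreducibility of the summands, the reduced universal algebra contains
all block diagonal operators. -/
theorem directSumCLM_mem_BAlg (A : ∀ i, (S.rep i).Hilb →L[ℂ] (S.rep i).Hilb) :
    directSumCLM A ∈ S.BAlg := by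
  rw [BAlg, Subalgebra.mem_centralizer_iff]
  intro T hT
  obtain ⟨c, hc⟩ := S.exists_diagonal (T := T) fun a x => by
    have h1 := (Subalgebra.mem_centralizer_iff ℂ).1 hT _ ⟨a, rfl⟩
    exact congrArg (fun R : S.HRed →L[ℂ] S.HRed => R x) h1.symm
  ext ξ i
  change T (directSumCLM A ξ) i = directSumCLM A (T ξ) i
  rw [hc, directSumCLM_apply, directSumCLM_apply, hc, map_smul]

theorem isClosed_BAlg : IsClosed (S.BAlg : Set (S.HRed →L[ℂ] S.HRed)) :=
  Set.isClosed_centralizer _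

end LevelData

/-! ### Operators of definite mode -/

section HasMode

variable {ι X : Type*} [AddCommGroup X] [Module ℂ X] {L A B : Module.End ℂ X} {s t : ℤ}

/-- `A` lowers the eigenvalues of `L` by `s`. -/
def HasMode (L A : Module.End ℂ X) (s : ℤ) : Prop := ∀ x, L (A x) = A (L x) - (s : ℂ) • A x

theorem HasMode.add (hA : HasMode L A s) (hB : HasMode L B s) : HasMode L (A + B) s := fun x => by
  simp only [LinearMap.add_apply, map_add, hA x, hB x]
  module

theorem HasMode.smul (c : ℂ) (hA : HasMode L A s) : HasMode L (c • A) s := fun x => by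
  simp only [LinearMap.smul_apply, map_smul, hA x]
  module

theorem HasMode.mul (hA : HasMode L A s) (hB : HasMode L B t) : HasMode L (A * B) (s + t) :=
  fun x => by
    simp only [Module.End.mul_apply, hA _, hB x, map_sub, map_smul]
    push_cast
    module

theorem HasMode.sum {T : ι → Module.End ℂ X} (S : Finset ι) (h : ∀ i ∈ S, HasMode L (T i) s) :
    HasMode L (∑ i ∈ S, T i) s := fun x => by
  simp only [LinearMap.sum_apply, map_sum, Finset.smul_sum]
  rw [← Finset.sum_sub_distrib]
  exact Finset.sum_congr rfl fun i hi => h i hi x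

theorem HasMode.locSum {T : ι → Module.End ℂ X}
    (hT : ∀ v, (Function.support fun i => T i v).Finite) (h : ∀ i, HasMode L (T i) s) :
    HasMode L (locSum T) s := fun x => by
  rw [locSum_apply hT, locSum_apply hT, smul_finsum]
  rw [← finsum_sub_distrib (hT _) ((hT x).subset fun i hi h0 => hi ?_)]
  · refine (L.toAddMonoidHom.map_finsum (hT x)).trans (finsum_congr fun i => h i x)
  · change T i x = 0 at h0
    simp only [h0, smul_zero]

theorem HasMode.eigenvector (hA : HasMode L A s) {h : ℝ} {x : X} (hx : L x = (h : ℂ) • x) :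
    L (A x) = ((h - s : ℝ) : ℂ) • A x := by
  rw [hA, hx, map_smul, ← sub_smul]
  push_cast
  rfl

end HasMode

/-! ### The Ramond representation -/

namespace RamondRep

variable {d : ℕ} (R : RamondRep.{v} d)

theorem F_F (m n : ℤ) (a b : Fin d ⊕ Fin d) (v : R.V) : R.F m a (R.F n b v) =
    (if m + n = 0 ∧ a = b then v else 0) - R.F n b (R.F m a v) := by
  rw [← R.car, add_sub_cancel_right]

/-- Every finite energy vector is annihilated by all fermionic modes of sufficiently large index. -/
theorem exists_F_eq_zero (v : R.V) : ∃ M : ℕ, ∀ m : ℤ, M ≤ m → ∀ a, R.F m a v = 0 := by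
  let S : Submodule ℂ R.V :=
    { carrier := {v | ∃ M : ℕ, ∀ m : ℤ, M ≤ m → ∀ a, R.F m a v = 0}
      add_mem' := by
        rintro v w ⟨M, hM⟩ ⟨N, hN⟩
        refine ⟨max M N, fun m hm x => ?_⟩
        rw [map_add, hM m (by omega), hN m (by omega), add_zero]
      zero_mem' := ⟨0, fun m _ x => map_zero _⟩
      smul_mem' := by
        rintro c v ⟨M, hM⟩
        refine ⟨M, fun m hm x => ?_⟩
        rw [map_smul, hM m hm, smul_zero] }
  have hS : ∀ n a, ∀ v ∈ S, R.F n a v ∈ S := by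
    rintro n a v ⟨M, hM⟩
    refine ⟨M + n.natAbs + 1, fun m hm y => ?_⟩
    rw [F_F, hM m (by omega), if_neg (by omega)]
    simp
  have htop : S = ⊤ := by
    refine (R.irreducible S hS).resolve_left fun hbot => ?_
    obtain ⟨v, hv0, hv⟩ := R.vacuum
    have : v ∈ S := ⟨1, fun m hm x => hv m (by omega) x⟩
    rw [hbot] at this
    exact hv0 this
  have : v ∈ S := by
    rw [htop]
    trivial
  exact this

/-- The term of mode number `±m` of the conformal Hamiltonian. -/
noncomputable def quad (m : ℕ) : Module.End ℂ R.V :=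
  ∑ a, (((m : ℤ) : ℂ) / 2) • (R.F (-m) a * R.F m a)

theorem quad_apply (m : ℕ) (v : R.V) :
    R.quad m v = ((m : ℂ) / 2) • ∑ a, R.F (-m) a (R.F m a v) := by
  rw [quad, LinearMap.sum_apply, Finset.smul_sum]
  rfl

theorem L0_eq : R.L0 = (locSum fun m : ℤ => R.quad m.natAbs) + ((d : ℂ) / 8) • 1 := by
  simp only [L0, quad, Int.abs_eq_natAbs]

theorem quad_support_finite (v : R.V) :
    (Function.support fun m : ℤ => R.quad m.natAbs v).Finite := by
  obtain ⟨M, hM⟩ := R.exists_F_eq_zero v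
  refine (Set.finite_Icc (-(M : ℤ)) M).subset fun m hm => ?_
  by_contra h
  refine hm ?_
  have h1 : (M : ℤ) ≤ (m.natAbs : ℤ) := by
    rw [Set.mem_Icc] at h
    omega
  simp only [quad_apply, hM _ h1, map_zero, Finset.sum_const_zero, smul_zero]

theorem L0_symm (u v : R.V) : ip (R.L0 u) v = ip u (R.L0 v) := by
  have hq : ∀ (m : ℕ) u v, ip (R.quad m u) v = ip u (R.quad m v) := by
    intro m u v
    have hm : (starRingEnd ℂ) ((m : ℂ) / 2) = (m : ℂ) / 2 := by
      rw [map_div₀, Complex.conj_natCast, Complex.conj_ofNat]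
    simp only [quad_apply, ip, inner_smul_left, inner_smul_right, sum_inner, inner_sum, hm]
    congr 1
    refine Finset.sum_congr rfl fun a _ => ?_
    have h1 := R.adj (-m) a (R.F m a u) v
    have h2 := R.adj m a u (R.F m a v)
    rw [neg_neg] at h1
    exact h1.trans h2
  have h := locSum_adjoint R.quad_support_finite R.quad_support_finite (Equiv.refl ℤ)
    (fun i u v => hq i.natAbs u v) u v
  have hd : (starRingEnd ℂ) ((d : ℂ) / 8) = (d : ℂ) / 8 := by
    rw [map_div₀, Complex.conj_natCast, Complex.conj_ofNat]
  rw [L0_eq, LinearMap.add_apply, LinearMap.add_apply]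
  simp only [ip, LinearMap.smul_apply, Module.End.one_apply, inner_add_left, inner_add_right,
    inner_smul_left, inner_smul_right, hd] at h ⊢
  rw [h]

theorem quad_F (m : ℕ) (n : ℤ) (b : Fin d ⊕ Fin d) (v : R.V) : R.quad m (R.F n b v) =
    R.F n b (R.quad m v) + if m = n.natAbs then (-(n : ℂ) / 2) • R.F n b v else 0 := by
  have h1 : ∀ a, R.F (-m) a (R.F m a (R.F n b v)) = R.F n b (R.F (-m) a (R.F m a v)) +
      ((if (m : ℤ) + n = 0 ∧ a = b then R.F n b v else 0) -
        if -(m : ℤ) + n = 0 ∧ a = b then R.F n b v else 0) := by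
    intro a
    rw [R.F_F m n, map_sub, R.F_F (-m) n]
    have h2 : R.F (-m) a (if (m : ℤ) + n = 0 ∧ a = b then v else 0) =
        if (m : ℤ) + n = 0 ∧ a = b then R.F n b v else 0 := by
      split_ifs with h
      · rw [h.2, show -(m : ℤ) = n by omega]
      · exact map_zero _
    have h3 : (if -(m : ℤ) + n = 0 ∧ a = b then R.F m a v else 0) =
        if -(m : ℤ) + n = 0 ∧ a = b then R.F n b v else 0 := by
      split_ifs with h
      · rw [h.2, show (m : ℤ) = n by omega]
      · rfl
    rw [h2, h3]
    abel
  rw [quad_apply, quad_apply, map_smul, map_sum]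
  simp only [h1]
  rw [Finset.sum_add_distrib, smul_add, Finset.sum_sub_distrib]
  congr 1
  simp only [ite_and, Finset.sum_ite_irrel, Finset.sum_ite_eq', Finset.mem_univ, if_true,
    Finset.sum_const_zero]
  rcases Nat.eq_zero_or_pos m with rfl | hm
  · have : (if 0 = n.natAbs then (-(n : ℂ) / 2) • R.F n b v else 0) = 0 := by
      split_ifs with h
      · rw [show n = 0 by omega]
        simp
      · rfl
    rw [this]
    simp
  · by_cases h : m = n.natAbs
    · rw [if_pos h]
      rcases le_or_gt n 0 with hn | hn
      · rw [if_pos (by omega), if_neg (by omega), sub_zero, show n = -(m : ℤ) by omega]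
        congr 1
        push_cast
        ring
      · rw [if_neg (by omega), if_pos (by omega), zero_sub, show n = (m : ℤ) by omega, smul_neg,
          ← neg_smul]
        congr 1
        push_cast
        ring
    · rw [if_neg h, if_neg (by omega), if_neg (by omega), sub_zero, smul_zero]

/-- The commutation relation `[L₀, Fᵇₙ] = -n Fᵇₙ`. -/
theorem hasMode_F (n : ℤ) (b : Fin d ⊕ Fin d) : HasMode R.L0 (R.F n b) n := by
  intro v
  set g : ℕ → R.V := fun m => if m = n.natAbs then (-(n : ℂ) / 2) • R.F n b v else 0 with hg
  have hgs : (Function.support fun m : ℤ => g m.natAbs).Finite := by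
    refine (Set.finite_Icc (-(n.natAbs : ℤ)) n.natAbs).subset fun m hm => ?_
    by_contra h
    refine hm (if_neg ?_)
    rw [Set.mem_Icc] at h
    omega
  have h1 : locSum (fun m : ℤ => R.quad m.natAbs) (R.F n b v) =
      R.F n b (locSum (fun m : ℤ => R.quad m.natAbs) v) - (n : ℂ) • R.F n b v := by
    rw [locSum_apply R.quad_support_finite, locSum_apply R.quad_support_finite]
    simp only [quad_F]
    rw [finsum_add_distrib ((R.quad_support_finite v).subset fun m hm h0 => hm ?_) hgs,
      AffineRep.finsum_natAbs (f := g) (N := n.natAbs) fun m hm => if_neg (by omega),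
      sub_eq_add_neg]
    · congr 1
      · exact ((R.F n b).toAddMonoidHom.map_finsum (R.quad_support_finite v)).symm
      · rcases Nat.eq_zero_or_pos n.natAbs with h | h
        · have hn : n = 0 := by omega
          subst hn
          simp [hg]
        · rw [Finset.sum_eq_single (n.natAbs - 1)]
          · rw [hg]
            dsimp only
            rw [if_neg (by omega), if_pos (by omega)]
            module
          · intro m _ hm
            exact if_neg (by omega)
          · intro hm
            exact absurd (Finset.mem_range.2 (by omega)) hm
    · change R.quad m.natAbs v = 0 at h0
      simp only [h0, map_zero]
  rw [L0_eq, LinearMap.add_apply, LinearMap.add_apply, h1]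
  simp only [LinearMap.smul_apply, Module.End.one_apply, map_add, map_smul]
  abel

/-- The span of the eigenvectors of the conformal Hamiltonian is invariant under the fermionic modes
and contains the vacuum. -/
theorem isDiagonalizable_L0 : IsDiagonalizable R.L0 := by
  set S := Submodule.span ℂ {x | ∃ h : ℝ, R.L0 x = (h : ℂ) • x} with hS
  refine (R.irreducible S fun n a v hv => ?_).resolve_left fun hbot => ?_
  · rw [hS] at hv
    induction hv using Submodule.span_induction with
    | mem v hv =>
      obtain ⟨h, hv⟩ := hv
      exact Submodule.subset_span ⟨_, (R.hasMode_F n a).eigenvector hv⟩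
    | zero => simp
    | add x y _ _ hx hy =>
      rw [map_add]
      exact S.add_mem hx hy
    | smul c x _ hx =>
      rw [map_smul]
      exact S.smul_mem _ hx
  · obtain ⟨v, hv0, hv⟩ := R.vacuum
    have h1 : R.L0 v = ((d / 8 : ℝ) : ℂ) • v := by
      have h2 : ∀ m : ℤ, R.quad m.natAbs v = 0 := by
        intro m
        rw [quad_apply]
        rcases Nat.eq_zero_or_pos m.natAbs with h | h
        · rw [h]
          simp
        · simp only [hv m.natAbs (by exact_mod_cast h), map_zero, Finset.sum_const_zero, smul_zero]
      rw [L0_eq, LinearMap.add_apply, locSum_apply R.quad_support_finite]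
      simp only [h2, finsum_zero, zero_add, LinearMap.smul_apply, Module.End.one_apply]
      push_cast
      rfl
    have : v ∈ S := Submodule.subset_span ⟨_, h1⟩
    rw [hbot] at this
    exact hv0 this

end RamondRep

theorem AffineRep.isDiagonalizable_L0 {g : Type*} [LieRing g] [LieAlgebra ℝ g] {hv ℓ d : ℕ}
    (π : AffineRep.{u} g hv ℓ) {e : Module.Basis (Fin d) ℝ g}
    (he : ∀ a b, normForm hv (e a) (e b) = if a = b then 1 else 0) (hhv : hv ≠ 0) :
    IsDiagonalizable (π.L0 e) := by
  obtain ⟨ι, b, h, hb, hspan, -⟩ := π.exists_energy_basis he hhv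
  rw [IsDiagonalizable, eq_top_iff, ← hspan]
  refine Submodule.span_mono ?_
  rintro _ ⟨i, rfl⟩
  exact ⟨h i, hb i⟩

/-! ### Structure constants -/

section StructConst

variable {g : Type*} [LieRing g] [LieAlgebra ℝ g] {hv d : ℕ} {e : Module.Basis (Fin d) ℝ g}
  (he : ∀ a b, normForm hv (e a) (e b) = if a = b then 1 else 0)
include he

/-- The structure constants with respect to an orthonormal basis are antisymmetric, also in the last
two indices. -/
theorem structConst_swap (a b c : Fin d ⊕ Fin d) : structConst e a b c = -structConst e a c b := by
  rcases a with a | a <;> rcases b with b | b <;> rcases c with c | c <;>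
    simp only [structConst, neg_zero]
  all_goals
    rw [repr_eq_normForm he, repr_eq_normForm he, normForm_lie_left, normForm_comm]

theorem structConst_right_self (a b : Fin d ⊕ Fin d) : structConst e a b b = 0 := by
  have := structConst_swap he a b b
  linarith

theorem structConst_left_self (a c : Fin d ⊕ Fin d) : structConst e a a c = 0 := by
  rcases a with a | a <;> rcases c with c | c <;> simp [structConst]

theorem structConst_outer_self (a b : Fin d ⊕ Fin d) : structConst e a b a = 0 := by
  rw [structConst_swap he, structConst_left_self he, neg_zero]

end StructConst

/-! ### The tensor product of the representations -/

section Hat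

variable {g : Type*} [LieRing g] [LieAlgebra ℝ g] {hv ℓ d : ℕ}
  {e : Module.Basis (Fin d) ℝ g} {π π₀ : AffineRep.{u} g hv ℓ} {R : RamondRep.{v} d}

theorem hatTmul_add_left (u u' : π.V) (v : π₀.V) (w : R.V) :
    hatTmul (u + u') v w = hatTmul u v w + hatTmul u' v w := TensorProduct.add_tmul _ _ _

theorem hatTmul_smul_left (c : ℂ) (u : π.V) (v : π₀.V) (w : R.V) :
    hatTmul (c • u) v w = c • hatTmul u v w := (TensorProduct.smul_tmul' c u _).symm

theorem hatTmul_add_mid (u : π.V) (v v' : π₀.V) (w : R.V) :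
    hatTmul u (v + v') w = hatTmul u v w + hatTmul u v' w :=
  (congrArg (fun z => u ⊗ₜ[ℂ] z) (TensorProduct.add_tmul v v' w)).trans
    (TensorProduct.tmul_add _ _ _)

theorem hatTmul_smul_mid (c : ℂ) (u : π.V) (v : π₀.V) (w : R.V) :
    hatTmul u (c • v) w = c • hatTmul u v w :=
  (congrArg (fun z => u ⊗ₜ[ℂ] z) (TensorProduct.smul_tmul' c v w).symm).trans
    (TensorProduct.tmul_smul _ _ _)

theorem hatTmul_add_right (u : π.V) (v : π₀.V) (w w' : R.V) :
    hatTmul u v (w + w') = hatTmul u v w + hatTmul u v w' :=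
  (congrArg (fun z => u ⊗ₜ[ℂ] z) (TensorProduct.tmul_add v w w')).trans
    (TensorProduct.tmul_add _ _ _)

theorem hatTmul_smul_right (c : ℂ) (u : π.V) (v : π₀.V) (w : R.V) :
    hatTmul u v (c • w) = c • hatTmul u v w :=
  (congrArg (fun z => u ⊗ₜ[ℂ] z) (TensorProduct.tmul_smul c v w)).trans
    (TensorProduct.tmul_smul _ _ _)

theorem hatTmul_zero_left (v : π₀.V) (w : R.V) : hatTmul (0 : π.V) v w = 0 :=
  TensorProduct.zero_tmul _ _

theorem hatTmul_zero_mid (u : π.V) (w : R.V) : hatTmul u (0 : π₀.V) w = 0 :=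
  (congrArg (fun z => u ⊗ₜ[ℂ] z) (TensorProduct.zero_tmul _ w)).trans (TensorProduct.tmul_zero _ _)

theorem hatTmul_zero_right (u : π.V) (v : π₀.V) : hatTmul u v (0 : R.V) = 0 :=
  (congrArg (fun z => u ⊗ₜ[ℂ] z) (TensorProduct.tmul_zero _ v)).trans (TensorProduct.tmul_zero _ _)

theorem HatV.ext_hatTmul {A B : Module.End ℂ (HatV π π₀ R)}
    (h : ∀ u v w, A (hatTmul u v w) = B (hatTmul u v w)) : A = B := by
  ext x
  refine HatV.induction_on (p := fun x => A x = B x) x ?_ h fun x y hx hy => ?_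
  · rw [map_zero, map_zero]
  · rw [map_add, map_add, hx, hy]

theorem hatMap_adj {A A' : Module.End ℂ π.V} {B B' : Module.End ℂ π₀.V} {C C' : Module.End ℂ R.V}
    (hA : ∀ u v, ip (A u) v = ip u (A' v)) (hB : ∀ u v, ip (B u) v = ip u (B' v))
    (hC : ∀ u v, ip (C u) v = ip u (C' v)) (x y : HatV π π₀ R) :
    ip (hatMap π π₀ R A B C x) y = ip x (hatMap π π₀ R A' B' C' y) := by
  refine HatV.induction_on
    (p := fun x => ip (hatMap π π₀ R A B C x) y = ip x (hatMap π π₀ R A' B' C' y)) x ?_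
    (fun u v w => ?_) fun x y hx hy => ?_
  · simp only [ip, map_zero, inner_zero_left]
  · refine HatV.induction_on (p := fun y => ip (hatMap π π₀ R A B C (hatTmul u v w)) y =
      ip (hatTmul u v w) (hatMap π π₀ R A' B' C' y)) y ?_ (fun u' v' w' => ?_) fun x y hx hy => ?_
    · simp only [ip, map_zero, inner_zero_right]
    · rw [hatMap_hatTmul, hatMap_hatTmul, ip_hatTmul, ip_hatTmul, hA, hB, hC]
    · simp only [ip, map_add, inner_add_right] at hx hy ⊢
      rw [hx, hy]
  · simp only [ip, map_add, inner_add_left] at hx hy ⊢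
    rw [hx, hy]

variable (e π π₀ R) in
/-- The conformal Hamiltonian on the tensor product. -/
noncomputable def hatL0 : Module.End ℂ (HatV π π₀ R) :=
  hatMap π π₀ R (π.L0 e) 1 1 + hatMap π π₀ R 1 (π₀.L0 e) 1 + hatMap π π₀ R 1 1 R.L0

theorem hatL0_hatTmul (u : π.V) (v : π₀.V) (w : R.V) : hatL0 e π π₀ R (hatTmul u v w) =
    hatTmul (π.L0 e u) v w + hatTmul u (π₀.L0 e v) w + hatTmul u v (R.L0 w) := rfl

theorem hatL0_symm (x y : HatV π π₀ R) :
    ip (hatL0 e π π₀ R x) y = ip x (hatL0 e π π₀ R y) := by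
  have h1 := hatMap_adj (R := R) (π.L0_symm (e := e)) (B := (1 : Module.End ℂ π₀.V)) (B' := 1)
    (fun _ _ => rfl) (C := 1) (C' := 1) (fun _ _ => rfl) x y
  have h2 := hatMap_adj (R := R) (A := (1 : Module.End ℂ π.V)) (A' := 1) (fun _ _ => rfl)
    (π₀.L0_symm (e := e)) (C := 1) (C' := 1) (fun _ _ => rfl) x y
  have h3 := hatMap_adj (A := (1 : Module.End ℂ π.V)) (A' := 1) (fun _ _ => rfl)
    (B := (1 : Module.End ℂ π₀.V)) (B' := 1) (fun _ _ => rfl) R.L0_symm x y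
  simp only [hatL0, ip, LinearMap.add_apply, inner_add_left, inner_add_right] at h1 h2 h3 ⊢
  rw [h1, h2, h3]

theorem hatL0_eigenvector {u : π.V} {v : π₀.V} {w : R.V} {h₁ h₂ h₃ : ℝ}
    (hu : π.L0 e u = (h₁ : ℂ) • u) (hv' : π₀.L0 e v = (h₂ : ℂ) • v)
    (hw : R.L0 w = (h₃ : ℂ) • w) : hatL0 e π π₀ R (hatTmul u v w) =
      ((h₁ + h₂ + h₃ : ℝ) : ℂ) • hatTmul u v w := by
  rw [hatL0_hatTmul, hu, hv', hw, hatTmul_smul_left, hatTmul_smul_mid, hatTmul_smul_right,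
    ← add_smul, ← add_smul]
  push_cast
  rfl

theorem isDiagonalizable_hatL0 (hπ : IsDiagonalizable (π.L0 e)) (hπ₀ : IsDiagonalizable (π₀.L0 e)) :
    IsDiagonalizable (hatL0 e π π₀ R) := by
  set S := Submodule.span ℂ {x | ∃ h : ℝ, hatL0 e π π₀ R x = (h : ℂ) • x} with hS
  have ht : ∀ u v w, hatTmul u v w ∈ S := by
    refine hπ.induction (fun v w => ?_) (fun u u' hu hu' v w => ?_) (fun c u hu v w => ?_)
      fun h₁ u hu => hπ₀.induction (fun w => ?_) (fun v v' hv hv' w => ?_) (fun c v hv w => ?_)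
      fun h₂ v hv => R.isDiagonalizable_L0.induction ?_ (fun w w' hw hw' => ?_) (fun c w hw => ?_)
      fun h₃ w hw => Submodule.subset_span ⟨_, hatL0_eigenvector hu hv hw⟩
    · rw [hatTmul_zero_left]
      exact S.zero_mem
    · rw [hatTmul_add_left]
      exact S.add_mem (hu v w) (hu' v w)
    · rw [hatTmul_smul_left]
      exact S.smul_mem _ (hu v w)
    · rw [hatTmul_zero_mid]
      exact S.zero_mem
    · rw [hatTmul_add_mid]
      exact S.add_mem (hv w) (hv' w)
    · rw [hatTmul_smul_mid]
      exact S.smul_mem _ (hv w)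
    · rw [hatTmul_zero_right]
      exact S.zero_mem
    · rw [hatTmul_add_right]
      exact S.add_mem hw hw'
    · rw [hatTmul_smul_right]
      exact S.smul_mem _ hw
  refine eq_top_iff.2 fun x _ => ?_
  exact HatV.induction_on x S.zero_mem ht fun x y hx hy => S.add_mem hx hy

theorem hasMode_hatJ (he : ∀ a b, normForm hv (e a) (e b) = if a = b then 1 else 0) (hhv : hv ≠ 0)
    (m : ℤ) (a : Fin d ⊕ Fin d) : HasMode (hatL0 e π π₀ R) (hatJ e π π₀ R m a) m := by
  intro x
  have h : hatL0 e π π₀ R * hatJ e π π₀ R m a =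
      hatJ e π π₀ R m a * hatL0 e π π₀ R - (m : ℂ) • hatJ e π π₀ R m a := by
    refine HatV.ext_hatTmul fun u v w => ?_
    simp only [Module.End.mul_apply, LinearMap.sub_apply, LinearMap.smul_apply, hatL0_hatTmul,
      map_add]
    rcases a with a | a
    · simp only [hatJ, hatMap_hatTmul, hatL0_hatTmul, Module.End.one_apply, π.L0_J he hhv]
      rw [sub_eq_add_neg, hatTmul_add_left, ← neg_smul, hatTmul_smul_left]
      module
    · simp only [hatJ, hatMap_hatTmul, hatL0_hatTmul, Module.End.one_apply, π₀.L0_J he hhv]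
      rw [sub_eq_add_neg, hatTmul_add_mid, ← neg_smul, hatTmul_smul_mid]
      module
  exact LinearMap.congr_fun h x

theorem hasMode_hatF (m : ℤ) (a : Fin d ⊕ Fin d) :
    HasMode (hatL0 e π π₀ R) (hatF π π₀ R m a) m := by
  intro x
  have h : hatL0 e π π₀ R * hatF π π₀ R m a =
      hatF π π₀ R m a * hatL0 e π π₀ R - (m : ℂ) • hatF π π₀ R m a := by
    refine HatV.ext_hatTmul fun u v w => ?_
    simp only [Module.End.mul_apply, LinearMap.sub_apply, LinearMap.smul_apply, hatL0_hatTmul,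
      map_add]
    simp only [hatF, hatMap_hatTmul, hatL0_hatTmul, Module.End.one_apply, R.hasMode_F m a w]
    rw [sub_eq_add_neg, hatTmul_add_right, ← neg_smul, hatTmul_smul_right]
    module
  exact LinearMap.congr_fun h x

theorem hatF_adj (m : ℤ) (a : Fin d ⊕ Fin d) (x y : HatV π π₀ R) :
    ip (hatF π π₀ R m a x) y = ip x (hatF π π₀ R (-m) a y) :=
  hatMap_adj (fun _ _ => rfl) (fun _ _ => rfl) (R.adj m a) x y

theorem hatJ_adj (m : ℤ) (a : Fin d ⊕ Fin d) (x y : HatV π π₀ R) :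
    ip (hatJ e π π₀ R m a x) y = ip x (hatJ e π π₀ R (-m) a y) := by
  rcases a with a | a
  · exact hatMap_adj (π.adj m (e a)) (fun _ _ => rfl) (fun _ _ => rfl) x y
  · exact hatMap_adj (fun _ _ => rfl) (π₀.adj m (e a)) (fun _ _ => rfl) x y

theorem hatF_hatF (m n : ℤ) (a b : Fin d ⊕ Fin d) (x : HatV π π₀ R) :
    hatF π π₀ R m a (hatF π π₀ R n b x) =
      (if m + n = 0 ∧ a = b then x else 0) - hatF π π₀ R n b (hatF π π₀ R m a x) := by
  refine HatV.induction_on (p := fun x => hatF π π₀ R m a (hatF π π₀ R n b x) =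
      (if m + n = 0 ∧ a = b then x else 0) - hatF π π₀ R n b (hatF π π₀ R m a x)) x ?_
    (fun u v w => ?_) fun x y hx hy => ?_
  · simp
  · simp only [hatF, hatMap_hatTmul, Module.End.one_apply]
    rw [R.F_F, sub_eq_add_neg, hatTmul_add_right, ← neg_one_smul ℂ (R.F n b _), hatTmul_smul_right,
      neg_one_smul, ← sub_eq_add_neg]
    congr 1
    split_ifs
    · rfl
    · exact hatTmul_zero_right _ _
  · simp only [map_add, hx, hy]
    split_ifs
    · abel
    · abel

theorem hatF_hatF_of_ne (m n : ℤ) {a b : Fin d ⊕ Fin d} (hab : a ≠ b) (x : HatV π π₀ R) :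
    hatF π π₀ R m a (hatF π π₀ R n b x) = -hatF π π₀ R n b (hatF π π₀ R m a x) := by
  rw [hatF_hatF, if_neg (fun h => hab h.2), zero_sub]

theorem hatJ_hatF (m n : ℤ) (a b : Fin d ⊕ Fin d) (x : HatV π π₀ R) :
    hatJ e π π₀ R m a (hatF π π₀ R n b x) = hatF π π₀ R n b (hatJ e π π₀ R m a x) := by
  refine HatV.induction_on (p := fun x => hatJ e π π₀ R m a (hatF π π₀ R n b x) =
    hatF π π₀ R n b (hatJ e π π₀ R m a x)) x (by simp only [map_zero])
    (fun u v w => ?_) fun x y hx hy => ?_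
  · rcases a with a | a <;> rfl
  · simp only [map_add, hx, hy]

theorem exists_hatF_eq_zero (x : HatV π π₀ R) :
    ∃ M : ℕ, ∀ m : ℤ, M ≤ m → ∀ a, hatF π π₀ R m a x = 0 := by
  refine HatV.induction_on
    (p := fun x => ∃ M : ℕ, ∀ m : ℤ, M ≤ m → ∀ a, hatF π π₀ R m a x = 0)
    x ⟨0, fun m _ a => map_zero _⟩ (fun u v w => ?_) ?_
  · obtain ⟨M, hM⟩ := R.exists_F_eq_zero w
    refine ⟨M, fun m hm a => ?_⟩
    rw [hatF, hatMap_hatTmul, hM m hm, hatTmul_zero_right]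
  · rintro x y ⟨M, hM⟩ ⟨N, hN⟩
    refine ⟨max M N, fun m hm a => ?_⟩
    rw [map_add, hM m (by omega), hN m (by omega), add_zero]

theorem exists_hatJ_eq_zero (x : HatV π π₀ R) :
    ∃ M : ℕ, ∀ m : ℤ, M ≤ m → ∀ a, hatJ e π π₀ R m a x = 0 := by
  refine HatV.induction_on
    (p := fun x => ∃ M : ℕ, ∀ m : ℤ, M ≤ m → ∀ a, hatJ e π π₀ R m a x = 0)
    x ⟨0, fun m _ a => map_zero _⟩ (fun u v w => ?_) ?_
  · obtain ⟨M, hM⟩ := π.exists_J_eq_zero u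
    obtain ⟨N, hN⟩ := π₀.exists_J_eq_zero v
    refine ⟨max M N, fun m hm a => ?_⟩
    rcases a with a | a
    · rw [hatJ, hatMap_hatTmul, hM m (by omega), hatTmul_zero_left]
    · rw [hatJ, hatMap_hatTmul, hN m (by omega), hatTmul_zero_mid]
  · rintro x y ⟨M, hM⟩ ⟨N, hN⟩
    refine ⟨max M N, fun m hm a => ?_⟩
    rw [map_add, hM m (by omega), hN m (by omega), add_zero]

/-! ### The fermionic currents and the supercurrent -/

variable (e π π₀ R) in
/-- The summand of the fermionic current `J'ᵃₘ` with index `k`. -/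
noncomputable def fermiTerm (m : ℤ) (a : Fin d ⊕ Fin d) (k : ℤ) : Module.End ℂ (HatV π π₀ R) :=
  ∑ b, ∑ c, (structConst e a b c : ℂ) • (hatF π π₀ R k b * hatF π π₀ R (m - k) c)

theorem hatJ'_eq (m : ℤ) (a : Fin d ⊕ Fin d) : hatJ' e π π₀ R m a =
    (-(Complex.I / 2)) • locSum (fermiTerm e π π₀ R m a) := rfl

theorem fermiTerm_apply (m : ℤ) (a : Fin d ⊕ Fin d) (k : ℤ) (x : HatV π π₀ R) :
    fermiTerm e π π₀ R m a k x = ∑ b, ∑ c, (structConst e a b c : ℂ) •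
      hatF π π₀ R k b (hatF π π₀ R (m - k) c x) := by
  simp only [fermiTerm, LinearMap.sum_apply, LinearMap.smul_apply, Module.End.mul_apply]

section

variable (he : ∀ a b, normForm hv (e a) (e b) = if a = b then 1 else 0)
include he

/-- The fermions in `J'ᵃₘ` anticommute because `f_{abb} = 0`, so either of them may be moved to the
right. -/
theorem fermiTerm_eq_zero {x : HatV π π₀ R} {M : ℕ}
    (hM : ∀ m : ℤ, M ≤ m → ∀ a, hatF π π₀ R m a x = 0) (m : ℤ) (a : Fin d ⊕ Fin d) {k : ℤ}
    (hk : M ≤ k ∨ M ≤ m - k) : fermiTerm e π π₀ R m a k x = 0 := by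
  rw [fermiTerm_apply]
  refine Finset.sum_eq_zero fun b _ => Finset.sum_eq_zero fun c _ => ?_
  rcases eq_or_ne b c with rfl | hbc
  · rw [structConst_right_self he, Complex.ofReal_zero, zero_smul]
  rcases hk with hk | hk
  · rw [hatF_hatF_of_ne _ _ hbc, hM k hk, map_zero, neg_zero, smul_zero]
  · rw [hM _ hk, map_zero, smul_zero]

theorem fermiTerm_support_finite (m : ℤ) (a : Fin d ⊕ Fin d) (x : HatV π π₀ R) :
    (Function.support fun k => fermiTerm e π π₀ R m a k x).Finite := by
  obtain ⟨M, hM⟩ := exists_hatF_eq_zero x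
  refine (Set.finite_Icc (m - M) M).subset fun k hk => ?_
  by_contra h
  rw [Set.mem_Icc] at h
  exact hk (fermiTerm_eq_zero he hM m a (by omega))

theorem exists_hatJ'_eq_zero (x : HatV π π₀ R) :
    ∃ M : ℕ, ∀ m : ℤ, M ≤ m → ∀ a, hatJ' e π π₀ R m a x = 0 := by
  obtain ⟨M, hM⟩ := exists_hatF_eq_zero x
  refine ⟨2 * M, fun m hm a => ?_⟩
  rw [hatJ'_eq, LinearMap.smul_apply, locSum_apply (fermiTerm_support_finite he m a)]
  have h : ∀ k, fermiTerm e π π₀ R m a k x = 0 := fun k =>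
    fermiTerm_eq_zero he hM m a (by push_cast at hm; omega)
  simp only [h, finsum_zero, smul_zero]

theorem hasMode_hatJ' (m : ℤ) (a : Fin d ⊕ Fin d) :
    HasMode (hatL0 e π π₀ R) (hatJ' e π π₀ R m a) m := by
  refine (HasMode.locSum (fermiTerm_support_finite he m a) fun k => ?_).smul _
  refine HasMode.sum _ fun b _ => HasMode.sum _ fun c _ => HasMode.smul _ ?_
  have := (hasMode_hatF (e := e) (π := π) (π₀ := π₀) (R := R) k b).mul
    (hasMode_hatF (e := e) (m - k) c)
  rwa [add_sub_cancel] at this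

/-- The sum is reindexed by `k ↦ k - m`, and the reversal of the order of the fermions is
compensated by the antisymmetry of the structure constants. -/
theorem hatJ'_adj (m : ℤ) (a : Fin d ⊕ Fin d) (x y : HatV π π₀ R) :
    ip (hatJ' e π π₀ R m a x) y = ip x (hatJ' e π π₀ R (-m) a y) := by
  have h := locSum_adjoint (T := fermiTerm e π π₀ R m a)
    (S := fun k => -fermiTerm e π π₀ R (-m) a k)
    (fermiTerm_support_finite he m a) (fun v => ?_) (Equiv.subRight m) (fun k u v => ?_) x y
  · have h1 : locSum (fun k => -fermiTerm e π π₀ R (-m) a k) y =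
        -locSum (fermiTerm e π π₀ R (-m) a) y := by
      rw [locSum_apply (fermiTerm_support_finite he (-m) a), locSum_apply]
      · simp only [LinearMap.neg_apply]
        exact finsum_neg_distrib _
      · intro v
        simpa only [LinearMap.neg_apply, Function.support_fun_neg] using
          fermiTerm_support_finite he (-m) a v
    rw [h1] at h
    rw [hatJ'_eq, hatJ'_eq, LinearMap.smul_apply, LinearMap.smul_apply]
    simp only [ip] at h ⊢
    rw [inner_smul_left, inner_smul_right, h, inner_neg_right]
    simp only [map_neg, map_div₀, Complex.conj_I, Complex.conj_ofNat]
    ring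
  · simpa only [LinearMap.neg_apply, Function.support_fun_neg] using
      fermiTerm_support_finite he (-m) a v
  · rw [LinearMap.neg_apply, fermiTerm_apply, fermiTerm_apply]
    simp only [ip, sum_inner, inner_sum, inner_neg_right, inner_smul_left, inner_smul_right]
    rw [Finset.sum_comm, ← Finset.sum_neg_distrib]
    refine Finset.sum_congr rfl fun b _ => ?_
    rw [← Finset.sum_neg_distrib]
    refine Finset.sum_congr rfl fun c _ => ?_
    have h1 := hatF_adj k c (hatF π π₀ R (m - k) b u) v
    have h2 := hatF_adj (m - k) b u (hatF π π₀ R (-k) c v)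
    simp only [ip] at h1 h2
    rw [Complex.conj_ofReal, h1, h2, structConst_swap he a c b, Equiv.subRight_apply,
      show -m - (k - m) = -k by ring, neg_sub]
    push_cast
    ring

/-- As `f_{abc} = 0` for `a = b` and for `a = c`, no anticommutator contributes when the fermion has
the same index `a` as the current. This makes the supercurrent symmetric. -/
theorem hatJ'_hatF (m n : ℤ) (a : Fin d ⊕ Fin d) (x : HatV π π₀ R) :
    hatJ' e π π₀ R m a (hatF π π₀ R n a x) = hatF π π₀ R n a (hatJ' e π π₀ R m a x) := by
  rw [hatJ'_eq, LinearMap.smul_apply, LinearMap.smul_apply, map_smul,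
    locSum_apply (fermiTerm_support_finite he m a), locSum_apply (fermiTerm_support_finite he m a)]
  congr 1
  refine Eq.trans (finsum_congr fun k => ?_) ((hatF π π₀ R n a).toAddMonoidHom.map_finsum
    (fermiTerm_support_finite he m a x)).symm
  change _ = hatF π π₀ R n a (fermiTerm e π π₀ R m a k x)
  rw [fermiTerm_apply, fermiTerm_apply, map_sum]
  refine Finset.sum_congr rfl fun b _ => ?_
  rw [map_sum]
  refine Finset.sum_congr rfl fun c _ => ?_
  rw [map_smul]
  rcases eq_or_ne b a with rfl | hb
  · rw [structConst_left_self he, Complex.ofReal_zero, zero_smul, zero_smul]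
  rcases eq_or_ne c a with rfl | hc
  · rw [structConst_outer_self he, Complex.ofReal_zero, zero_smul, zero_smul]
  rw [hatF_hatF_of_ne _ _ hc, map_neg, hatF_hatF_of_ne _ _ hb, neg_neg]

variable (e π π₀ R) in
omit he in
/-- The summand of the supercurrent zero mode with index `m`. -/
noncomputable def superTerm (m : ℤ) : Module.End ℂ (HatV π π₀ R) :=
  ∑ a, (hatJ e π π₀ R m a + (1 / 3 : ℂ) • hatJ' e π π₀ R m a) * hatF π π₀ R (-m) a

omit he in
theorem superTerm_apply (m : ℤ) (x : HatV π π₀ R) : superTerm e π π₀ R m x =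
    ∑ a, (hatJ e π π₀ R m a (hatF π π₀ R (-m) a x) +
      (1 / 3 : ℂ) • hatJ' e π π₀ R m a (hatF π π₀ R (-m) a x)) := by
  simp only [superTerm, LinearMap.sum_apply, LinearMap.add_apply, LinearMap.smul_apply,
    Module.End.mul_apply]

theorem superTerm_support_finite (x : HatV π π₀ R) :
    (Function.support fun m => superTerm e π π₀ R m x).Finite := by
  obtain ⟨M, hM⟩ := exists_hatF_eq_zero x
  obtain ⟨N, hN⟩ := exists_hatJ_eq_zero (e := e) x
  obtain ⟨K, hK⟩ := exists_hatJ'_eq_zero he x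
  refine (Set.finite_Icc (-(M : ℤ)) (max N K)).subset fun m hm => ?_
  by_contra h
  rw [Set.mem_Icc] at h
  refine hm ?_
  change superTerm e π π₀ R m x = 0
  rw [superTerm_apply]
  refine Finset.sum_eq_zero fun a _ => ?_
  rcases le_or_gt (M : ℤ) (-m) with h1 | h1
  · rw [hM _ h1, map_zero, map_zero, smul_zero, add_zero]
  · rw [hatJ_hatF, hatJ'_hatF he, hN m (by omega), hK m (by omega), map_zero, smul_zero, add_zero]

theorem superG0_symm (x y : HatV π π₀ R) :
    ip (superG0 e π π₀ R x) y = ip x (superG0 e π π₀ R y) := by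
  have h := locSum_adjoint (superTerm_support_finite he (π := π) (π₀ := π₀) (R := R))
    (superTerm_support_finite he) (Equiv.neg ℤ) (fun m u v => ?_) x y
  · have h1 : superG0 e π π₀ R =
        ((1 / √((ℓ : ℝ) + hv) : ℝ) : ℂ) • locSum (superTerm e π π₀ R) := rfl
    rw [h1, LinearMap.smul_apply, LinearMap.smul_apply]
    simp only [ip] at h ⊢
    rw [inner_smul_left, inner_smul_right, h, Complex.conj_ofReal]
  · rw [superTerm_apply, superTerm_apply]
    simp only [ip, sum_inner, inner_sum, inner_add_left, inner_add_right, inner_smul_left,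
      inner_smul_right, Equiv.neg_apply, neg_neg]
    refine Finset.sum_congr rfl fun a _ => ?_
    have h1 := hatJ_adj (e := e) m a (hatF π π₀ R (-m) a u) v
    have h2 := hatJ'_adj he m a (hatF π π₀ R (-m) a u) v
    have h3 := hatF_adj (-m) a u (hatJ e π π₀ R (-m) a v)
    have h4 := hatF_adj (-m) a u (hatJ' e π π₀ R (-m) a v)
    simp only [ip, neg_neg] at h1 h2 h3 h4
    rw [h1, h2, h3, h4, hatJ_hatF, hatJ'_hatF he]
    simp only [map_div₀, map_one, Complex.conj_ofNat]

/-- All terms of the supercurrent zero mode have mode `0`, so it commutes with the conformal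
Hamiltonian. -/
theorem hatL0_superG0 (hhv : hv ≠ 0) (x : HatV π π₀ R) :
    hatL0 e π π₀ R (superG0 e π π₀ R x) = superG0 e π π₀ R (hatL0 e π π₀ R x) := by
  have h : HasMode (hatL0 e π π₀ R) (superG0 e π π₀ R) 0 := by
    refine HasMode.smul _ (HasMode.locSum (superTerm_support_finite he) fun m =>
      HasMode.sum _ fun a _ => ?_)
    have h1 := ((hasMode_hatJ he hhv m a).add ((hasMode_hatJ' he m a).smul (1 / 3))).mul
      (hasMode_hatF (e := e) (π := π) (π₀ := π₀) (R := R) (-m) a)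
    rwa [add_neg_cancel] at h1
  have := h x
  rwa [Int.cast_zero, zero_smul, sub_zero] at this

end

end Hat

/-! ### Approximate identities of the compact differentiable algebra -/

section ApproxId

variable {H K : Type*} [NormedAddCommGroup H] [InnerProductSpace ℂ H] [CompleteSpace H]
  [NormedAddCommGroup K] [InnerProductSpace ℂ K] [CompleteSpace K]
  {B : Subalgebra ℂ (H →L[ℂ] H)} {P : B →ₙₐ[ℂ] (K →L[ℂ] K)} {D : DenseOp K}
  {hP : ∀ x, ‖P x‖ ≤ ‖x‖}

theorem DiffAlg.isCompactOperator_toOp (x : DiffAlg P D hP) : IsCompactOperator x.toOp :=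
  x.elt.2.1

theorem DiffAlg.isCompactOperator_deriv (x : DiffAlg P D hP) : IsCompactOperator x.deriv := by
  obtain ⟨-, y, hy, hc⟩ := x.elt.2
  rwa [DiffAlg.deriv_eq hy]

theorem DiffAlg.tendsto_of_tendsto_toOp_deriv {x : ℕ → DiffAlg P D hP} {y : DiffAlg P D hP}
    (h : Filter.Tendsto (fun n => (x n).toOp) Filter.atTop (nhds y.toOp))
    (h' : Filter.Tendsto (fun n => (x n).deriv) Filter.atTop (nhds y.deriv)) :
    Filter.Tendsto x Filter.atTop (nhds y) := by
  rw [tendsto_iff_norm_sub_tendsto_zero] at h h' ⊢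
  have h2 := h.add h'
  rw [add_zero] at h2
  refine h2.congr fun n => ?_
  have h1 : (x n - y).deriv = (x n).deriv - y.deriv := by
    rw [sub_eq_add_neg, ← neg_one_smul ℂ, DiffAlg.deriv_add, DiffAlg.deriv_smul, neg_one_smul,
      sub_eq_add_neg]
  rw [DiffAlg.norm_def, h1]
  rfl

/-- Multiplication by `p n` acts on the derivative as multiplication by `E n` if `E n` commutes
with `D` and acts as `p n` on the image of `P`; for compact operators strong convergence of the
`p n` and the `E n` then suffices. -/
theorem DiffAlg.tendsto_mul_left {p : ℕ → DiffAlg P D hP} {E : ℕ → K →L[ℂ] K}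
    (hp : ∀ n, ‖(p n).toOp‖ ≤ 1)
    (hps : ∀ ξ, Filter.Tendsto (fun n => (p n).toOp ξ) Filter.atTop (nhds ξ))
    (hE : ∀ n, ‖E n‖ ≤ 1)
    (hEs : ∀ ξ, Filter.Tendsto (fun n => E n ξ) Filter.atTop (nhds ξ))
    (hD : ∀ n, IsDerivation D.op (E n) 0)
    (hEp : ∀ n (x : DiffAlg P D hP), P (p n).elt * P x.elt = E n * P x.elt) (x : DiffAlg P D hP) :
    Filter.Tendsto (fun n => p n * x) Filter.atTop (nhds x) := by
  refine DiffAlg.tendsto_of_tendsto_toOp_deriv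
    (x.isCompactOperator_toOp.tendsto_mul_left hp hps) ?_
  refine (x.isCompactOperator_deriv.tendsto_mul_left hE hEs).congr fun n => ?_
  refine (DiffAlg.deriv_eq ?_).symm
  have h := (hD n).mul x.isDerivation
  rw [zero_mul, add_zero, ← hEp, ← map_mul] at h
  exact h

theorem DiffAlg.tendsto_mul_right {p : ℕ → DiffAlg P D hP} {E : ℕ → K →L[ℂ] K}
    (hp : ∀ n, ‖(p n).toOp‖ ≤ 1) (hpa : ∀ n, IsSelfAdjoint (p n).toOp)
    (hps : ∀ ξ, Filter.Tendsto (fun n => (p n).toOp ξ) Filter.atTop (nhds ξ))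
    (hE : ∀ n, ‖E n‖ ≤ 1) (hEa : ∀ n, IsSelfAdjoint (E n))
    (hEs : ∀ ξ, Filter.Tendsto (fun n => E n ξ) Filter.atTop (nhds ξ))
    (hD : ∀ n, IsDerivation D.op (E n) 0)
    (hEp : ∀ n (x : DiffAlg P D hP), P x.elt * P (p n).elt = P x.elt * E n) (x : DiffAlg P D hP) :
    Filter.Tendsto (fun n => x * p n) Filter.atTop (nhds x) := by
  refine DiffAlg.tendsto_of_tendsto_toOp_deriv
    (x.isCompactOperator_toOp.tendsto_mul_right hp hpa hps) ?_
  refine (x.isCompactOperator_deriv.tendsto_mul_right hE hEa hEs).congr fun n => ?_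
  refine (DiffAlg.deriv_eq ?_).symm
  have h := x.isDerivation.mul (hD n)
  rw [mul_zero, zero_add, ← hEp, ← map_mul] at h
  exact h

end ApproxId

/-! ### Stable unitality -/

section StablyUnital

variable {A : Type*} [NonUnitalNormedRing A] [NormedSpace ℂ A]

/-- The diagonal matrix with the first `n` diagonal entries equal to `a`. -/
def MInf.diag (n : ℕ) (a : A) : MInf A :=
  ⟨fun i j => if i = j ∧ i < n then a else 0, n, fun i j h => if_neg (by omega)⟩

theorem MInf.diag_mul_apply (n : ℕ) (a : A) (x : MInf A) (i j : ℕ) :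
    (MInf.diag n a * x).1 i j = if i < n then a * x.1 i j else 0 := by
  change ∑ᶠ k, (if i = k ∧ i < n then a else 0) * x.1 k j = _
  rw [finsum_eq_single _ i fun k hk => by rw [if_neg fun h => hk h.1.symm, zero_mul]]
  simp only [true_and, ite_mul, zero_mul]

theorem MInf.mul_diag_apply (n : ℕ) (a : A) (x : MInf A) (i j : ℕ) :
    (x * MInf.diag n a).1 i j = if j < n then x.1 i j * a else 0 := by
  change ∑ᶠ k, x.1 i k * (if k = j ∧ k < n then a else 0) = _
  rw [finsum_eq_single _ j fun k hk => by rw [if_neg fun h => hk h.1, mul_zero]]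
  simp only [true_and, mul_ite, mul_zero]

theorem IsMatrixNorm.nonneg {ν : MInf A → ℝ} (hν : IsMatrixNorm ν) (x : MInf A) : 0 ≤ ν x := by
  have h1 := hν.add_le x ((-1 : ℂ) • x)
  rw [hν.smul, norm_neg, norm_one, one_mul, neg_one_smul ℂ x, add_neg_cancel,
    (hν.eq_zero_iff 0).2 rfl] at h1
  linarith

theorem IsMatrixNorm.tendsto_zero {ν : MInf A → ℝ} (hν : IsMatrixNorm ν) {y : ℕ → MInf A} (r : ℕ)
    (hr : ∀ᶠ n in Filter.atTop, ∀ i j, r ≤ i ∨ r ≤ j → (y n).1 i j = 0)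
    (hy : ∀ i j, Filter.Tendsto (fun n => (y n).1 i j) Filter.atTop (nhds 0)) :
    Filter.Tendsto (fun n => ν (y n)) Filter.atTop (nhds 0) := by
  obtain ⟨C, hC⟩ := hν.equivalent r
  have h : Filter.Tendsto
      (fun n => C * ∑ i ∈ Finset.range r, ∑ j ∈ Finset.range r, ‖(y n).1 i j‖)
      Filter.atTop (nhds (C * ∑ i ∈ Finset.range r, ∑ j ∈ Finset.range r, 0)) :=
    (tendsto_finsetSum _ fun i _ => tendsto_finsetSum _ fun j _ => by
      simpa only [norm_zero] using (hy i j).norm).const_mul C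
  simp only [Finset.sum_const_zero, mul_zero] at h
  refine squeeze_zero' (Filter.Eventually.of_forall fun n => hν.nonneg _) ?_ h
  filter_upwards [hr] with n hn
  exact (hC (y n) hn).2

/-- If `p` is an approximate identity of idempotents of `A`, then the block-diagonal matrices
with `n` blocks `p n` form one of `M_∞(A)`. -/
theorem isStablyUnital_of_tendsto {p : ℕ → A} (hp : ∀ n, p n * p n = p n)
    (hl : ∀ x, Filter.Tendsto (fun n => p n * x) Filter.atTop (nhds x))
    (hr : ∀ x, Filter.Tendsto (fun n => x * p n) Filter.atTop (nhds x)) : IsStablyUnital A := by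
  intro ν hν
  refine ⟨Filter.map (fun n => MInf.diag n (p n)) Filter.atTop, inferInstance, ?_, fun x => ?_⟩
  · refine Filter.eventually_map.2 (Filter.Eventually.of_forall fun n => ?_)
    ext i j
    rw [MInf.diag_mul_apply]
    change _ = if i = j ∧ i < n then p n else 0
    change (if i < n then p n * (if i = j ∧ i < n then p n else 0) else 0) = _
    rcases eq_or_ne i j with rfl | hij
    · simp only [true_and, mul_ite, mul_zero, hp]
      split_ifs <;> rfl
    · simp only [hij, false_and, if_false, mul_zero, ite_self]
  · obtain ⟨r, hx⟩ := x.2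
    rw [Filter.tendsto_map'_iff, Filter.tendsto_map'_iff]
    have hsub : ∀ (y : MInf A) i j, (y - x).1 i j = y.1 i j - x.1 i j := fun _ _ _ => rfl
    refine ⟨hν.tendsto_zero r (Filter.Eventually.of_forall fun n i j hij => ?_) fun i j => ?_,
      hν.tendsto_zero r (Filter.Eventually.of_forall fun n i j hij => ?_) fun i j => ?_⟩
    · rw [hsub, MInf.diag_mul_apply, hx i j hij, mul_zero, ite_self, sub_zero]
    · have h := (hl (x.1 i j)).sub_const (x.1 i j)
      rw [sub_self] at h
      refine h.congr' ?_
      filter_upwards [Filter.eventually_gt_atTop i] with n hn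
      rw [hsub, MInf.diag_mul_apply, if_pos hn]
    · rw [hsub, MInf.mul_diag_apply, hx i j hij, zero_mul, ite_self, sub_zero]
    · have h := (hr (x.1 i j)).sub_const (x.1 i j)
      rw [sub_self] at h
      refine h.congr' ?_
      filter_upwards [Filter.eventually_gt_atTop j] with n hn
      rw [hsub, MInf.mul_diag_apply, if_pos hn]

end StablyUnital

/-! ### Direct sums of bounded operators -/

section DirectSumBounded

variable {ι : Type*} [Fintype ι] [DecidableEq ι] {K : ι → Type*} [∀ i, NormedAddCommGroup (K i)]
  [∀ i, InnerProductSpace ℂ (K i)]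

theorem corner_directSumCLM (T : ∀ i, K i →L[ℂ] K i) (i : ι) :
    corner K i (directSumCLM T) = T i := by
  ext ξ
  change T i (inclCLM K i ξ i) = T i ξ
  rw [inclCLM_apply, Pi.single_eq_same]

theorem isSelfAdjoint_directSumCLM [∀ i, CompleteSpace (K i)] {T : ∀ i, K i →L[ℂ] K i}
    (hT : ∀ i, IsSelfAdjoint (T i)) : IsSelfAdjoint (directSumCLM T) := by
  rw [ContinuousLinearMap.isSelfAdjoint_iff_isSymmetric]
  intro x y
  change inner ℂ (directSumCLM T x) y = inner ℂ x (directSumCLM T y)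
  rw [PiLp.inner_apply, PiLp.inner_apply]
  exact Finset.sum_congr rfl fun i _ =>
    (ContinuousLinearMap.isSelfAdjoint_iff_isSymmetric.1 (hT i)) (x i) (y i)

theorem finiteDimensional_range_directSumCLM {T : ∀ i, K i →L[ℂ] K i}
    (hT : ∀ i, FiniteDimensional ℂ (LinearMap.range (T i).toLinearMap)) :
    FiniteDimensional ℂ (LinearMap.range (directSumCLM T).toLinearMap) := by
  refine Submodule.finiteDimensional_of_le (S₂ :=
    ⨆ i, (LinearMap.range (T i).toLinearMap).map (inclCLM K i).toLinearMap) ?_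
  rintro _ ⟨ξ, rfl⟩
  have h : (directSumCLM T).toLinearMap ξ = ∑ i, inclCLM K i (T i (ξ i)) :=
    (sum_inclCLM (directSumCLM T ξ)).symm
  rw [h]
  exact Submodule.sum_mem _ fun i _ => Submodule.mem_iSup_of_mem i ⟨_, ⟨_, rfl⟩, rfl⟩

theorem tendsto_directSumCLM {T : ℕ → ∀ i, K i →L[ℂ] K i}
    (hT : ∀ i ξ, Filter.Tendsto (fun n => T n i ξ) Filter.atTop (nhds ξ)) (ξ : PiLp 2 K) :
    Filter.Tendsto (fun n => directSumCLM (T n) ξ) Filter.atTop (nhds ξ) := by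
  have h : Filter.Tendsto (fun n i => T n i (ξ i)) Filter.atTop (nhds (WithLp.ofLp ξ)) :=
    tendsto_pi_nhds.2 fun i => hT i (ξ i)
  exact ((PiLp.continuous_toLp 2 K).tendsto _).comp h

theorem IsDerivation.directSum {D : ∀ i, K i →ₗ.[ℂ] K i} {T T' : ∀ i, K i →L[ℂ] K i}
    (h : ∀ i, IsDerivation (D i) (T i) (T' i)) :
    IsDerivation (directSumOp D) (directSumCLM T) (directSumCLM T') := by
  intro ξ
  choose hm he using fun i => h i ⟨ξ.1 i, ξ.2 i⟩
  refine ⟨hm, ?_⟩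
  ext i
  exact he i

end DirectSumBounded

/-! ### The energy cutoff projections in the algebra -/

namespace LevelData

variable {d : ℕ} {G : Type*} [TopologicalSpace G] [ChartedSpace (ModelE d) G] [Group G]
  [LieGroup 𝓘(ℝ, ModelE d) ∞ G] {ℓ : ℕ} (S : LevelData.{u, v} d G ℓ)

/-- For `hv = 0` the form `normForm hv` would vanish, and could not have an orthonormal basis unless
the Lie algebra is trivial. -/
theorem hv_ne_zero (hG : LieAlgebra.IsSimple ℝ (LieAlg d G)) : S.hv ≠ 0 := by
  intro h0
  rcases Nat.eq_zero_or_pos d with rfl | hd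
  · refine hG.non_abelian ⟨fun x y => ?_⟩
    have : Subsingleton (LieAlg 0 G) := inferInstanceAs (Subsingleton (ModelE 0))
    exact Subsingleton.elim _ _
  · have h := S.e_orthonormal ⟨0, hd⟩ ⟨0, hd⟩
    rw [normForm, h0, if_pos rfl] at h
    simp at h

/-- The conformal Hamiltonian on the tensor product for the `i`-th representation. -/
noncomputable def hatEnergy (i : Fin S.N) : S.HHat i →ₗ.[ℂ] S.HHat i :=
  closedOp (hatL0 S.e (S.rep i).toAffineRep (S.rep 0).toAffineRep S.ramond)

/-- The spectral projection of the conformal Hamiltonian of the `i`-th representation. -/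
noncomputable def cutoff (i : Fin S.N) (c : ℝ) : (S.rep i).Hilb →L[ℂ] (S.rep i).Hilb :=
  spectralProj (closedOp ((S.rep i).L0 S.e)) c

/-- As `Ω` and `ψ` are energy eigenvectors, `ξ ↦ ξ ⊗ Ω ⊗ ψ` intertwines the energy cutoffs up to a
shift of the cutoff by the energy of `Ω ⊗ ψ`. -/
theorem exists_spectralProj_emb (hhv : S.hv ≠ 0) : ∃ s : ℝ, ∀ i c ξ,
    spectralProj (S.hatEnergy i) (c + s) (S.emb i ξ) = S.emb i (S.cutoff i c ξ) := by
  obtain ⟨h₀, -, hΩ, -⟩ := S.Ω_lowest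
  refine ⟨h₀ + d / 8, fun i c ξ => ?_⟩
  have hψ : S.ramond.L0 S.ψ = ((d / 8 : ℝ) : ℂ) • S.ψ := by
    rw [S.ψ_lowest]
    push_cast
    rfl
  refine denseRange_toHilb.induction_on (p := fun ξ => spectralProj (S.hatEnergy i)
    (c + (h₀ + d / 8)) (S.emb i ξ) = S.emb i (S.cutoff i c ξ)) ξ
    (isClosed_eq (by fun_prop) (by fun_prop)) fun u => ?_
  refine ((S.rep i).isDiagonalizable_L0 S.e_orthonormal hhv).induction (p := fun u =>
    spectralProj (S.hatEnergy i) (c + (h₀ + d / 8)) (S.emb i (toHilb u)) =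
      S.emb i (S.cutoff i c (toHilb u))) ?_ (fun x y hx hy => ?_) (fun a x hx => ?_)
    (fun h x hx => ?_) u
  · simp only [map_zero]
  · simp only [map_add, hx, hy]
  · simp only [map_smul, hx]
  · have hx' := hatL0_eigenvector (e := S.e) (π := (S.rep i).toAffineRep) hx hΩ hψ
    rcases lt_or_ge h c with hc | hc
    · rw [cutoff, spectralProj_toHilb_of_lt hc hx, emb_toHilb]
      exact spectralProj_toHilb_of_lt (by linarith) hx'
    · rw [cutoff, spectralProj_toHilb_of_le (S.rep i).L0_symm hc hx, emb_toHilb, map_zero]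
      exact spectralProj_toHilb_of_le hatL0_symm (by linarith) hx'

/-- The range of an energy cutoff is finite dimensional and consists of finite energy vectors. -/
theorem exists_finiteDimensional_core (hhv : S.hv ≠ 0) (i : Fin S.N) (c : ℝ) :
    ∃ W : Submodule ℂ (S.rep i).V, FiniteDimensional ℂ W ∧ ∀ ξ,
      S.cutoff i c ξ ∈ W.map (toHilb : (S.rep i).V →ₗᵢ[ℂ] _).toLinearMap := by
  obtain ⟨ι, b, h, hb, hspan, hfin⟩ := (S.rep i).exists_energy_basis S.e_orthonormal hhv
  exact ⟨_, hfin c, spectralProj_mem_map_toHilb (S.rep i).L0_symm hb hspan c (hfin c)⟩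

theorem finiteDimensional_range_cutoff (hhv : S.hv ≠ 0) (i : Fin S.N) (c : ℝ) :
    FiniteDimensional ℂ (LinearMap.range (S.cutoff i c).toLinearMap) := by
  obtain ⟨W, hW, h⟩ := S.exists_finiteDimensional_core hhv i c
  refine Submodule.finiteDimensional_of_le (S₂ := W.map (toHilb : (S.rep i).V →ₗᵢ[ℂ] _).toLinearMap)
    ?_
  rintro _ ⟨ξ, rfl⟩
  exact h ξ

/-- The spectral projection of the conformal Hamiltonian of the reduced representation, as an
element of the reduced universal algebra. -/
noncomputable def energyProj (c : ℝ) : S.BAlg :=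
  ⟨directSumCLM fun i => S.cutoff i c, S.directSumCLM_mem_BAlg _⟩

theorem coe_energyProj (c : ℝ) :
    (S.energyProj c : S.HRed →L[ℂ] S.HRed) = spectralProj S.L0Red c :=
  (spectralProj_directSumOp (fun i => closedOp ((S.rep i).L0 S.e)) c).symm

theorem energyProj_mul_self (c : ℝ) : S.energyProj c * S.energyProj c = S.energyProj c := by
  refine Subtype.ext ?_
  change (S.energyProj c : S.HRed →L[ℂ] S.HRed) * (S.energyProj c : S.HRed →L[ℂ] S.HRed) = _
  rw [coe_energyProj, spectralProj_mul_self]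

theorem finiteDimensional_range_energyProj (hhv : S.hv ≠ 0) (c : ℝ) : FiniteDimensional ℂ
    (LinearMap.range (S.energyProj c : S.HRed →L[ℂ] S.HRed).toLinearMap) :=
  finiteDimensional_range_directSumCLM fun i => S.finiteDimensional_range_cutoff hhv i c

theorem hatPi_energyProj (i : Fin S.N) (c : ℝ) : S.hatPi i (S.energyProj c) =
    S.emb i ∘L S.cutoff i c ∘L ContinuousLinearMap.adjoint (S.emb i) := by
  rw [hatPi, piRep, energyProj, corner_directSumCLM]

theorem hatPiRed_apply (x : S.BAlg) (ξ : S.HHatRed) (i : Fin S.N) : S.hatPiRed x ξ i =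
    S.emb i (S.piRep i x (ContinuousLinearMap.adjoint (S.emb i) (ξ i))) := rfl

theorem hatPiRed_energyProj (c : ℝ) : S.hatPiRed (S.energyProj c) = directSumCLM fun i =>
    S.emb i ∘L S.cutoff i c ∘L ContinuousLinearMap.adjoint (S.emb i) :=
  congrArg directSumCLM (funext fun i => S.hatPi_energyProj i c)

theorem hatPiRed_energyProj_apply (c : ℝ) (ξ : S.HHatRed) (i : Fin S.N) :
    S.hatPiRed (S.energyProj c) ξ i =
      S.emb i (S.cutoff i c (ContinuousLinearMap.adjoint (S.emb i) (ξ i))) := by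
  rw [hatPiRed_energyProj]
  rfl

theorem dirac_symmetric (i : Fin S.N) (x y : (S.dirac i).domain) :
    inner ℂ (S.dirac i x) (y : S.HHat i) = inner ℂ (x : S.HHat i) (S.dirac i y) :=
  closedOp_symmetric (superG0_symm S.e_orthonormal) x y

theorem isSelfAdjoint_cutoff (i : Fin S.N) (c : ℝ) : IsSelfAdjoint (S.cutoff i c) :=
  spectralProj_isSelfAdjoint _ c

theorem isSelfAdjoint_emb_cutoff (i : Fin S.N) (c : ℝ) : IsSelfAdjoint
    (S.emb i ∘L S.cutoff i c ∘L ContinuousLinearMap.adjoint (S.emb i)) :=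
  (S.isSelfAdjoint_cutoff i c).conj_adjoint (S.emb i)

/-- The range of the projection `π̂_red (e)` consists of vectors `u ⊗ Ω ⊗ ψ` with `u` of finite
energy, on which the Dirac operator is defined. -/
theorem exists_isDerivation_energyProj (hhv : S.hv ≠ 0) (c : ℝ) :
    ∃ y, IsDerivation S.diracRed.op (S.hatPiRed (S.energyProj c)) y ∧ IsCompactOperator y := by
  refine exists_isDerivation_of_finiteRank (directSumOp_symmetric S.dirac_symmetric) ?_ ?_ ?_ ?_
  · rw [hatPiRed_energyProj]
    exact isSelfAdjoint_directSumCLM fun i => S.isSelfAdjoint_emb_cutoff i c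
  · exact (map_mul S.hatPiRed _ _).symm.trans
      (congrArg S.hatPiRed (S.energyProj_mul_self c))
  · rw [hatPiRed_energyProj]
    refine finiteDimensional_range_directSumCLM fun i => ?_
    have h := S.finiteDimensional_range_cutoff hhv i c
    refine Submodule.finiteDimensional_of_le (S₂ :=
      (LinearMap.range (S.cutoff i c).toLinearMap).map (S.emb i).toLinearMap) ?_
    rintro _ ⟨ξ, rfl⟩
    exact ⟨_, ⟨_, rfl⟩, rfl⟩
  · intro ξ i
    rw [hatPiRed_energyProj]
    obtain ⟨W, -, hW⟩ := S.exists_finiteDimensional_core hhv i c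
    obtain ⟨u, -, hu⟩ := hW (ContinuousLinearMap.adjoint (S.emb i) (ξ i))
    change S.emb i (S.cutoff i c (ContinuousLinearMap.adjoint (S.emb i) (ξ i))) ∈ _
    rw [← hu]
    change S.emb i (toHilb u) ∈ _
    rw [emb_toHilb]
    exact toHilb_mem_closedOp _ _

/-- The energy cutoff projections as elements of the compact differentiable algebra. -/
noncomputable def energyIdem (hhv : S.hv ≠ 0) (c : ℝ) : S.KOne :=
  ⟨⟨S.energyProj c,
    isCompactOperator_of_range_finiteDimensional (S.finiteDimensional_range_energyProj hhv c),
    S.exists_isDerivation_energyProj hhv c⟩⟩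

theorem toOp_energyIdem (hhv : S.hv ≠ 0) (c : ℝ) :
    (S.energyIdem hhv c).toOp = spectralProj S.L0Red c := S.coe_energyProj c

theorem energyIdem_mul_self (hhv : S.hv ≠ 0) (c : ℝ) :
    S.energyIdem hhv c * S.energyIdem hhv c = S.energyIdem hhv c :=
  (DiffAlg.equiv S.hatPiRed S.diracRed S.norm_hatPiRed_le).injective
    (Subtype.ext (S.energyProj_mul_self c))

theorem tendsto_energyIdem (hhv : S.hv ≠ 0) (ξ : S.HRed) :
    Filter.Tendsto (fun n : ℕ => (S.energyIdem hhv n).toOp ξ) Filter.atTop (nhds ξ) :=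
  tendsto_directSumCLM (T := fun n i => S.cutoff i n) (fun i => spectralProj_tendsto
    (S.rep i).L0_symm ((S.rep i).isDiagonalizable_L0 S.e_orthonormal hhv)
    tendsto_natCast_atTop_atTop) ξ

/-- The energy cutoff on `⊕ᵢ Hᵢ ⊗ H₀ ⊗ H_R`. -/
noncomputable def hatCutoff (c : ℝ) : S.HHatRed →L[ℂ] S.HHatRed :=
  directSumCLM fun i => spectralProj (S.hatEnergy i) c

theorem norm_hatCutoff_le (c : ℝ) : ‖S.hatCutoff c‖ ≤ 1 :=
  norm_directSumCLM_le _ 1 zero_le_one fun _ => spectralProj_norm_le _ _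

theorem isSelfAdjoint_hatCutoff (c : ℝ) : IsSelfAdjoint (S.hatCutoff c) :=
  isSelfAdjoint_directSumCLM fun _ => spectralProj_isSelfAdjoint _ _

theorem tendsto_hatCutoff (hhv : S.hv ≠ 0) (s : ℝ) (ξ : S.HHatRed) :
    Filter.Tendsto (fun n : ℕ => S.hatCutoff (n + s) ξ) Filter.atTop (nhds ξ) :=
  tendsto_directSumCLM (T := fun n i => spectralProj (S.hatEnergy i) (n + s))
    (fun i => spectralProj_tendsto hatL0_symm (isDiagonalizable_hatL0
      ((S.rep i).isDiagonalizable_L0 S.e_orthonormal hhv)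
      ((S.rep 0).isDiagonalizable_L0 S.e_orthonormal hhv))
      (tendsto_natCast_atTop_atTop.atTop_add tendsto_const_nhds)) ξ

/-- The energy cutoff commutes with the Dirac operator. -/
theorem isDerivation_hatCutoff (hhv : S.hv ≠ 0) (c : ℝ) :
    IsDerivation S.diracRed.op (S.hatCutoff c) 0 := by
  have h : IsDerivation S.diracRed.op (S.hatCutoff c) (directSumCLM fun _ => 0) := by
    refine IsDerivation.directSum fun i ξ => ?_
    obtain ⟨hm, he⟩ := spectralProj_commute hatL0_symm (isDiagonalizable_hatL0
      ((S.rep i).isDiagonalizable_L0 S.e_orthonormal hhv)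
      ((S.rep 0).isDiagonalizable_L0 S.e_orthonormal hhv)) (superG0_symm S.e_orthonormal)
      (hatL0_superG0 S.e_orthonormal hhv) c ξ
    refine ⟨hm, he.symm.trans ?_⟩
    exact (sub_zero _).symm
  exact h

/-- The image of `π̂_red` lives on the vectors `ξ ⊗ Ω ⊗ ψ`, where the degenerate projection
`π̂_red (e)` agrees with the energy cutoff on the whole tensor product. -/
theorem hatPiRed_energyProj_mul {c c' : ℝ} (h : ∀ i ξ,
    spectralProj (S.hatEnergy i) c' (S.emb i ξ) = S.emb i (S.cutoff i c ξ)) (x : S.BAlg) :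
    S.hatPiRed (S.energyProj c) * S.hatPiRed x = S.hatCutoff c' * S.hatPiRed x := by
  refine ContinuousLinearMap.ext fun ξ => PiLp.ext fun i => ?_
  refine (S.hatPiRed_energyProj_apply c (S.hatPiRed x ξ) i).trans ?_
  refine Eq.trans ?_ (directSumCLM_apply (fun i => spectralProj (S.hatEnergy i) c')
    (S.hatPiRed x ξ) i).symm
  rw [hatPiRed_apply, adjoint_emb_emb, h]

/-- The adjoint of the relation `h`. -/
theorem adjoint_emb_spectralProj {c c' : ℝ} (i : Fin S.N) (h : ∀ ξ,
    spectralProj (S.hatEnergy i) c' (S.emb i ξ) = S.emb i (S.cutoff i c ξ)) (ξ : S.HHat i) :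
    ContinuousLinearMap.adjoint (S.emb i) (spectralProj (S.hatEnergy i) c' ξ) =
      S.cutoff i c (ContinuousLinearMap.adjoint (S.emb i) ξ) := by
  refine ext_inner_left ℂ fun η => ?_
  have h1 := ContinuousLinearMap.isSelfAdjoint_iff_isSymmetric.1
    (spectralProj_isSelfAdjoint (S.hatEnergy i) c') (S.emb i η) ξ
  have h2 := ContinuousLinearMap.isSelfAdjoint_iff_isSymmetric.1
    (S.isSelfAdjoint_cutoff i c) η (ContinuousLinearMap.adjoint (S.emb i) ξ)
  refine (ContinuousLinearMap.adjoint_inner_right (S.emb i) η _).trans (h1.symm.trans ?_)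
  refine (congrArg (fun z => inner ℂ z ξ) (h η)).trans (Eq.trans ?_ h2)
  exact (ContinuousLinearMap.adjoint_inner_right (S.emb i) _ ξ).symm

theorem mul_hatPiRed_energyProj {c c' : ℝ} (h : ∀ i ξ,
    spectralProj (S.hatEnergy i) c' (S.emb i ξ) = S.emb i (S.cutoff i c ξ)) (x : S.BAlg) :
    S.hatPiRed x * S.hatPiRed (S.energyProj c) = S.hatPiRed x * S.hatCutoff c' := by
  refine ContinuousLinearMap.ext fun ξ => PiLp.ext fun i => ?_
  refine (S.hatPiRed_apply x (S.hatPiRed (S.energyProj c) ξ) i).trans ?_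
  refine Eq.trans ?_ (S.hatPiRed_apply x (S.hatCutoff c' ξ) i).symm
  rw [hatPiRed_energyProj_apply, adjoint_emb_emb, hatCutoff, directSumCLM_apply,
    S.adjoint_emb_spectralProj i (h i)]

theorem completeSpace_KOne : CompleteSpace S.KOne :=
  DiffAlg.completeSpace S.isClosed_BAlg
    (directSumOp_isClosed fun _ => closedOp_isClosed (superG0_symm S.e_orthonormal))

theorem tendsto_energyIdem_mul (hhv : S.hv ≠ 0) (x : S.KOne) :
    Filter.Tendsto (fun n : ℕ => S.energyIdem hhv n * x) Filter.atTop (nhds x) ∧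
      Filter.Tendsto (fun n : ℕ => x * S.energyIdem hhv n) Filter.atTop (nhds x) := by
  obtain ⟨s, hs⟩ := S.exists_spectralProj_emb hhv
  have hnorm : ∀ n : ℕ, ‖(S.energyIdem hhv n).toOp‖ ≤ 1 := fun n => by
    rw [toOp_energyIdem]
    exact spectralProj_norm_le _ _
  have hsa : ∀ n : ℕ, IsSelfAdjoint (S.energyIdem hhv n).toOp := fun n => by
    rw [toOp_energyIdem]
    exact spectralProj_isSelfAdjoint _ _
  have hl : ∀ (n : ℕ) (x : S.KOne), S.hatPiRed (S.energyProj n) * S.hatPiRed x.elt =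
      S.hatCutoff (n + s) * S.hatPiRed x.elt := fun n x => S.hatPiRed_energyProj_mul (hs · n) x.elt
  have hr : ∀ (n : ℕ) (x : S.KOne), S.hatPiRed x.elt * S.hatPiRed (S.energyProj n) =
      S.hatPiRed x.elt * S.hatCutoff (n + s) := fun n x => S.mul_hatPiRed_energyProj (hs · n) x.elt
  exact ⟨DiffAlg.tendsto_mul_left hnorm (S.tendsto_energyIdem hhv)
      (fun n => S.norm_hatCutoff_le _) (S.tendsto_hatCutoff hhv s)
      (fun n => S.isDerivation_hatCutoff hhv _) hl x,
    DiffAlg.tendsto_mul_right hnorm hsa (S.tendsto_energyIdem hhv)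
      (fun n => S.norm_hatCutoff_le _) (fun n => S.isSelfAdjoint_hatCutoff _)
      (S.tendsto_hatCutoff hhv s) (fun n => S.isDerivation_hatCutoff hhv _) hr x⟩

end LevelData

theorem mainTheorem10 {d : ℕ} {G : Type*} [TopologicalSpace G] [T2Space G] [CompactSpace G]
    [SimplyConnectedSpace G] [ChartedSpace (ModelE d) G] [Group G]
    [LieGroup 𝓘(ℝ, ModelE d) ∞ G] (hG : LieAlgebra.IsSimple ℝ (LieAlg d G))
    {ℓ : ℕ} (hℓ : 0 < ℓ) (S : LevelData.{u, v} d G ℓ) :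
    CompleteSpace S.KOne ∧
    IsStablyUnital S.KOne ∧
    (∃ p : ℕ → S.KOne,
      (∀ n, (p n).toOp = spectralProj S.L0Red n ∧
        FiniteDimensional ℂ (LinearMap.range (p n).toOp.toLinearMap) ∧ p n * p n = p n) ∧
      ∀ x : S.KOne, Filter.Tendsto (fun n => p n * x) Filter.atTop (nhds x) ∧
        Filter.Tendsto (fun n => x * p n) Filter.atTop (nhds x)) ∧
    Dense {x : S.KOne | FiniteDimensional ℂ (LinearMap.range x.toOp.toLinearMap)} := by
  have hhv := S.hv_ne_zero hG
  have hp := S.tendsto_energyIdem_mul hhv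
  refine ⟨S.completeSpace_KOne,
    isStablyUnital_of_tendsto (fun n : ℕ => S.energyIdem_mul_self hhv n) (fun x => (hp x).1)
      fun x => (hp x).2,
    ⟨fun n => S.energyIdem hhv n, fun n => ⟨S.toOp_energyIdem hhv n,
      S.finiteDimensional_range_energyProj hhv n, S.energyIdem_mul_self hhv n⟩, hp⟩, fun x => ?_⟩
  refine mem_closure_of_tendsto (hp x).1 (Filter.Eventually.of_forall fun n => ?_)
  have h := S.finiteDimensional_range_energyProj hhv n
  refine Submodule.finiteDimensional_of_le (S₂ := LinearMap.range
    (S.energyProj n : S.HRed →L[ℂ] S.HRed).toLinearMap) ?_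
  rintro _ ⟨ξ, rfl⟩
  exact ⟨x.toOp ξ, rfl⟩
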